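/- Let $M>0$. Let $r=r(u)\in(2M,\infty)$ be the inverse of the Regge–Wheeler coordinate $u(r)=r+2M\log\left(\frac{r}{2M}-1\right)$, $u\in\mathbb R$, and let $V_0(u)=\left(1-\frac{2M}{r(u)}\right)\frac{2M}{r(u)^3}$. For $\omega\in\mathbb R\setminus\{0\}$ let $\phi_\omega=\sum_{k\ge0}\phi^{(k)}_\omega$, where $$\phi^{(0)}_\omega(u)=e^{-i\omega u},\qquad \phi^{(k+1)}_\omega(u)=-\int_u^\infty\frac1\omega\sin(\omega(u-v))\,V_0(v)\,\phi^{(k)}_\omega(v)\,dv ,$$ be the Jost solution of $-\phi''+(V_0-\omega^2)\phi=0$ with $e^{i\omega u}\phi_\omega(u)\to1$ and $(e^{i\omega u}\phi_\omega(u))'\to0$ as $u\to+\infty$. Let $\log$ be the principal branch of the logarithm. Then there are real constants $c_{ijk}$ (depending only on $M$), for $1\le i=j+k\le4$, such that for every integer $\kappa$ there are functions $g_0,h_0$ and $g_{ijk},h_{ijk}$, $1\le j+k\le i\le4$, of $(\omega,u)\in\mathbb R\times\mathbb R$ with the following properties for every fixed $u\in\mathbb R$. 1. The functions $g_0,h_0,g_{ijk},h_{ijk}$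 are of class $C^4(\mathbb R)$ with respect to $\omega$. 2. For all $\omega\in\mathbb R\setminus\{0\}$, $$\phi_\omega(u)=e^{-i\omega u}+g_0(\omega,u)+\sum_{1\le j+k\le i\le4}(2i\omega)^i\log^j(2i\omega)\log^k(-2i\omega)\,g_{ijk}(\omega,u),$$ $$\phi_\omega'(u)=-i\omega e^{-i\omega u}+h_0(\omega,u)+\sum_{1\le j+k\le i\le4}(2i\omega)^i\log^j(2i\omega)\log^k(-2i\omega)\,h_{ijk}(\omega,u),$$ where the prime is the derivative in $u$ (in the factor $2i\omega$ the letter $i$ is the imaginary unit; as exponent and index it is an integer). 3. For $1\le i=j+k\le4$, as $\omega\to0$, $\omega\neq 0$: if $i$ is even, $$g_{ijk}(\omega,u)=c_{ijk}\left(e^{-i\omega u}+g_0(\omega,u)\right)+o(\omega^\kappa),\qquad h_{ijk}(\omega,u)=c_{ijk}\,h_0(\omega,u)+o(\omega^\kappa),$$ and if $i$ is odd, $$g_{ijk}(\omega,u)=c_{ijk}\left(e^{i\omega u}+\overline{g_0(\omega,u)}\right)+o(\omega^\kappa),\qquad h_{ijk}(\omega,u)=c_{ijk}\,\overline{h_0(\omega,u)}+o(\omega^\kappa).$$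 -/

import Mathlib

open Filter Topology Asymptotics

noncomputable section

/-- The Regge-Wheeler coordinate `u(r) = r + 2M log (r / (2M) - 1)`, for `r > 2M`. -/
def reggeWheeler (M r : ℝ) : ℝ := r + 2 * M * Real.log (r / (2 * M) - 1)

/-- The Regge-Wheeler coordinate is a bijection from the exterior `(2M, ∞)` onto `ℝ`. -/
theorem reggeWheeler_bijOn {M : ℝ} (hM : 0 < M) :
    Set.BijOn (reggeWheeler M) (Set.Ioi (2 * M)) Set.univ := by
  have h2 : 0 < 2 * M := by positivity
  refine ⟨fun _ _ => Set.mem_univ _, ?_, ?_⟩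
  · refine StrictMonoOn.injOn fun a ha b hb hab => ?_
    have ha' : 1 < a / (2 * M) := (one_lt_div h2).2 ha
    have h : a / (2 * M) < b / (2 * M) := div_lt_div_of_pos_right hab h2
    have hl := Real.log_lt_log (by linarith : 0 < a / (2 * M) - 1)
      (by linarith : a / (2 * M) - 1 < b / (2 * M) - 1)
    unfold reggeWheeler
    nlinarith [mul_lt_mul_of_pos_left hl h2]
  · intro u _
    have hc : Continuous fun t : ℝ => 2 * M * (1 + Real.exp t) + 2 * M * t := by fun_prop
    have htop : Tendsto (fun t : ℝ => 2 * M * (1 + Real.exp t) + 2 * M * t) atTop atTop := by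
      refine tendsto_atTop_mono (fun t => ?_) (tendsto_id.const_mul_atTop h2)
      have := mul_pos h2 (add_pos one_pos (Real.exp_pos t))
      simp only [id]
      linarith
    have hbot : Tendsto (fun t : ℝ => 2 * M * (1 + Real.exp t) + 2 * M * t) atBot atBot := by
      have h1 : Tendsto (fun t : ℝ => 2 * M * (1 + Real.exp t)) atBot (𝓝 (2 * M * (1 + 0))) :=
        (Real.tendsto_exp_atBot.const_add 1).const_mul (2 * M)
      exact h1.add_atBot (tendsto_id.const_mul_atBot h2)
    obtain ⟨t, ht⟩ := hc.surjective htop hbot u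
    refine ⟨2 * M * (1 + Real.exp t), ?_, ?_⟩
    · have := mul_pos h2 (Real.exp_pos t)
      simp only [Set.mem_Ioi]
      linarith
    · have h3 : 2 * M * (1 + Real.exp t) / (2 * M) - 1 = Real.exp t := by
        field_simp
        ring
      simp only [reggeWheeler, h3, Real.log_exp]
      exact ht

/-- The Schwarzschild radius `r(u) > 2M` as a function of the Regge-Wheeler coordinate. -/
def schwarzschildRadius (M u : ℝ) : ℝ :=
  Function.invFunOn (reggeWheeler M) (Set.Ioi (2 * M)) u

/-- The potential `V_l(u) = (1 - 2M / r) (2M / r³ + l (l + 1) / r²)`, with `r = r(u)`. -/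
def potential (M : ℝ) (l : ℕ) (u : ℝ) : ℝ :=
  (1 - 2 * M / schwarzschildRadius M u) *
    (2 * M / schwarzschildRadius M u ^ 3 + l * (l + 1) / schwarzschildRadius M u ^ 2)

/-- The iteration of the Jost equation with boundary conditions at `+∞`, for `l = 0`:
`φ⁽⁰⁾(u) = e^{-iωu}`, `φ⁽ᵏ⁺¹⁾(u) = -∫_u^∞ (1/ω) sin(ω(u - v)) V_0(v) φ⁽ᵏ⁾(v) dv`. -/
def jostIter (M ω : ℝ) : ℕ → ℝ → ℂ
  | 0, u => Complex.exp (-(Complex.I * ω * u))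
  | k + 1, u =>
      -∫ v in Set.Ioi u,
        ((1 / ω * Real.sin (ω * (u - v)) * potential M 0 v : ℝ) : ℂ) * jostIter M ω k v

/-- The Jost solution for `l = 0` and real `ω ≠ 0`: the sum of the iteration series. It is the
solution of `-φ'' + (V_0 - ω²) φ = 0` that satisfies `e^{iωu} φ(u) → 1` and
`(e^{iωu} φ(u))' → 0` as `u → +∞`. -/
def jost (M ω u : ℝ) : ℂ := ∑' k : ℕ, jostIter M ω k u

/-- The sum over `1 ≤ j + k ≤ i ≤ n` of `(2iω)^i log^j(2iω) log^k(-2iω) g_{ijk}(ω, u)`, with the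
principal branch of the logarithm. -/
def logSum (n : ℕ) (g : ℕ → ℕ → ℕ → ℝ → ℝ → ℂ) (ω u : ℝ) : ℂ :=
  ∑ i ∈ Finset.Icc 1 n, ∑ m ∈ Finset.Icc 1 i, ∑ p ∈ Finset.HasAntidiagonal.antidiagonal m,
    (2 * Complex.I * ω) ^ i * Complex.log (2 * Complex.I * ω) ^ p.1 *
      Complex.log (-(2 * Complex.I * ω)) ^ p.2 * g i p.1 p.2 ω u

end

/-! Put `a = 2M`, `z = 2iω` and `φ = e^{-zu/2} m(r)`. Then `m` solves a confluent Heun equation and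
is `1` plus the Laplace transform in `r` of a function `D` that solves a Volterra equation
(`borel_volterra`, `borelLaplace_ode`). `D` has exponential type at most `2a` and is holomorphic in
`z` for `|arg z| < 3π/4`, a sector that contains `z = 2iω` for both signs of `ω`. Uniqueness for the
Volterra equation in `u` identifies the result with the iteration series (`jost_eq_of_tendsto`).

All nonanalyticity at `ω = 0` is concentrated in one vector. Relative to the two zero-energy
solutions, the coordinates of `φ` satisfy `c' = (z²/4) A c`, so transport in `u` is entire in `ω²`.
At the base point `r = 4a` the coordinates are `v(log z)`. To continue `v` around `z = 0`, `r` is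
turned along `|r| = 4a` against `arg z`, so that `zr` stays in the half-plane of convergence, and
the coordinates are transported back to `r = 4a`. Thus `v` is entire in `ζ = log z`, with `v(ζ +
2πi) = Mh(z) v(ζ)`. The monodromy `Mh` is entire, and `Mh(z) = 1 + πiaz + O(z²)`: the linear term
comes from the logarithm in `u`, while the transport contributes only `O(z²)`.

Taking a logarithm of `Mh` and removing a singularity gives `v(log z) = exp(log z · G(z)) w(z)` with
`G`, `w` analytic and `G(z) = Mz + O(z²)` (`exists_monodromy_factorization`, `exists_jost_coord`).
Hence `φ` is a series in `z log z` with analytic coefficients `f_j(z)`, and `f_j(0) = (M^j / j!)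
f_0(0)` because `G'(0)` is scalar (`exists_exp_expansion`). The same holds for `φ' + iω e^{-iωu}`.
In particular only powers of `log(2iω)` are needed, and every coefficient with `k > 0` can be zero.

It remains to distribute this expansion among `C⁴` coefficients (`exists_log_expansion`). The top
coefficients should be `c_j` times the regular part or its conjugate, which is a fixed-point
equation for the regular part. Starting from a Taylor polynomial, each iteration of that equation
improves the error by at least `|ω|^{1/2}`, so finitely many reach any prescribed `κ`. Compatibility
at lowest order for odd `j` requires `f_0(0)` to be real, which follows from `φ_{-ω} = conj φ_ω`.
Cauchy estimates in a double sector around the real axis turn the remainder bound `O(|ω|^{9/2})`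
into `C⁴` regularity. -/

noncomputable section

/-! ### Holomorphic dependence of integrals on parameters. -/

open MeasureTheory in
/-- A parametric integral of a dominated family of holomorphic functions is holomorphic. -/
theorem differentiableAt_integral_of_dominated {α E : Type*} [MeasurableSpace α] {μ : Measure α}
    [NormedAddCommGroup E] [NormedSpace ℂ E] [CompleteSpace E] {F : ℂ → α → E} {z₀ : ℂ}
    {s : Set ℂ} (hs : s ∈ 𝓝 z₀) {bound : α → ℝ}
    (hmeas : ∀ z ∈ s, AEStronglyMeasurable (F z) μ)
    (hdiff : ∀ᵐ a ∂μ, DifferentiableOn ℂ (F · a) s)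
    (hb : ∀ᵐ a ∂μ, ∀ z ∈ s, ‖F z a‖ ≤ bound a) (hi : Integrable bound μ) :
    DifferentiableAt ℂ (fun z => ∫ a, F z a ∂μ) z₀ := by
  obtain ⟨R', hR', hball⟩ := Metric.mem_nhds_iff.1 hs
  -- One third leaves room: closed `R`-discs about points of the `R`-disc stay in `s`, so Cauchy's
  -- estimate bounds the derivative of the integrand by `bound a / R`.
  set R := R' / 3 with hR
  have hRpos : 0 < R := by positivity
  have hsub : ∀ z ∈ Metric.ball z₀ R, Metric.closedBall z R ⊆ s := by
    intro z hz w hw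
    apply hball
    have h1 := Metric.mem_ball.1 hz
    have h2 := Metric.mem_closedBall.1 hw
    have h3 := dist_triangle w z z₀
    exact Metric.mem_ball.2 (by linarith)
  have hball' : Metric.ball z₀ R' ∈ 𝓝 z₀ := Metric.ball_mem_nhds _ hR'
  have hdz : ∀ᵐ a ∂μ, ∀ z ∈ Metric.ball z₀ R', DifferentiableAt ℂ (F · a) z := by
    filter_upwards [hdiff] with a ha z hz
    exact (ha.mono hball).differentiableAt (Metric.isOpen_ball.mem_nhds hz)
  have hsubR : Metric.ball z₀ R ⊆ Metric.ball z₀ R' := Metric.ball_subset_ball (by linarith)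
  refine (hasDerivAt_integral_of_dominated_loc_of_deriv_le (s := Metric.ball z₀ R)
    (F' := fun z a => deriv (F · a) z) (bound := fun a => bound a / R)
    (Metric.ball_mem_nhds _ hRpos) ?_ ?_ ?_ ?_ (hi.div_const R) ?_).2.differentiableAt
  · filter_upwards [hs] with z hz using hmeas z hz
  · refine Integrable.mono' hi (hmeas z₀ (mem_of_mem_nhds hs)) ?_
    filter_upwards [hb] with a ha using ha z₀ (mem_of_mem_nhds hs)
  -- Measurability of the derivative: it is a pointwise limit of difference quotients along a
  -- sequence.
  · obtain ⟨w, hw⟩ : ∃ w : ℕ → ℂ, Tendsto w atTop (𝓝[≠] z₀) :=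
      exists_seq_tendsto _
    have hw' : ∀ᶠ n in atTop, w n ∈ s :=
      (hw.mono_right nhdsWithin_le_nhds).eventually hs
    obtain ⟨N, hN⟩ := hw'.exists_forall_of_atTop
    refine aestronglyMeasurable_of_tendsto_ae (u := atTop)
      (f := fun n a => slope (F · a) z₀ (w (n + N))) ?_ ?_
    · intro n
      simp only [slope_def_module]
      exact ((hmeas _ (hN _ (by omega))).sub (hmeas _ (mem_of_mem_nhds hs))).const_smul _
    · filter_upwards [hdz] with a ha
      have := (ha z₀ (Metric.mem_ball_self hR')).hasDerivAt
      rw [hasDerivAt_iff_tendsto_slope] at this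
      exact this.comp (hw.comp (tendsto_add_atTop_nat N))
  · filter_upwards [hb, hdiff] with a ha hd z hz
    refine Complex.norm_deriv_le_of_forall_mem_sphere_norm_le hRpos ?_ ?_
    · refine DifferentiableOn.diffContOnCl ?_
      rw [closure_ball _ hRpos.ne']
      exact hd.mono (hsub z hz)
    · intro w hw
      exact ha w (hsub z hz (Metric.sphere_subset_closedBall hw))
  · filter_upwards [hdz] with a ha z hz
    exact (ha z (hsubR hz)).hasDerivAt

/-! ### Linear differential equations, entire in a parameter. -/

section LinearODE

variable {E : Type*} [NormedAddCommGroup E] [NormedSpace ℂ E]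

/-- The Picard iterates of the linear equation `x' = ε L(t) x`, `x(0) = e₀`, as coefficients of the
powers of `ε`. -/
def linearODEIter (L : ℝ → E →L[ℂ] E) (e₀ : E) : ℕ → ℝ → E
  | 0, _ => e₀
  | n + 1, t => ∫ s in (0 : ℝ)..t, L s (linearODEIter L e₀ n s)

theorem continuous_linearODEIter {L : ℝ → E →L[ℂ] E} (hL : Continuous L) (e₀ : E) (n : ℕ) :
    Continuous (linearODEIter L e₀ n) := by
  induction n with
  | zero => exact continuous_const
  | succ n ih =>
    exact intervalIntegral.continuous_primitive
      (fun a b => (hL.clm_apply ih).intervalIntegrable a b) 0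

/-- The iterated integral runs over a simplex, whence the factorial; this makes the series in `ε`
entire, locally uniformly in `t`. -/
theorem norm_linearODEIter_le {L : ℝ → E →L[ℂ] E} (hL : Continuous L) (e₀ : E) {T C : ℝ}
    (hC : ∀ t, |t| ≤ T → ‖L t‖ ≤ C) (n : ℕ) {t : ℝ} (ht : |t| ≤ T) :
    ‖linearODEIter L e₀ n t‖ ≤ ‖e₀‖ * ((C * |t|) ^ n / n.factorial) := by
  have hC0 : 0 ≤ C := (norm_nonneg _).trans (hC t ht)
  induction n generalizing t with
  | zero => simp [linearODEIter]
  | succ n ih =>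
    have hsub : ∀ s ∈ Set.uIoc 0 t, |s| ≤ |t| := by
      intro s hs
      rcases Set.mem_uIoc.1 hs with h | h
      · rw [abs_of_pos h.1, abs_of_pos (h.1.trans_le h.2)]; exact h.2
      · rw [abs_of_nonpos h.2, abs_of_neg (h.1.trans_le h.2)]; linarith
    calc ‖linearODEIter L e₀ (n + 1) t‖
        ≤ ∫ s in Set.uIoc 0 t, ‖L s (linearODEIter L e₀ n s)‖ :=
          intervalIntegral.norm_integral_le_integral_norm_uIoc
      _ ≤ ∫ s in Set.uIoc 0 t, C * (‖e₀‖ * (C ^ n / n.factorial)) * |s - 0| ^ n := by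
          refine MeasureTheory.setIntegral_mono_on ?_ ?_ measurableSet_uIoc ?_
          · exact (hL.clm_apply (continuous_linearODEIter hL e₀ n)).norm.integrableOn_uIoc
          · exact (by fun_prop : Continuous fun s : ℝ =>
              C * (‖e₀‖ * (C ^ n / n.factorial)) * |s - 0| ^ n).integrableOn_uIoc
          · intro s hs
            have hsT := (hsub s hs).trans ht
            calc ‖L s (linearODEIter L e₀ n s)‖
                ≤ ‖L s‖ * ‖linearODEIter L e₀ n s‖ := (L s).le_opNorm _
              _ ≤ C * (‖e₀‖ * ((C * |s|) ^ n / n.factorial)) := by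
                  gcongr
                  · exact hC s hsT
                  · exact ih hsT
              _ = _ := by rw [sub_zero, mul_pow]; ring
      _ = ‖e₀‖ * ((C * |t|) ^ (n + 1) / (n + 1).factorial) := by
          rw [MeasureTheory.integral_const_mul, integral_pow_abs_sub_uIoc, Nat.factorial_succ,
            sub_zero, mul_pow]
          push_cast
          have : (n.factorial : ℝ) ≠ 0 := by positivity
          field_simp
          ring

/-- The linear equation `x' = ε L(t) x` has global solutions which are entire in `ε`. -/
theorem exists_linearODE_solution [CompleteSpace E] {L : ℝ → E →L[ℂ] E} (hL : Continuous L)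
    (e₀ : E) :
    ∃ x : ℝ → ℂ → E, (∀ ε, x 0 ε = e₀) ∧ (∀ t, x t 0 = e₀) ∧
      (∀ t ε, HasDerivAt (fun t => x t ε) (ε • L t (x t ε)) t) ∧
      (∀ t, Differentiable ℂ (x t)) ∧
      ∀ T R : ℝ, ∃ C, ∀ t ε, |t| ≤ T → ‖ε‖ ≤ R → ‖x t ε‖ ≤ C := by
  set X := linearODEIter L e₀ with hX
  have hbd : ∀ T : ℝ, ∃ C, ∀ t, |t| ≤ T → ‖L t‖ ≤ C := by
    intro T
    obtain ⟨C, hC⟩ := (isCompact_Icc (a := -T) (b := T)).exists_bound_of_continuousOn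
      hL.continuousOn
    exact ⟨C, fun t ht => hC t ⟨(abs_le.1 ht).1, (abs_le.1 ht).2⟩⟩
  have hterm : ∀ {T C R : ℝ}, (∀ t, |t| ≤ T → ‖L t‖ ≤ C) → ∀ n {t : ℝ} {ε : ℂ}, |t| ≤ T →
      ‖ε‖ ≤ R → ‖ε ^ n • X n t‖ ≤ ‖e₀‖ * ((R * (C * T)) ^ n / n.factorial) := by
    intro T C R hC n t ε ht hε
    have hC0 : 0 ≤ C := (norm_nonneg _).trans (hC t ht)
    have hR0 : 0 ≤ R := (norm_nonneg _).trans hε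
    rw [norm_smul, norm_pow]
    calc ‖ε‖ ^ n * ‖X n t‖ ≤ R ^ n * (‖e₀‖ * ((C * |t|) ^ n / n.factorial)) := by
          gcongr
          exact norm_linearODEIter_le hL e₀ hC n ht
      _ ≤ R ^ n * (‖e₀‖ * ((C * T) ^ n / n.factorial)) := by gcongr
      _ = _ := by rw [mul_pow R]; ring
  have hsum : ∀ r : ℝ, Summable fun n : ℕ => ‖e₀‖ * (r ^ n / n.factorial) := fun r =>
    (Real.summable_pow_div_factorial r).mul_left _
  have hsumX : ∀ (t : ℝ) (ε : ℂ), Summable fun n : ℕ => ε ^ n • X n t := by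
    intro t ε
    obtain ⟨C, hC⟩ := hbd |t|
    exact Summable.of_norm_bounded (hsum _) fun n => hterm hC n le_rfl le_rfl
  refine ⟨fun t ε => ∑' n, ε ^ n • X n t, ?_, ?_, ?_, ?_, ?_⟩
  · intro ε
    beta_reduce
    rw [tsum_eq_single 0]
    · simp [hX, linearODEIter]
    · intro n hn
      obtain ⟨m, rfl⟩ := Nat.exists_eq_succ_of_ne_zero hn
      simp [hX, linearODEIter]
  · intro t
    beta_reduce
    rw [tsum_eq_single 0]
    · simp [hX, linearODEIter]
    · intro n hn
      simp [hn]
  · intro t ε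
    -- The enlarged interval dominates the differentiated series on a whole neighbourhood of `t`.
    obtain ⟨C, hC⟩ := hbd (|t| + 1)
    have hd : ∀ (n : ℕ) (s : ℝ), HasDerivAt (fun s => ε ^ n • X n s)
        (n.casesOn 0 fun m => ε ^ (m + 1) • L s (X m s)) s := by
      intro n s
      cases n with
      | zero =>
        simpa [hX, linearODEIter] using hasDerivAt_const s e₀
      | succ m =>
        exact (((hL.clm_apply (continuous_linearODEIter hL e₀ m)).integral_hasStrictDerivAt
          0 s).hasDerivAt).const_smul _
    have hball : ∀ s ∈ Metric.ball t 1, |s| ≤ |t| + 1 := by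
      intro s hs
      have h1 := Metric.mem_ball.1 hs
      rw [Real.dist_eq] at h1
      have := abs_sub_abs_le_abs_sub s t
      linarith
    have key := hasDerivAt_tsum_of_isPreconnected (t := Metric.ball t 1) (y₀ := t) (y := t)
      (u := fun n : ℕ => n.casesOn 0 fun m => ‖ε‖ * C *
        (‖e₀‖ * ((‖ε‖ * (C * (|t| + 1))) ^ m / m.factorial)))
      ?_ Metric.isOpen_ball (convex_ball t 1).isPreconnected (fun n s _ => hd n s) ?_
      (Metric.mem_ball_self one_pos) (hsumX t ε) (Metric.mem_ball_self one_pos)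
    · convert key using 1
      rw [← Summable.sum_add_tsum_nat_add 1]
      · simp only [Finset.range_one, Finset.sum_singleton]
        rw [ContinuousLinearMap.map_tsum _ (hsumX t ε), ← tsum_const_smul'']
        refine Eq.trans (tsum_congr fun n => ?_) (zero_add _).symm
        rw [map_smul, smul_smul, pow_succ']
      · rw [← summable_nat_add_iff 1]
        have := ((hsumX t ε).mapL (L t)).const_smul ε
        refine this.congr fun n => ?_
        simp only
        rw [map_smul, smul_smul, pow_succ']
    · rw [← summable_nat_add_iff 1]
      exact (hsum _).mul_left _
    · intro n s hs
      cases n with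
      | zero => simp
      | succ m =>
        have hs' := hball s hs
        have h1 := hterm hC m (R := ‖ε‖) hs' le_rfl
        have hC0 : 0 ≤ C := (norm_nonneg _).trans (hC s hs')
        calc ‖ε ^ (m + 1) • L s (X m s)‖ = ‖ε • L s (ε ^ m • X m s)‖ := by
              rw [map_smul, smul_smul, pow_succ']
          _ ≤ ‖ε‖ * (‖L s‖ * ‖ε ^ m • X m s‖) := by
              rw [norm_smul]; gcongr; exact (L s).le_opNorm _
          _ ≤ ‖ε‖ * (C * (‖e₀‖ * ((‖ε‖ * (C * (|t| + 1))) ^ m / m.factorial))) := by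
              gcongr
              exact hC s hs'
          _ = _ := by ring
  · intro t ε
    obtain ⟨C, hC⟩ := hbd |t|
    have := Complex.differentiableOn_tsum_of_summable_norm (hsum ((‖ε‖ + 1) * (C * |t|)))
      (F := fun n (ε : ℂ) => ε ^ n • X n t) (U := Metric.ball 0 (‖ε‖ + 1))
      (fun n => by fun_prop) Metric.isOpen_ball
      (fun n w hw => hterm hC n le_rfl (mem_ball_zero_iff.1 hw).le)
    exact this.differentiableAt (Metric.isOpen_ball.mem_nhds (by simp))
  · intro T R
    obtain ⟨C, hC⟩ := hbd T
    refine ⟨∑' n : ℕ, ‖e₀‖ * ((R * (C * T)) ^ n / n.factorial), fun t ε ht hε => ?_⟩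
    exact tsum_of_norm_bounded (hsum _).hasSum fun n => hterm hC n ht hε

end LinearODE

/-! ### Regularity on the real axis from bounds in a double sector. -/

/-- The double sector `|Im w| < |Re w|` around the punctured real axis. -/
def doubleSector : Set ℂ := {w | |w.im| < |w.re|}

theorem isOpen_doubleSector : IsOpen doubleSector :=
  isOpen_lt (by fun_prop) (by fun_prop)

theorem ofReal_mem_doubleSector {x : ℝ} (hx : x ≠ 0) : (x : ℂ) ∈ doubleSector := by
  simpa [doubleSector] using hx

/-- The radius is proportional to `|x|`, so that Cauchy's estimate costs exactly one power of `|x|`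
per derivative. -/
theorem closedBall_subset_doubleSector {x : ℝ} (hx : x ≠ 0) :
    Metric.closedBall (x : ℂ) (|x| / 4) ⊆ doubleSector := by
  intro w hw
  have h := mem_closedBall_iff_norm.1 hw
  have h1 := (Complex.abs_re_le_norm _).trans h
  have h2 := (Complex.abs_im_le_norm _).trans h
  simp only [Complex.sub_re, Complex.sub_im, Complex.ofReal_re, Complex.ofReal_im, sub_zero] at h1 h2
  have h3 := abs_sub_abs_le_abs_sub x w.re
  rw [abs_sub_comm] at h3
  have := abs_pos.2 hx
  simp only [doubleSector, Set.mem_ofPred_eq]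
  linarith

theorem ofReal_tendsto_doubleSector :
    Tendsto (fun x : ℝ => (x : ℂ)) (𝓝[≠] 0) (𝓝[doubleSector] 0) := by
  refine tendsto_nhdsWithin_of_tendsto_nhds_of_eventually_within _ ?_ ?_
  · exact (Complex.continuous_ofReal.tendsto' 0 0 (by simp)).mono_left nhdsWithin_le_nhds
  · filter_upwards [self_mem_nhdsWithin] with x hx using ofReal_mem_doubleSector hx

/-- A holomorphic function on the double sector which is `O(|w|^s)` at `0` extends to a function of
class `Cⁿ` on the real axis if `n < s`. -/
theorem contDiff_of_isBigO_doubleSector {F : ℂ → ℂ} (hF : DifferentiableOn ℂ F doubleSector)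
    {s : ℝ} {n : ℕ} (hs : n < s) (hb : F =O[𝓝[doubleSector] 0] fun w => ‖w‖ ^ s) :
    ContDiff ℝ n (fun x : ℝ => if x = 0 then 0 else F x) := by
  have hs0 : 0 < s := (Nat.cast_nonneg n).trans_lt hs
  set f : ℕ → ℝ → ℂ := fun k x => if x = 0 then 0 else iteratedDeriv k F x with hf
  have hFd : ∀ k, DifferentiableOn ℂ (iteratedDeriv k F) doubleSector := by
    intro k
    induction k with
    | zero => simpa using hF
    | succ k ih => rw [iteratedDeriv_succ]; exact ih.deriv isOpen_doubleSector
  have hoff : ∀ k (x : ℝ), x ≠ 0 → HasDerivAt (f k) (f (k + 1) x) x := by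
    intro k x hx
    have h1 := ((hFd k).differentiableAt
      (isOpen_doubleSector.mem_nhds (ofReal_mem_doubleSector hx))).hasDerivAt.comp_ofReal
    rw [← iteratedDeriv_succ] at h1
    have h2 : f (k + 1) x = iteratedDeriv (k + 1) F x := by simp [hf, hx]
    rw [h2]
    refine h1.congr_of_eventuallyEq ?_
    filter_upwards [isOpen_ne.mem_nhds hx] with y hy
    simp only [hf, if_neg (show y ≠ 0 from hy)]
  -- Cauchy's estimate on the circle of radius `|x| / 4`, on which `‖w‖ ≤ 2|x|`.
  have hbd : ∀ k, ∃ C, ∀ᶠ x : ℝ in 𝓝[≠] 0, ‖f k x‖ ≤ C * |x| ^ (s - k) := by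
    intro k
    obtain ⟨C, hC0, hC⟩ := hb.exists_pos
    rw [IsBigOWith, eventually_nhdsWithin_iff, Metric.eventually_nhds_iff] at hC
    obtain ⟨δ, hδ, hδ'⟩ := hC
    refine ⟨k.factorial * (C * 2 ^ s) * 4 ^ k, ?_⟩
    have hball : Metric.ball (0 : ℝ) (δ / 2) ∈ 𝓝 (0 : ℝ) := Metric.ball_mem_nhds _ (by positivity)
    filter_upwards [self_mem_nhdsWithin, mem_nhdsWithin_of_mem_nhds hball] with x hx hxδ
    have hx' : x ≠ 0 := hx
    have hxp : 0 < |x| := abs_pos.2 hx'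
    have hxδ' : |x| < δ / 2 := by simpa using hxδ
    simp only [hf, if_neg hx']
    have hsub := closedBall_subset_doubleSector hx'
    have := Complex.norm_iteratedDeriv_le_of_forall_mem_sphere_norm_le (f := F) (c := x)
      (R := |x| / 4) (C := C * (2 * |x|) ^ s) k (by positivity) ?_ ?_
    · refine this.trans (le_of_eq ?_)
      rw [Real.mul_rpow (by norm_num) hxp.le, Real.rpow_sub hxp, Real.rpow_natCast, div_pow]
      field_simp
    · refine DifferentiableOn.diffContOnCl ?_
      rw [closure_ball _ (by positivity)]
      exact hF.mono hsub
    · intro w hw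
      have hw1 : ‖w - x‖ = |x| / 4 := mem_sphere_iff_norm.1 hw
      have hw2 : ‖w‖ ≤ 2 * |x| := by
        have := norm_le_norm_add_norm_sub' w (x : ℂ)
        rw [Complex.norm_real, Real.norm_eq_abs, hw1] at this
        linarith
      have h3 := hδ' (y := w) (by rw [dist_zero_right]; linarith)
        (hsub (Metric.sphere_subset_closedBall hw))
      refine h3.trans ?_
      rw [Real.norm_of_nonneg (by positivity)]
      gcongr
  -- Here `s - k > 1`, so the difference quotient at `0` still tends to `0`.
  have hzero : ∀ k, k < n → HasDerivAt (f k) (f (k + 1) 0) 0 := by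
    intro k hk
    have h0 : ∀ k, f k 0 = 0 := fun k => by simp [hf]
    rw [h0, hasDerivAt_iff_tendsto_slope]
    obtain ⟨C, hC⟩ := hbd k
    have hk' : (k : ℝ) + 1 ≤ n := by exact_mod_cast hk
    have hlim : Tendsto (fun x : ℝ => C * |x| ^ (s - k - 1)) (𝓝[≠] 0) (𝓝 0) := by
      have h1 : Tendsto (fun x : ℝ => |x|) (𝓝[≠] 0) (𝓝 0) :=
        (continuous_abs.tendsto' 0 0 abs_zero).mono_left nhdsWithin_le_nhds
      have := (h1.rpow_const (p := s - k - 1) (Or.inr (by linarith))).const_mul C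
      rwa [Real.zero_rpow (by linarith), mul_zero] at this
    refine squeeze_zero_norm' ?_ hlim
    filter_upwards [hC, self_mem_nhdsWithin] with x hx hx0
    have hxp : 0 < |x| := abs_pos.2 hx0
    rw [slope_def_module, h0, sub_zero, sub_zero, norm_smul, norm_inv, Real.norm_eq_abs]
    rw [inv_mul_le_iff₀ hxp]
    refine hx.trans (le_of_eq ?_)
    rw [Real.rpow_sub_one hxp.ne']
    field_simp
  have hder : ∀ k, k < n → ∀ x, HasDerivAt (f k) (f (k + 1) x) x := by
    intro k hk x
    rcases eq_or_ne x 0 with rfl | hx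
    · exact hzero k hk
    · exact hoff k x hx
  have hcont : Continuous (f n) := by
    rw [continuous_iff_continuousAt]
    intro x
    rcases eq_or_ne x 0 with rfl | hx
    · rw [← continuousWithinAt_compl_self, ContinuousWithinAt]
      have h0 : f n 0 = 0 := by simp [hf]
      rw [h0]
      obtain ⟨C, hC⟩ := hbd n
      have h1 : Tendsto (fun x : ℝ => |x|) (𝓝[≠] 0) (𝓝 0) :=
        (continuous_abs.tendsto' 0 0 abs_zero).mono_left nhdsWithin_le_nhds
      have := (h1.rpow_const (p := s - n) (Or.inr (by linarith))).const_mul C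
      rw [Real.zero_rpow (by linarith), mul_zero] at this
      exact squeeze_zero_norm' hC this
    · exact (hoff n x hx).continuousAt
  -- Induction downwards from the top derivative: `f (n - m)` has `m` continuous derivatives.
  have hmain : ∀ m, m ≤ n → ContDiff ℝ m (f (n - m)) := by
    intro m
    induction m with
    | zero => intro _; simpa using hcont
    | succ m ih =>
      intro hm
      push_cast
      rw [contDiff_succ_iff_deriv]
      have hk : n - (m + 1) < n := by omega
      refine ⟨fun x => (hder _ hk x).differentiableAt, by simp, ?_⟩
      have : deriv (f (n - (m + 1))) = f (n - m) := by
        ext x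
        rw [(hder _ hk x).deriv]
        congr 1
        omega
      rw [this]
      exact ih (by omega)
  have := hmain n le_rfl
  simpa [hf] using this

/-! ### Logarithm of the monodromy and removal of the singularity. -/

/-- A holomorphic logarithm near `1` in a complex Banach algebra. -/
theorem exists_local_log {A : Type*} [NormedRing A] [NormedAlgebra ℂ A] [CompleteSpace A] :
    ∃ Lg : A → A, Lg 1 = 0 ∧ AnalyticAt ℂ Lg 1 ∧
      HasFDerivAt Lg (ContinuousLinearMap.id ℂ A) 1 ∧ ∀ᶠ B in 𝓝 1, NormedSpace.exp (Lg B) = B := by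
  have hs : HasStrictFDerivAt (NormedSpace.exp : A → A)
      ((ContinuousLinearEquiv.refl ℂ A : A ≃L[ℂ] A) : A →L[ℂ] A) 0 := hasStrictFDerivAt_exp_zero
  have ha : AnalyticAt ℂ (NormedSpace.exp : A → A) 0 := NormedSpace.exp_analytic 0
  have h1 : (NormedSpace.exp : A → A) 0 = 1 := NormedSpace.exp_zero
  refine ⟨hs.localInverse _ _ _, ?_, ?_, ?_, ?_⟩
  · have := hs.localInverse_apply_image
    rwa [h1] at this
  · have := (ha.contDiffAt (n := ⊤)).to_localInverse hs.hasFDerivAt (by simp)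
    rw [h1] at this
    exact this.analyticAt
  · have := hs.to_localInverse.hasFDerivAt
    rw [h1] at this
    exact this
  · have := hs.eventually_right_inverse
    rwa [h1] at this

theorem exp_add_smul {A : Type*} [NormedRing A] [NormedAlgebra ℂ A] [CompleteSpace A] (a b : ℂ)
    (g : A) : NormedSpace.exp ((a + b) • g) =
      NormedSpace.exp (a • g) * NormedSpace.exp (b • g) := by
  let _ : NormedAlgebra ℚ A := NormedAlgebra.restrictScalars ℚ ℂ A
  rw [add_smul, NormedSpace.exp_add_of_commute]
  exact ((Commute.refl g).smul_left _).smul_right _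

theorem exp_add_smul_apply (a b : ℂ) (g : (ℂ × ℂ) →L[ℂ] (ℂ × ℂ)) (x : ℂ × ℂ) :
    NormedSpace.exp ((a + b) • g) x = NormedSpace.exp (a • g) (NormedSpace.exp (b • g) x) :=
  DFunLike.congr_fun (exp_add_smul a b g) x

theorem exp_smul_apply_exp_neg_smul (a : ℂ) (g : (ℂ × ℂ) →L[ℂ] (ℂ × ℂ)) (x : ℂ × ℂ) :
    NormedSpace.exp (a • g) (NormedSpace.exp (-a • g) x) = x := by
  rw [← exp_add_smul_apply, add_neg_cancel, show (0 : ℂ) • g = 0 from zero_smul ℂ g,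
    NormedSpace.exp_zero]
  rfl

open Complex Function Function.Periodic in
/-- A vector valued entire function `v` with `v(ζ + 2πi) = M(e^ζ) v(ζ)`, `M(0) = 1`, bounded for
`Re ζ → -∞`, is of the form `exp(ζ G(e^ζ)) w(e^ζ)` with `G`, `w` analytic at `0`. -/
theorem exists_monodromy_factorization {v : ℂ → ℂ × ℂ} (hv : Differentiable ℂ v)
    {Mh : ℂ → (ℂ × ℂ) →L[ℂ] (ℂ × ℂ)} (hM : Differentiable ℂ Mh) (h0 : Mh 0 = 1) {c : ℂ}
    (h1 : HasDerivAt Mh ((2 * Real.pi * I * c) • 1) 0)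
    (hper : ∀ ζ, v (ζ + 2 * Real.pi * I) = Mh (exp ζ) (v ζ)) {C : ℝ}
    (hb : ∀ ζ : ℂ, ζ.re ≤ 0 → 0 ≤ ζ.im → ζ.im ≤ 2 * Real.pi → ‖v ζ‖ ≤ C) :
    ∃ (G : ℂ → (ℂ × ℂ) →L[ℂ] (ℂ × ℂ)) (w : ℂ → ℂ × ℂ) (δ : ℝ), 0 < δ ∧ AnalyticAt ℂ G 0 ∧
      G 0 = 0 ∧ HasDerivAt G (c • 1) 0 ∧ AnalyticAt ℂ w 0 ∧
      ∀ ζ, ‖exp ζ‖ < δ → v ζ = NormedSpace.exp (ζ • G (exp ζ)) (w (exp ζ)) := by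
  obtain ⟨Lg, hLg1, hLga, hLgd, hLge⟩ :=
    exists_local_log (A := (ℂ × ℂ) →L[ℂ] (ℂ × ℂ))
  have hc2 : (2 * Real.pi * I : ℂ) ≠ 0 := by simp [Real.pi_ne_zero]
  set p : ℂ := 2 * Real.pi * I with hp
  -- Normalized so that `exp(2πi G) = Mh` near `0`.
  set G : ℂ → (ℂ × ℂ) →L[ℂ] (ℂ × ℂ) := fun z => p⁻¹ • Lg (Mh z) with hG
  have hGa : AnalyticAt ℂ G 0 := by
    have h2 : AnalyticAt ℂ Lg (Mh 0) := by rwa [h0]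
    exact (h2.comp (hM.analyticAt 0)).const_smul (c := p⁻¹)
  have hG0 : G 0 = 0 := by simp [hG, h0, hLg1]
  have hGd : HasDerivAt G (c • 1) 0 := by
    have h2 : HasFDerivAt Lg (ContinuousLinearMap.id ℂ _) (Mh 0) := by rwa [h0]
    have h3 := (h2.comp_hasDerivAt (0 : ℂ) h1).const_smul p⁻¹
    rw [ContinuousLinearMap.id_apply, smul_smul, ← mul_assoc, inv_mul_cancel₀ hc2, one_mul] at h3
    exact h3
  have hGexp : ∀ᶠ z in 𝓝 (0 : ℂ), NormedSpace.exp (p • G z) = Mh z := by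
    have h2 : Tendsto Mh (𝓝 0) (𝓝 1) := by
      have := hM.continuous.tendsto 0
      rwa [h0] at this
    filter_upwards [h2.eventually hLge] with z hz
    simp only [hG]
    rw [smul_smul, mul_inv_cancel₀ hc2, one_smul, hz]
  -- The bound `G(z) = O(z)` will compensate the linear growth of `ζ` in `ζ G(e^ζ)`.
  obtain ⟨K, hK⟩ := (hGa.differentiableAt.isBigO_sub).bound
  simp only [hG0, sub_zero] at hK
  obtain ⟨δ, hδ, hδ'⟩ := Metric.eventually_nhds_iff.1
    ((hGexp.and hGa.eventually_analyticAt).and hK)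
  have hE : ∀ z : ℂ, ‖z‖ < δ → NormedSpace.exp (p • G z) = Mh z ∧ AnalyticAt ℂ G z ∧
      ‖G z‖ ≤ |K| * ‖z‖ := by
    intro z hz
    obtain ⟨⟨h2, h3⟩, h4⟩ := hδ' (y := z) (by rwa [dist_zero_right])
    exact ⟨h2, h3, h4.trans (by gcongr; exact le_abs_self K)⟩
  clear_value G
  -- With `ζ = iτ`, the factor `exp(-ζ G(e^ζ))` cancels the monodromy and makes `f` `2π`-periodic.
  -- Only large `Im τ` matters, so the value `0` elsewhere is harmless.
  set f : ℂ → ℂ × ℂ := fun τ => if ‖exp (I * τ)‖ < δ then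
    NormedSpace.exp (-(I * τ) • G (exp (I * τ))) (v (I * τ)) else 0 with hf
  have hexp : ∀ τ : ℂ, exp (I * (τ + (2 * Real.pi : ℝ))) = exp (I * τ) := by
    intro τ
    rw [mul_add, exp_add]
    have : I * ((2 * Real.pi : ℝ) : ℂ) = 2 * Real.pi * I := by push_cast; ring
    rw [this, exp_two_pi_mul_I, mul_one]
  have hfper : Periodic f ((2 * Real.pi : ℝ) : ℂ) := by
    intro τ
    simp only [hf, hexp]
    split_ifs with h
    · have h2 : I * (τ + (2 * Real.pi : ℝ)) = I * τ + p := by rw [hp]; push_cast; ring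
      rw [h2, hper, ← (hE _ h).1, neg_add, exp_add_smul_apply]
      congr 1
      simpa using exp_smul_apply_exp_neg_smul (-p) (G (exp (I * τ))) (v (I * τ))
    · rfl
  have hnorm : ∀ τ : ℂ, ‖exp (I * τ)‖ = Real.exp (-τ.im) := by
    intro τ; rw [norm_exp]; simp
  have hfd : ∀ τ : ℂ, ‖exp (I * τ)‖ < δ → DifferentiableAt ℂ f τ := by
    intro τ hτ
    have hopen : ∀ᶠ τ' in 𝓝 τ, ‖exp (I * τ')‖ < δ :=
      (isOpen_lt (by fun_prop) continuous_const).mem_nhds hτ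
    have h2 : DifferentiableAt ℂ (fun τ => NormedSpace.exp (-(I * τ) • G (exp (I * τ)))
        (v (I * τ))) τ := by
      refine DifferentiableAt.clm_apply ?_ ?_
      · have h3 : DifferentiableAt ℂ (fun τ : ℂ => -(I * τ) • G (exp (I * τ))) τ := by
          have h5 : DifferentiableAt ℂ (fun τ : ℂ => -(I * τ)) τ := by fun_prop
          refine h5.smul ?_
          have h4 : DifferentiableAt ℂ (fun τ : ℂ => exp (I * τ)) τ := by fun_prop
          exact (hE _ hτ).2.1.differentiableAt.comp τ h4
        exact (NormedSpace.exp_analytic (𝕂 := ℂ) _).differentiableAt.comp τ h3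
      · have h4 : DifferentiableAt ℂ (fun τ : ℂ => I * τ) τ := by fun_prop
        exact (hv _).comp τ h4
    refine h2.congr_of_eventuallyEq ?_
    filter_upwards [hopen] with τ' hτ'
    simp only [hf, if_pos hτ']
  have hev : ∀ᶠ τ in comap im atTop, ‖exp (I * τ)‖ < δ ∧ 0 ≤ τ.im := by
    have h2 : ∀ᶠ y : ℝ in atTop, Real.exp (-y) < δ ∧ 0 ≤ y :=
      ((Real.tendsto_exp_neg_atTop_nhds_zero).eventually (gt_mem_nhds hδ)).and
        (eventually_ge_atTop 0)
    filter_upwards [tendsto_comap.eventually h2] with τ hτ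
    rwa [hnorm]
  have hhol : ∀ᶠ τ in comap im atTop, DifferentiableAt ℂ f τ := by
    filter_upwards [hev] with τ hτ using hfd τ hτ.1
  obtain ⟨B, hexpB⟩ : ∃ B, ∀ T : (ℂ × ℂ) →L[ℂ] (ℂ × ℂ), ‖T‖ ≤ |K| * (2 * Real.pi + 1) →
      ‖NormedSpace.exp T‖ ≤ B := by
    have : ProperSpace ((ℂ × ℂ) →L[ℂ] (ℂ × ℂ)) := FiniteDimensional.proper ℂ _
    obtain ⟨B, hB⟩ := (isCompact_closedBall (0 : (ℂ × ℂ) →L[ℂ] (ℂ × ℂ))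
      (|K| * (2 * Real.pi + 1))).exists_bound_of_continuousOn (f := NormedSpace.exp)
      (fun T _ => (NormedSpace.exp_analytic (𝕂 := ℂ) T).continuousAt.continuousWithinAt)
    exact ⟨B, fun T hT => hB T (by simpa using hT)⟩
  have hbd : ∀ᶠ τ in comap im atTop, ‖f τ‖ ≤ B * C := by
    filter_upwards [hev] with τ hτ
    -- Periodicity moves `τ` into the strip `0 ≤ Re τ ≤ 2π`, the only place where a bound on `v` is
    -- given.
    obtain ⟨n, hn⟩ : ∃ n : ℤ, 0 ≤ τ.re + n * (2 * Real.pi) ∧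
        τ.re + n * (2 * Real.pi) ≤ 2 * Real.pi := by
      refine ⟨-⌊τ.re / (2 * Real.pi)⌋, ?_⟩
      have h2 := Int.floor_le (τ.re / (2 * Real.pi))
      have h3 := (Int.lt_floor_add_one (τ.re / (2 * Real.pi))).le
      rw [le_div_iff₀ Real.two_pi_pos] at h2
      rw [div_le_iff₀ Real.two_pi_pos] at h3
      push_cast
      constructor <;> linarith
    set τ' : ℂ := τ + n * ((2 * Real.pi : ℝ) : ℂ) with hτ'
    have hfτ : f τ' = f τ := hfper.int_mul n τ
    have hre : τ'.re = τ.re + n * (2 * Real.pi) := by simp [hτ']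
    have him : τ'.im = τ.im := by simp [hτ']
    rw [← hfτ]
    have h2 : ‖exp (I * τ')‖ < δ := by rw [hnorm, him, ← hnorm]; exact hτ.1
    simp only [hf, if_pos h2]
    refine (ContinuousLinearMap.le_opNorm _ _).trans ?_
    have hvb : ‖v (I * τ')‖ ≤ C := by
      refine hb _ ?_ ?_ ?_
      · simp [him, hτ.2]
      · simpa [hre] using hn.1
      · simpa [hre] using hn.2
    refine mul_le_mul ?_ hvb (norm_nonneg _) ((norm_nonneg _).trans (hexpB 0 (by rw [norm_zero]; positivity)))
    refine hexpB _ ?_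
    rw [norm_smul, norm_neg, norm_mul, norm_I, one_mul]
    have hG' := (hE _ h2).2.2
    rw [hnorm, him] at hG'
    have hτn : ‖τ'‖ ≤ 2 * Real.pi + τ.im := by
      refine (norm_le_abs_re_add_abs_im τ').trans ?_
      rw [hre, him, abs_of_nonneg hn.1, abs_of_nonneg hτ.2]
      linarith [hn.2]
    -- With `‖G(e^ζ)‖ ≤ |K| e^{-Im τ}`, this bounds the exponent `ζ G(e^ζ)` uniformly.
    have hye : τ.im * Real.exp (-τ.im) ≤ 1 := by
      have := Real.add_one_le_exp τ.im
      rw [Real.exp_neg, ← div_eq_mul_inv, div_le_one (Real.exp_pos _)]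
      linarith
    have he1 : Real.exp (-τ.im) ≤ 1 := Real.exp_le_one_iff.2 (by linarith [hτ.2])
    calc ‖τ'‖ * ‖G (exp (I * τ'))‖
        ≤ (2 * Real.pi + τ.im) * (|K| * Real.exp (-τ.im)) :=
          mul_le_mul hτn hG' (norm_nonneg _) ((norm_nonneg _).trans hτn)
      _ = |K| * (2 * Real.pi * Real.exp (-τ.im) + τ.im * Real.exp (-τ.im)) := by ring
      _ ≤ |K| * (2 * Real.pi * 1 + 1) := by gcongr
      _ = _ := by ring
  have hpi : (0 : ℝ) < 2 * Real.pi := Real.two_pi_pos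
  -- A bounded periodic holomorphic function near `i∞` is analytic in `q = e^{iτ} = e^ζ`, including
  -- `q = 0`; applied to each component.
  have hcomp : ∀ g : ℂ × ℂ →L[ℂ] ℂ, AnalyticAt ℂ
      (cuspFunction (2 * Real.pi) (fun τ => g (f τ))) 0 := by
    intro g
    have hgp : Periodic (fun τ => g (f τ)) ((2 * Real.pi : ℝ) : ℂ) := fun τ => by
      simp only [hfper τ]
    have hgh : ∀ᶠ τ in comap im atTop, DifferentiableAt ℂ (fun τ => g (f τ)) τ := by
      filter_upwards [hhol] with τ hτ using g.differentiableAt.comp τ hτ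
    have hgb : BoundedAtFilter (comap im atTop) (fun τ => g (f τ)) := by
      refine IsBigO.of_bound (‖g‖ * (B * C)) ?_
      filter_upwards [hbd] with τ hτ
      simp only [Pi.one_apply, norm_one, mul_one]
      exact (g.le_opNorm _).trans (by gcongr)
    rw [analyticAt_iff_eventually_differentiableAt]
    have h2 := eventually_differentiableAt_cuspFunction_nhds_ne_zero hpi hgp hgh
    have h3 := differentiableAt_cuspFunction_zero hpi hgp hgh hgb
    rw [eventually_nhdsWithin_iff] at h2
    filter_upwards [h2] with q hq
    rcases eq_or_ne q 0 with rfl | hq0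
    · exact h3
    · exact hq hq0
  refine ⟨G, fun q => (cuspFunction (2 * Real.pi) (fun τ => (f τ).1) q,
    cuspFunction (2 * Real.pi) (fun τ => (f τ).2) q), δ, hδ, hGa, hG0, hGd, ?_, ?_⟩
  · exact (hcomp (ContinuousLinearMap.fst ℂ ℂ ℂ)).prod (hcomp (ContinuousLinearMap.snd ℂ ℂ ℂ))
  · intro ζ hζ
    have hq : qParam (2 * Real.pi) (-I * ζ) = exp ζ := by
      rw [qParam]
      congr 1
      push_cast
      have : (Real.pi : ℂ) ≠ 0 := by exact_mod_cast Real.pi_ne_zero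
      field_simp
      simp
    have hI : I * (-I * ζ) = ζ := by rw [← mul_assoc, mul_neg, I_mul_I]; ring
    have hw : (cuspFunction (2 * Real.pi) (fun τ => (f τ).1) (exp ζ),
        cuspFunction (2 * Real.pi) (fun τ => (f τ).2) (exp ζ)) =
        NormedSpace.exp (-ζ • G (exp ζ)) (v ζ) := by
      rw [← hq, eq_cuspFunction hpi.ne' (fun τ => by simp only [hfper τ]),
        eq_cuspFunction hpi.ne' (fun τ => by simp only [hfper τ]), hq]
      simp only [hf, hI, if_pos hζ]
    beta_reduce
    rw [hw, exp_smul_apply_exp_neg_smul]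

/-! ### The Borel transform of the Jost solution. -/

/-- The sector `|arg β| < 3π/4`. -/
def wideSector : Set ℂ := {β | 0 < β.re + |β.im|}

theorem isOpen_wideSector : IsOpen wideSector :=
  isOpen_lt continuous_const (by fun_prop)

/-- The sector omits the closed negative axis, so the singular point `s = -β` never meets the ray of
integration. -/
theorem add_ne_zero_of_mem_wideSector {β : ℂ} (hβ : β ∈ wideSector) (s : ℝ) :
    ((|s| : ℝ) : ℂ) + β ≠ 0 := by
  intro h
  have h1 := congrArg Complex.re h
  have h2 := congrArg Complex.im h
  simp only [Complex.add_re, Complex.ofReal_re, Complex.zero_re, Complex.add_im, Complex.ofReal_im,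
    Complex.zero_im, zero_add] at h1 h2
  have h3 : 0 < β.re + |β.im| := hβ
  rw [h2, abs_zero] at h3
  linarith [abs_nonneg s]

/-- Either `|Im β|` is at least `|s| / 2`, or `Re β > -|s| / 2`. Hence `|s| / (2 |s + β|) ≤ 1` for
`s > 0`, uniformly as `β → 0`. -/
theorem half_le_norm_add_of_mem_wideSector {β : ℂ} (hβ : β ∈ wideSector) (s : ℝ) :
    |s| / 2 ≤ ‖((|s| : ℝ) : ℂ) + β‖ := by
  have h3 : 0 < β.re + |β.im| := hβ
  rcases le_or_gt (|s| / 2) |β.im| with h | h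
  · refine h.trans ?_
    simpa using Complex.abs_im_le_norm (((|s| : ℝ) : ℂ) + β)
  · refine le_trans ?_ (Complex.re_le_norm _)
    simp only [Complex.add_re, Complex.ofReal_re]
    linarith

/-- The iterates of the Volterra equation
`2 s (s + β) D(s) = α (s² + ∫_0^s (s² + t²) D(t) dt)` for the Borel transform of the Jost solution,
as coefficients of the powers of `α`. -/
def borelIter (β : ℂ) : ℕ → ℝ → ℂ
  | 0, s => ((|s| : ℝ) : ℂ) / (2 * (((|s| : ℝ) : ℂ) + β))
  | k + 1, s => (s : ℂ) ^ 2 / (2 * (((|s| : ℝ) : ℂ) + β)) *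
      ∫ σ in (0 : ℝ)..1, (1 + (σ : ℂ) ^ 2) * borelIter β k (σ * s)

/-- The modulus `|s|` keeps the denominator nonzero for negative `s` too, which gives continuity on
the whole line although the equation concerns `s > 0`. -/
theorem continuous_borelIter {β : ℂ} (hβ : β ∈ wideSector) (k : ℕ) :
    Continuous (borelIter β k) := by
  have hne : ∀ s : ℝ, 2 * (((|s| : ℝ) : ℂ) + β) ≠ 0 := fun s =>
    mul_ne_zero two_ne_zero (add_ne_zero_of_mem_wideSector hβ s)
  induction k with
  | zero =>
    exact Continuous.div (by fun_prop) (by fun_prop) hne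
  | succ k ih =>
    refine Continuous.mul (Continuous.div (by fun_prop) (by fun_prop) hne) ?_
    refine intervalIntegral.continuous_parametric_intervalIntegral_of_continuous' ?_ 0 1
    have : Continuous fun p : ℝ × ℝ => borelIter β k (p.2 * p.1) := ih.comp (by fun_prop)
    exact Continuous.mul (by fun_prop) this

/-- One factor `|s| / (2 ||s| + β|)` is at most `1`; the remaining `|s|` and the integral of `2 σ^k`
supply `2|s| / (k + 1)`. The bound is uniform in `β`. -/
theorem norm_borelIter_le {β : ℂ} (hβ : β ∈ wideSector) (k : ℕ) (s : ℝ) :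
    ‖borelIter β k s‖ ≤ (2 * |s|) ^ k / k.factorial := by
  have hpos : ∀ s : ℝ, 0 < ‖((|s| : ℝ) : ℂ) + β‖ := fun s =>
    norm_pos_iff.2 (add_ne_zero_of_mem_wideSector hβ s)
  have hfrac : ∀ s : ℝ, |s| / (2 * ‖((|s| : ℝ) : ℂ) + β‖) ≤ 1 := by
    intro s
    rw [div_le_one (mul_pos two_pos (hpos s))]
    linarith [half_le_norm_add_of_mem_wideSector hβ s]
  induction k generalizing s with
  | zero =>
    simp only [borelIter, norm_div, norm_mul, Complex.norm_real, Real.norm_eq_abs, abs_abs]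
    simpa using hfrac s
  | succ k ih =>
    have hint : ‖∫ σ in (0 : ℝ)..1, (1 + (σ : ℂ) ^ 2) * borelIter β k (σ * s)‖ ≤
        ∫ σ in (0 : ℝ)..1, (2 * (2 * |s|) ^ k / k.factorial) * σ ^ k := by
      refine intervalIntegral.norm_integral_le_of_norm_le zero_le_one ?_
        (by apply Continuous.intervalIntegrable; fun_prop)
      refine Filter.Eventually.of_forall fun σ hσ => ?_
      have h1 : ‖(1 + (σ : ℂ) ^ 2)‖ ≤ 2 := by
        refine (norm_add_le _ _).trans ?_
        rw [norm_one, norm_pow, Complex.norm_real, Real.norm_of_nonneg hσ.1.le]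
        have := pow_le_one₀ (n := 2) hσ.1.le hσ.2
        linarith
      rw [norm_mul]
      calc _ ≤ 2 * ((2 * |σ * s|) ^ k / k.factorial) := by gcongr; exact ih _
        _ = _ := by rw [abs_mul, abs_of_pos hσ.1]; ring
    rw [intervalIntegral.integral_const_mul, integral_pow] at hint
    simp only [one_pow, ne_eq, Nat.add_eq_zero_iff, one_ne_zero, and_false, not_false_eq_true,
      zero_pow, sub_zero] at hint
    simp only [borelIter, norm_mul, norm_div, norm_pow, Complex.norm_real, Real.norm_eq_abs]
    calc |s| ^ 2 / (‖(2 : ℂ)‖ * ‖((|s| : ℝ) : ℂ) + β‖) * _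
        ≤ |s| ^ 2 / (‖(2 : ℂ)‖ * ‖((|s| : ℝ) : ℂ) + β‖) *
          (2 * (2 * |s|) ^ k / k.factorial * (1 / (k + 1))) := by gcongr
      _ = (|s| / (2 * ‖((|s| : ℝ) : ℂ) + β‖)) * ((2 * |s|) ^ (k + 1) / (k + 1).factorial) := by
          rw [Nat.factorial_succ]
          push_cast
          have := (hpos s).ne'
          have h2 : (k.factorial : ℝ) ≠ 0 := by positivity
          rw [Complex.norm_ofNat]
          field_simp
          ring
      _ ≤ 1 * ((2 * |s|) ^ (k + 1) / (k + 1).factorial) := by gcongr; exact hfrac s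
      _ = _ := one_mul _

open MeasureTheory in
theorem differentiableOn_borelIter (k : ℕ) (s : ℝ) :
    DifferentiableOn ℂ (fun β => borelIter β k s) wideSector := by
  have hne : ∀ (s : ℝ), ∀ β ∈ wideSector, 2 * (((|s| : ℝ) : ℂ) + β) ≠ 0 := fun s β hβ =>
    mul_ne_zero two_ne_zero (add_ne_zero_of_mem_wideSector hβ s)
  induction k generalizing s with
  | zero =>
    exact DifferentiableOn.div (by fun_prop) (by fun_prop) (hne s)
  | succ k ih =>
    refine DifferentiableOn.mul (DifferentiableOn.div (by fun_prop) (by fun_prop) (hne s)) ?_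
    intro β hβ
    refine DifferentiableAt.differentiableWithinAt ?_
    simp only [intervalIntegral.integral_of_le zero_le_one]
    refine differentiableAt_integral_of_dominated (isOpen_wideSector.mem_nhds hβ)
      (bound := fun _ => 2 * ((2 * |s|) ^ k / k.factorial)) ?_ ?_ ?_ ?_
    · intro β' hβ'
      have : Continuous fun σ : ℝ => borelIter β' k (σ * s) :=
        (continuous_borelIter hβ' k).comp (by fun_prop)
      exact (Continuous.mul (by fun_prop) this).aestronglyMeasurable
    · exact Eventually.of_forall fun σ => (ih (σ * s)).const_mul _
    · filter_upwards [ae_restrict_mem measurableSet_Ioc] with σ hσ β' hβ'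
      have h1 : ‖(1 + (σ : ℂ) ^ 2)‖ ≤ 2 := by
        refine (norm_add_le _ _).trans ?_
        rw [norm_one, norm_pow, Complex.norm_real, Real.norm_of_nonneg hσ.1.le]
        have := pow_le_one₀ (n := 2) hσ.1.le hσ.2
        linarith
      have h2 : |σ * s| ≤ |s| := by
        rw [abs_mul, abs_of_pos hσ.1]
        exact mul_le_of_le_one_left (abs_nonneg s) hσ.2
      rw [norm_mul]
      gcongr
      refine (norm_borelIter_le hβ' k _).trans ?_
      gcongr
    · exact integrable_const _

/-- The Borel transform `D(s; α, β)` of the Jost solution. -/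
def jostBorel (α β : ℂ) (s : ℝ) : ℂ := ∑' k : ℕ, α ^ (k + 1) * borelIter β k s

theorem norm_borel_term_le {β : ℂ} (hβ : β ∈ wideSector) {α : ℂ} {A T : ℝ} (hα : ‖α‖ ≤ A) (k : ℕ)
    {s : ℝ} (hs : |s| ≤ T) :
    ‖α ^ (k + 1) * borelIter β k s‖ ≤ A * ((2 * A * T) ^ k / k.factorial) := by
  have hA : 0 ≤ A := (norm_nonneg _).trans hα
  have hT : 0 ≤ T := (abs_nonneg _).trans hs
  rw [norm_mul, norm_pow]
  calc ‖α‖ ^ (k + 1) * ‖borelIter β k s‖ ≤ A ^ (k + 1) * ((2 * T) ^ k / k.factorial) := by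
        gcongr
        refine (norm_borelIter_le hβ k s).trans ?_
        gcongr
    _ = _ := by rw [pow_succ, mul_right_comm 2 A T, mul_pow _ A]; ring

theorem summable_borel_bound (A T : ℝ) :
    Summable fun k : ℕ => A * ((2 * A * T) ^ k / k.factorial) :=
  (Real.summable_pow_div_factorial _).mul_left _

theorem hasSum_borel {β : ℂ} (hβ : β ∈ wideSector) (α : ℂ) (s : ℝ) :
    HasSum (fun k : ℕ => α ^ (k + 1) * borelIter β k s) (jostBorel α β s) :=
  (Summable.of_norm_bounded (summable_borel_bound ‖α‖ |s|)
    fun k => norm_borel_term_le hβ le_rfl k le_rfl).hasSum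

/-- Exponential type `2|α|`: this is the origin of the condition `2‖α‖ < x.re` for all Laplace
integrals. -/
theorem norm_borel_le {β : ℂ} (hβ : β ∈ wideSector) (α : ℂ) (s : ℝ) :
    ‖jostBorel α β s‖ ≤ ‖α‖ * Real.exp (2 * ‖α‖ * |s|) := by
  have h : HasSum (fun k : ℕ => ‖α‖ * ((2 * ‖α‖ * |s|) ^ k / k.factorial))
      (‖α‖ * Real.exp (2 * ‖α‖ * |s|)) := by
    have h1 := NormedSpace.expSeries_div_hasSum_exp (2 * ‖α‖ * |s|)
    rw [← Real.exp_eq_exp_ℝ] at h1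
    exact h1.mul_left _
  exact tsum_of_norm_bounded h fun k => norm_borel_term_le hβ le_rfl k le_rfl

theorem continuous_borel {β : ℂ} (hβ : β ∈ wideSector) (α : ℂ) : Continuous (jostBorel α β) := by
  rw [continuous_iff_continuousAt]
  intro s
  have := continuousOn_tsum (s := Metric.ball s 1)
    (f := fun (k : ℕ) s => α ^ (k + 1) * borelIter β k s)
    (fun k => (continuous_const.mul (continuous_borelIter hβ k)).continuousOn)
    (summable_borel_bound ‖α‖ (|s| + 1)) (fun k t ht => norm_borel_term_le hβ le_rfl k ?_)
  · exact this.continuousAt (Metric.ball_mem_nhds _ one_pos)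
  · have h1 := Metric.mem_ball.1 ht
    rw [Real.dist_eq] at h1
    have := abs_sub_abs_le_abs_sub t s
    linarith

theorem differentiableOn_borel {U : Set ℂ} (hU : IsOpen U) {a b : ℂ → ℂ}
    (ha : DifferentiableOn ℂ a U) (hb : DifferentiableOn ℂ b U) (hbU : ∀ z ∈ U, b z ∈ wideSector)
    (s : ℝ) : DifferentiableOn ℂ (fun z => jostBorel (a z) (b z) s) U := by
  intro z hz
  set V := U ∩ a ⁻¹' Metric.ball 0 (‖a z‖ + 1) with hV
  have hVo : IsOpen V := ha.continuousOn.isOpen_inter_preimage hU Metric.isOpen_ball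
  have := Complex.differentiableOn_tsum_of_summable_norm (summable_borel_bound (‖a z‖ + 1) |s|)
    (F := fun (k : ℕ) z => a z ^ (k + 1) * borelIter (b z) k s) (U := V)
    (fun k => ((ha.mono Set.inter_subset_left).pow _).mul
      ((differentiableOn_borelIter k s).comp (hb.mono Set.inter_subset_left)
        fun w hw => hbU w hw.1)) hVo
    (fun k w hw => norm_borel_term_le (hbU w hw.1) (mem_ball_zero_iff.1 hw.2).le k le_rfl)
  exact (this.differentiableAt (hVo.mem_nhds ⟨hz, by simp⟩)).differentiableWithinAt

/-- Sum of the recursion over `k`. The scaled variable `σ = t / s` avoids dividing by `s` at the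
origin. -/
theorem borel_eq_integral {β : ℂ} (hβ : β ∈ wideSector) (α : ℂ) (s : ℝ) :
    jostBorel α β s = α * (((|s| : ℝ) : ℂ) / (2 * (((|s| : ℝ) : ℂ) + β))) +
      α * ((s : ℂ) ^ 2 / (2 * (((|s| : ℝ) : ℂ) + β))) *
        ∫ σ in (0 : ℝ)..1, (1 + (σ : ℂ) ^ 2) * jostBorel α β (σ * s) := by
  have hsum : HasSum (fun k : ℕ => ∫ σ in (0 : ℝ)..1,
      (1 + (σ : ℂ) ^ 2) * (α ^ (k + 1) * borelIter β k (σ * s)))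
      (∫ σ in (0 : ℝ)..1, (1 + (σ : ℂ) ^ 2) * jostBorel α β (σ * s)) := by
    refine intervalIntegral.hasSum_integral_of_dominated_convergence
      (fun k _ => 2 * (‖α‖ * ((2 * ‖α‖ * |s|) ^ k / k.factorial))) ?_ ?_ ?_ ?_ ?_
    · intro k
      have : Continuous fun σ : ℝ => borelIter β k (σ * s) :=
        (continuous_borelIter hβ k).comp (by fun_prop)
      exact (Continuous.mul (by fun_prop) (continuous_const.mul this)).aestronglyMeasurable
    · intro k
      refine Eventually.of_forall fun σ hσ => ?_
      rw [Set.uIoc_of_le zero_le_one] at hσ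
      have h1 : ‖(1 + (σ : ℂ) ^ 2)‖ ≤ 2 := by
        refine (norm_add_le _ _).trans ?_
        rw [norm_one, norm_pow, Complex.norm_real, Real.norm_of_nonneg hσ.1.le]
        have := pow_le_one₀ (n := 2) hσ.1.le hσ.2
        linarith
      have h2 : |σ * s| ≤ |s| := by
        rw [abs_mul, abs_of_pos hσ.1]
        exact mul_le_of_le_one_left (abs_nonneg s) hσ.2
      rw [norm_mul]
      exact mul_le_mul h1 (norm_borel_term_le hβ le_rfl k h2) (norm_nonneg _) zero_le_two
    · exact Eventually.of_forall fun σ _ => (summable_borel_bound _ _).mul_left 2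
    · exact intervalIntegrable_const
    · exact Eventually.of_forall fun σ _ => (hasSum_borel hβ α (σ * s)).mul_left _
  have h0 := hasSum_borel hβ α s
  rw [← hasSum_nat_add_iff' 1] at h0
  have h1 := hsum.mul_left (α * ((s : ℂ) ^ 2 / (2 * (((|s| : ℝ) : ℂ) + β))))
  have heq : (fun k : ℕ => α * ((s : ℂ) ^ 2 / (2 * (((|s| : ℝ) : ℂ) + β))) *
      ∫ σ in (0 : ℝ)..1, (1 + (σ : ℂ) ^ 2) * (α ^ (k + 1) * borelIter β k (σ * s))) =
      fun k => α ^ (k + 1 + 1) * borelIter β (k + 1) s := by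
    ext k
    rw [borelIter, show (fun σ : ℝ => (1 + (σ : ℂ) ^ 2) * (α ^ (k + 1) * borelIter β k (σ * s))) =
      fun σ : ℝ => α ^ (k + 1) * ((1 + (σ : ℂ) ^ 2) * borelIter β k (σ * s)) by ext; ring,
      intervalIntegral.integral_const_mul]
    ring
  rw [heq] at h1
  have h2 := h0.unique h1
  rw [Finset.sum_range_one, zero_add, pow_one, sub_eq_iff_eq_add] at h2
  refine h2.trans ?_
  rw [borelIter, add_comm]

/-- The Volterra equation for the Borel transform. -/
theorem borel_volterra {β : ℂ} (hβ : β ∈ wideSector) (α : ℂ) {s : ℝ} (hs : 0 < s) :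
    s * (s + β) * jostBorel α β s = α / 2 * ((s : ℂ) ^ 2 +
      (s : ℂ) ^ 2 * (∫ t in (0 : ℝ)..s, jostBorel α β t) +
        ∫ t in (0 : ℝ)..s, (t : ℂ) ^ 2 * jostBorel α β t) := by
  have hne : (s : ℂ) + β ≠ 0 := by
    simpa [abs_of_pos hs] using add_ne_zero_of_mem_wideSector hβ s
  have hs' : (s : ℂ) ≠ 0 := by exact_mod_cast hs.ne'
  have hc := continuous_borel hβ α
  have hsub : (s : ℂ) ^ 3 * ∫ σ in (0 : ℝ)..1, (1 + (σ : ℂ) ^ 2) * jostBorel α β (σ * s) =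
      (s : ℂ) ^ 2 * (∫ t in (0 : ℝ)..s, jostBorel α β t) +
        ∫ t in (0 : ℝ)..s, (t : ℂ) ^ 2 * jostBorel α β t := by
    have h1 := intervalIntegral.integral_comp_mul_right (a := 0) (b := 1) (c := s)
      (fun t : ℝ => (1 + ((t / s : ℝ) : ℂ) ^ 2) * jostBorel α β t) hs.ne'
    have h2 : (fun σ : ℝ => (1 + ((σ * s / s : ℝ) : ℂ) ^ 2) * jostBorel α β (σ * s)) =
        fun σ : ℝ => (1 + (σ : ℂ) ^ 2) * jostBorel α β (σ * s) := by
      ext σ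
      rw [mul_div_assoc, div_self hs.ne', mul_one]
    rw [h2, zero_mul, one_mul] at h1
    rw [h1, ← intervalIntegral.integral_const_mul, ← intervalIntegral.integral_add,
      Complex.real_smul, ← mul_assoc, ← intervalIntegral.integral_const_mul]
    · refine intervalIntegral.integral_congr fun t _ => ?_
      push_cast
      field_simp
    · exact (continuous_const.mul hc).intervalIntegrable _ _
    · exact (Continuous.mul (by fun_prop) hc).intervalIntegrable _ _
  rw [add_assoc ((s : ℂ) ^ 2), ← hsub, borel_eq_integral hβ α s, abs_of_pos hs]
  generalize (∫ σ in (0 : ℝ)..1, (1 + (σ : ℂ) ^ 2) * jostBorel α β (σ * s)) = J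
  field_simp

/-- Scaling of the Borel transform. -/
theorem borelIter_scale {z : ℝ} (hz : 0 < z) (k : ℕ) (s : ℝ) :
    borelIter z k (z * s) = (z : ℂ) ^ k * borelIter 1 k s := by
  have hz' : (z : ℂ) ≠ 0 := by exact_mod_cast hz.ne'
  have h1 : (1 : ℂ) ∈ wideSector := by simp [wideSector]
  have hne := add_ne_zero_of_mem_wideSector h1 s
  have habs : ((|z * s| : ℝ) : ℂ) = z * ((|s| : ℝ) : ℂ) := by rw [abs_mul, abs_of_pos hz]; push_cast; rfl
  have hfac : ((|z * s| : ℝ) : ℂ) + z = z * (((|s| : ℝ) : ℂ) + 1) := by rw [habs]; ring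
  induction k generalizing s with
  | zero =>
    simp only [borelIter, habs]
    field_simp
  | succ k ih =>
    have h2 : ∀ σ : ℝ, borelIter z k (σ * (z * s)) = (z : ℂ) ^ k * borelIter 1 k (σ * s) := by
      intro σ
      have hne' := add_ne_zero_of_mem_wideSector h1 (σ * s)
      have habs' : ((|z * (σ * s)| : ℝ) : ℂ) = z * ((|σ * s| : ℝ) : ℂ) := by
        rw [abs_mul, abs_of_pos hz]; push_cast; rfl
      rw [show σ * (z * s) = z * (σ * s) by ring]
      exact ih (σ * s) hne' habs' (by rw [habs']; ring)
    simp only [borelIter, hfac, h2]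
    rw [show (fun σ : ℝ => (1 + (σ : ℂ) ^ 2) * ((z : ℂ) ^ k * borelIter 1 k (σ * s))) =
      fun σ : ℝ => (z : ℂ) ^ k * ((1 + (σ : ℂ) ^ 2) * borelIter 1 k (σ * s)) by ext; ring,
      intervalIntegral.integral_const_mul]
    generalize (∫ σ in (0 : ℝ)..1, (1 + (σ : ℂ) ^ 2) * borelIter 1 k (σ * s)) = J
    push_cast
    field_simp
    ring

/-- Connects two normalizations: `β = z` at fixed radius, which reaches real `ω`, and `β = 1` with
the variable `zr`, which can be continued around `z = 0`. -/
theorem borel_scale {z : ℝ} (hz : 0 < z) (a : ℂ) (s : ℝ) :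
    z * jostBorel a z (z * s) = jostBorel (a * z) 1 s := by
  unfold jostBorel
  rw [← tsum_mul_left]
  refine tsum_congr fun k => ?_
  rw [borelIter_scale hz]
  ring

/-! ### Laplace transform and the confluent Heun equation. -/

theorem integral_pow_mul_exp_neg_mul (j : ℕ) {b : ℝ} (hb : 0 < b) :
    ∫ s in Set.Ioi (0 : ℝ), s ^ j * Real.exp (-(b * s)) = j.factorial / b ^ (j + 1) := by
  have h := Real.integral_rpow_mul_exp_neg_mul_Ioi (a := (j : ℝ) + 1) (by positivity) hb
  rw [Real.Gamma_nat_eq_factorial, add_sub_cancel_right] at h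
  simp only [Real.rpow_natCast] at h
  rw [h, ← Nat.cast_succ, Real.rpow_natCast, one_div, inv_pow]
  field_simp

theorem integrableOn_pow_mul_exp_neg_mul (j : ℕ) {b : ℝ} (hb : 0 < b) :
    MeasureTheory.IntegrableOn (fun s : ℝ => s ^ j * Real.exp (-(b * s))) (Set.Ioi 0) :=
  .of_integral_ne_zero (by rw [integral_pow_mul_exp_neg_mul j hb]; positivity)

/-- The moments `∫_0^∞ s^j e^{-xs} D(s; α, β) ds` of the Borel transform. -/
def borelLaplace (j : ℕ) (α β x : ℂ) : ℂ :=
  ∫ s in Set.Ioi (0 : ℝ), (s : ℂ) ^ j * Complex.exp (-(x * s)) * jostBorel α β s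

theorem norm_borelLaplace_integrand_le {β : ℂ} (hβ : β ∈ wideSector) (α x : ℂ) (j : ℕ) {δ : ℝ}
    (hδ : 2 * ‖α‖ + δ ≤ x.re) {s : ℝ} (hs : 0 < s) :
    ‖(s : ℂ) ^ j * Complex.exp (-(x * s)) * jostBorel α β s‖ ≤
      ‖α‖ * (s ^ j * Real.exp (-(δ * s))) := by
  rw [norm_mul, norm_mul, norm_pow, Complex.norm_real, Real.norm_of_nonneg hs.le, Complex.norm_exp]
  have h1 : (-(x * s)).re = -(x.re * s) := by simp
  rw [h1]
  have h2 := norm_borel_le hβ α s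
  rw [abs_of_pos hs] at h2
  calc s ^ j * Real.exp (-(x.re * s)) * ‖jostBorel α β s‖
      ≤ s ^ j * Real.exp (-(x.re * s)) * (‖α‖ * Real.exp (2 * ‖α‖ * s)) := by gcongr
    _ = ‖α‖ * (s ^ j * Real.exp (-((x.re - 2 * ‖α‖) * s))) := by
        have : -((x.re - 2 * ‖α‖) * s) = -(x.re * s) + 2 * ‖α‖ * s := by ring
        rw [this, Real.exp_add]; ring
    _ ≤ ‖α‖ * (s ^ j * Real.exp (-(δ * s))) := by
        have : δ ≤ x.re - 2 * ‖α‖ := by linarith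
        gcongr

theorem continuous_borelLaplace_integrand {β : ℂ} (hβ : β ∈ wideSector) (α x : ℂ) (j : ℕ) :
    Continuous fun s : ℝ => (s : ℂ) ^ j * Complex.exp (-(x * s)) * jostBorel α β s :=
  Continuous.mul (by fun_prop) (continuous_borel hβ α)

theorem integrableOn_borelLaplace {β : ℂ} (hβ : β ∈ wideSector) {α x : ℂ} (hx : 2 * ‖α‖ < x.re)
    (j : ℕ) : MeasureTheory.IntegrableOn
      (fun s : ℝ => (s : ℂ) ^ j * Complex.exp (-(x * s)) * jostBorel α β s) (Set.Ioi 0) := by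
  have hδ : 0 < x.re - 2 * ‖α‖ := by linarith
  refine MeasureTheory.Integrable.mono' ((integrableOn_pow_mul_exp_neg_mul j hδ).const_mul ‖α‖)
    (continuous_borelLaplace_integrand hβ α x j).aestronglyMeasurable ?_
  filter_upwards [MeasureTheory.ae_restrict_mem measurableSet_Ioi] with s hs
  exact norm_borelLaplace_integrand_le hβ α x j (by linarith) hs

theorem norm_borelLaplace_le {β : ℂ} (hβ : β ∈ wideSector) {α x : ℂ} {δ : ℝ} (hδ : 0 < δ)
    (hx : 2 * ‖α‖ + δ ≤ x.re) (j : ℕ) :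
    ‖borelLaplace j α β x‖ ≤ ‖α‖ * (j.factorial / δ ^ (j + 1)) := by
  rw [← integral_pow_mul_exp_neg_mul j hδ, ← MeasureTheory.integral_const_mul]
  refine MeasureTheory.norm_integral_le_of_norm_le
    ((integrableOn_pow_mul_exp_neg_mul j hδ).const_mul ‖α‖) ?_
  filter_upwards [MeasureTheory.ae_restrict_mem measurableSet_Ioi] with s hs
  exact norm_borelLaplace_integrand_le hβ α x j hx hs

theorem hasDerivAt_borelLaplace {β : ℂ} (hβ : β ∈ wideSector) {α x : ℂ} (hx : 2 * ‖α‖ < x.re)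
    (j : ℕ) : HasDerivAt (borelLaplace j α β) (-borelLaplace (j + 1) α β x) x := by
  set δ := (x.re - 2 * ‖α‖) / 2 with hδ
  have hδ0 : 0 < δ := by rw [hδ]; linarith
  have hball : ∀ y ∈ Metric.ball x δ, 2 * ‖α‖ + δ ≤ y.re := by
    intro y hy
    have h1 := (Complex.abs_re_le_norm _).trans_lt (mem_ball_iff_norm.1 hy)
    rw [Complex.sub_re] at h1
    have := (abs_lt.1 h1).1
    rw [hδ] at *
    linarith
  have h := (hasDerivAt_integral_of_dominated_loc_of_deriv_le
    (μ := MeasureTheory.volume.restrict (Set.Ioi (0 : ℝ)))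
    (F := fun (x : ℂ) (s : ℝ) => (s : ℂ) ^ j * Complex.exp (-(x * s)) * jostBorel α β s)
    (F' := fun (x : ℂ) (s : ℝ) => -((s : ℂ) ^ (j + 1) * Complex.exp (-(x * s)) * jostBorel α β s))
    (x₀ := x) (s := Metric.ball x δ)
    (bound := fun s => ‖α‖ * (s ^ (j + 1) * Real.exp (-(δ * s))))
    (Metric.ball_mem_nhds _ hδ0) ?_ ?_ ?_ ?_ ?_ ?_).2
  · rw [MeasureTheory.integral_neg] at h
    exact h
  · exact Eventually.of_forall fun y =>
      (continuous_borelLaplace_integrand hβ α y j).aestronglyMeasurable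
  · exact integrableOn_borelLaplace hβ hx j
  · exact (continuous_borelLaplace_integrand hβ α x (j + 1)).neg.aestronglyMeasurable
  · filter_upwards [MeasureTheory.ae_restrict_mem measurableSet_Ioi] with s hs y hy
    rw [norm_neg]
    exact norm_borelLaplace_integrand_le hβ α y (j + 1) (hball y hy) hs
  · exact (integrableOn_pow_mul_exp_neg_mul (j + 1) hδ0).const_mul ‖α‖
  · refine Eventually.of_forall fun s y _ => ?_
    have h1 : HasDerivAt (fun y : ℂ => Complex.exp (-(y * s))) (Complex.exp (-(y * s)) * -(1 * s)) y :=
      ((hasDerivAt_id y).mul_const (s : ℂ)).neg.cexp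
    refine ((h1.const_mul ((s : ℂ) ^ j)).mul_const (jostBorel α β s)).congr_deriv ?_
    ring

/-- Serves both normalizations: `b = 1` with `x = zr`, and `b = z` with `x` fixed. -/
theorem differentiableAt_borelLaplace_param {U : Set ℂ} (hU : IsOpen U) {a b x : ℂ → ℂ}
    (ha : DifferentiableOn ℂ a U) (hb : DifferentiableOn ℂ b U) (hx : DifferentiableOn ℂ x U)
    (hbU : ∀ z ∈ U, b z ∈ wideSector) (hxU : ∀ z ∈ U, 2 * ‖a z‖ < (x z).re) (j : ℕ) {z₀ : ℂ}
    (hz : z₀ ∈ U) : DifferentiableAt ℂ (fun z => borelLaplace j (a z) (b z) (x z)) z₀ := by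
  set δ := ((x z₀).re - 2 * ‖a z₀‖) / 2 with hδ
  have hδ0 : 0 < δ := by have := hxU z₀ hz; rw [hδ]; linarith
  set V := {z ∈ U | 2 * ‖a z‖ + δ < (x z).re ∧ ‖a z‖ < ‖a z₀‖ + 1} with hV
  have haC := ha.continuousOn
  have hVn : V ∈ 𝓝 z₀ := by
    have h1 : ContinuousAt a z₀ := haC.continuousAt (hU.mem_nhds hz)
    have h2 : ContinuousAt x z₀ := hx.continuousOn.continuousAt (hU.mem_nhds hz)
    have h3 : ∀ᶠ z in 𝓝 z₀, 2 * ‖a z‖ + δ < (x z).re := by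
      have h4 : ContinuousAt (fun z => (x z).re - 2 * ‖a z‖) z₀ :=
        (Complex.continuous_re.continuousAt.comp h2).sub (h1.norm.const_mul 2)
      have h5 : δ < (x z₀).re - 2 * ‖a z₀‖ := by rw [hδ] at *; linarith
      filter_upwards [h4.eventually (lt_mem_nhds h5)] with z hz
      linarith
    have h4 : ∀ᶠ z in 𝓝 z₀, ‖a z‖ < ‖a z₀‖ + 1 := h1.norm.eventually (gt_mem_nhds (by linarith))
    filter_upwards [hU.mem_nhds hz, h3, h4] with z h5 h6 h7 using ⟨h5, h6, h7⟩
  have hVU : V ⊆ U := fun z hz => hz.1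
  refine differentiableAt_integral_of_dominated hVn
    (bound := fun s => (‖a z₀‖ + 1) * (s ^ j * Real.exp (-(δ * s)))) ?_ ?_ ?_ ?_
  · exact fun z hz =>
      (continuous_borelLaplace_integrand (hbU z hz.1) (a z) (x z) j).aestronglyMeasurable
  · refine Eventually.of_forall fun s => DifferentiableOn.mul ?_
      ((differentiableOn_borel hU ha hb hbU s).mono hVU)
    exact (((hx.mono hVU).mul_const (s : ℂ)).neg.cexp).const_mul _
  · filter_upwards [MeasureTheory.ae_restrict_mem measurableSet_Ioi] with s hs z hz
    refine (norm_borelLaplace_integrand_le (hbU z hz.1) (a z) (x z) j hz.2.1.le hs).trans ?_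
    have hs' : 0 < s := hs
    have := hz.2.2.le
    gcongr
  · exact (integrableOn_pow_mul_exp_neg_mul j hδ0).const_mul _

theorem borelLaplace_scale {z : ℝ} (hz : 0 < z) (a x : ℂ) (j : ℕ) :
    borelLaplace j a z x = (z : ℂ) ^ j * borelLaplace j (a * z) 1 (z * x) := by
  have hz' : (z : ℂ) ≠ 0 := by exact_mod_cast hz.ne'
  have h := MeasureTheory.integral_comp_mul_left_Ioi
    (fun s : ℝ => (s : ℂ) ^ j * Complex.exp (-(x * s)) * jostBorel a z s) 0 hz
  rw [mul_zero] at h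
  rw [borelLaplace, eq_comm, ← sub_eq_zero]
  have h2 : (fun s : ℝ => ((z * s : ℝ) : ℂ) ^ j * Complex.exp (-(x * ((z * s : ℝ) : ℂ))) *
      jostBorel a z (z * s)) = fun s : ℝ => ((z : ℂ) ^ j * (z : ℂ)⁻¹) * ((s : ℂ) ^ j *
        Complex.exp (-((z * x) * s)) * jostBorel (a * z) 1 s) := by
    ext s
    rw [← borel_scale hz]
    push_cast
    rw [mul_pow, show x * (z * s) = z * x * (s : ℂ) by ring]
    field_simp
  rw [h2, MeasureTheory.integral_const_mul, Complex.real_smul] at h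
  rw [borelLaplace, sub_eq_zero]
  generalize a * (z : ℂ) = A at h ⊢
  push_cast at h
  field_simp at h
  exact h


theorem norm_integral_mul_borel_le {β : ℂ} (hβ : β ∈ wideSector) (α : ℂ) (j : ℕ) {p : ℝ}
    (hp : 0 ≤ p) : ‖∫ t in (0 : ℝ)..p, (t : ℂ) ^ j * jostBorel α β t‖ ≤
      ‖α‖ * p ^ (j + 1) * Real.exp (2 * ‖α‖ * p) := by
  have := intervalIntegral.norm_integral_le_of_norm_le_const (a := 0) (b := p)
    (f := fun t : ℝ => (t : ℂ) ^ j * jostBorel α β t)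
    (C := p ^ j * (‖α‖ * Real.exp (2 * ‖α‖ * p))) ?_
  · rw [sub_zero, abs_of_nonneg hp] at this
    refine this.trans (le_of_eq ?_)
    ring
  · intro t ht
    rw [Set.uIoc_of_le hp] at ht
    have h := norm_borel_le hβ α t
    rw [abs_of_pos ht.1] at h
    rw [norm_mul, norm_pow, Complex.norm_real, Real.norm_of_nonneg ht.1.le]
    have h1 := ht.1.le
    have h2 := ht.2
    refine mul_le_mul (by gcongr) (h.trans (by gcongr)) (norm_nonneg _) (by positivity)

/-- The function `m(x) = 1 + ∫_0^∞ e^{-xs} D(s; α, β) ds` solves a confluent Heun equation. -/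
theorem borelLaplace_ode {β : ℂ} (hβ : β ∈ wideSector) {α x : ℂ} (hx : 2 * ‖α‖ < x.re) :
    x ^ 3 * borelLaplace 2 α β x - α * x ^ 2 * borelLaplace 2 α β x -
      α * x * borelLaplace 1 α β x + β * x ^ 3 * borelLaplace 1 α β x -
      α * (1 + borelLaplace 0 α β x) = 0 := by
  set D := jostBorel α β with hD
  have hDc : Continuous D := continuous_borel hβ α
  set B0 : ℝ → ℂ := fun p => ∫ t in (0 : ℝ)..p, D t with hB0
  set B2 : ℝ → ℂ := fun p => ∫ t in (0 : ℝ)..p, (t : ℂ) ^ 2 * D t with hB2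
  have hdB0 : ∀ p, HasDerivAt B0 (D p) p := fun p =>
    (hDc.integral_hasStrictDerivAt 0 p).hasDerivAt
  have hdB2 : ∀ p : ℝ, HasDerivAt B2 ((p : ℂ) ^ 2 * D p) p := fun p =>
    ((Continuous.mul (by fun_prop) hDc).integral_hasStrictDerivAt 0 p).hasDerivAt
  -- Boundary terms of three integrations by parts of `x³ e^{-xp} q(p)`, with `q` the right side of
  -- the Volterra equation. The values `H(0) = -α` and `H(∞) = 0` yield the inhomogeneous term.
  set H : ℝ → ℂ := fun p => -(Complex.exp (-(x * p)) * (α * (x ^ 2 / 2 *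
    ((p : ℂ) ^ 2 + (p : ℂ) ^ 2 * B0 p + B2 p) + x * p * (1 + B0 p) + (1 + B0 p)))) with hH
  set H' : ℝ → ℂ := fun p => Complex.exp (-(x * p)) * (x ^ 3 * (α / 2 *
    ((p : ℂ) ^ 2 + (p : ℂ) ^ 2 * B0 p + B2 p)) - α * x ^ 2 * (p : ℂ) ^ 2 * D p -
      α * x * p * D p - α * D p) with hH'
  have hHd : ∀ p, HasDerivAt H (H' p) p := by
    intro p
    have hp : HasDerivAt (fun p : ℝ => (p : ℂ)) 1 p := Complex.ofRealCLM.hasDerivAt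
    have he : HasDerivAt (fun p : ℝ => Complex.exp (-(x * p)))
        (Complex.exp (-(x * p)) * -(x * 1)) p := (hp.const_mul x).neg.cexp
    have h1 := (((hp.pow 2).add ((hp.pow 2).mul (hdB0 p))).add (hdB2 p)).const_mul (x ^ 2 / 2)
    have h2 := (hp.const_mul x).mul ((hdB0 p).const_add 1)
    have h3 := (he.mul (((h1.add h2).add ((hdB0 p).const_add 1)).const_mul α)).neg
    refine h3.congr_deriv ?_
    simp only [hH']
    push_cast
    simp
    ring
  set I : ℕ → ℝ → ℂ := fun j s => (s : ℂ) ^ j * Complex.exp (-(x * s)) * D s with hI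
  have hIi : ∀ j, MeasureTheory.IntegrableOn (I j) (Set.Ioi 0) := fun j =>
    integrableOn_borelLaplace hβ hx j
  have hIeq : ∀ j, ∫ s in Set.Ioi (0 : ℝ), I j s = borelLaplace j α β x := fun j => rfl
  have hH'eq : ∀ p ∈ Set.Ioi (0 : ℝ), x ^ 3 * I 2 p + x ^ 3 * β * I 1 p - α * x ^ 2 * I 2 p -
      α * x * I 1 p - α * I 0 p = H' p := by
    intro p hp
    have h := borel_volterra hβ α (s := p) hp
    simp only [hH', hI]
    rw [← hD] at h
    simp only [hB0, hB2]
    rw [← h]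
    ring
  have hint : MeasureTheory.IntegrableOn (fun p => x ^ 3 * I 2 p + x ^ 3 * β * I 1 p -
      α * x ^ 2 * I 2 p - α * x * I 1 p - α * I 0 p) (Set.Ioi 0) :=
    (((((hIi 2).const_mul _).add ((hIi 1).const_mul _)).sub ((hIi 2).const_mul _)).sub
      ((hIi 1).const_mul _)).sub ((hIi 0).const_mul _)
  have hlim : Tendsto H atTop (𝓝 0) := by
    -- The primitives `B0` and `B2` grow at most like a power times `e^{2‖α‖p}`, so `H` decays at
    -- rate `δ` up to powers of `p`.
    set δ := x.re - 2 * ‖α‖ with hδ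
    have hδ0 : 0 < δ := by rw [hδ]; linarith
    have hpow : ∀ n : ℕ, Tendsto (fun p : ℝ => p ^ n * Real.exp (-(δ * p))) atTop (𝓝 0) := by
      intro n
      have := Real.tendsto_pow_mul_exp_neg_atTop_nhds_zero n
      have h2 := (this.comp (tendsto_id.const_mul_atTop hδ0)).const_mul (δ⁻¹ ^ n)
      rw [mul_zero] at h2
      refine h2.congr fun p => ?_
      simp only [Function.comp, id, mul_pow]
      rw [← mul_assoc, ← mul_assoc, ← mul_pow, inv_mul_cancel₀ hδ0.ne', one_pow, one_mul]
    set A := ‖α‖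
    set X := ‖x‖
    have hbound : Tendsto (fun p : ℝ => A * (X ^ 2 / 2 * (p ^ 2 + A * p ^ 3 + A * p ^ 3) +
        X * (p + A * p ^ 2) + (1 + A * p)) * Real.exp (-(δ * p))) atTop (𝓝 0) := by
      have h0 := hpow 0
      have h1 := hpow 1
      have h2 := hpow 2
      have h3 := hpow 3
      have := (((h0.const_mul A).add (h1.const_mul (A * (X + A)))).add
        (h2.const_mul (A * (X ^ 2 / 2 + X * A)))).add (h3.const_mul (A * (X ^ 2 * A)))
      simp only [mul_zero, add_zero] at this
      refine this.congr fun p => ?_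
      ring
    refine squeeze_zero_norm' ?_ hbound
    filter_upwards [eventually_ge_atTop 0] with p hp
    have e1 : (1 : ℝ) ≤ Real.exp (2 * A * p) := Real.one_le_exp (by positivity)
    have b0 : ‖B0 p‖ ≤ A * p * Real.exp (2 * A * p) := by
      simpa using norm_integral_mul_borel_le hβ α 0 hp
    have b2 : ‖B2 p‖ ≤ A * p ^ 3 * Real.exp (2 * A * p) :=
      norm_integral_mul_borel_le hβ α 2 hp
    have hexp : Real.exp (-(δ * p)) = Real.exp (-(x.re * p)) * Real.exp (2 * A * p) := by
      rw [← Real.exp_add, hδ]; congr 1; ring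
    have hnp : ‖(p : ℂ)‖ = p := by rw [Complex.norm_real, Real.norm_of_nonneg hp]
    set E := Real.exp (2 * A * p) with hE
    have c1 : ‖(1 : ℂ) + B0 p‖ ≤ (1 + A * p) * E := by
      refine (norm_add_le _ _).trans ?_
      rw [norm_one]; nlinarith
    have c2 : ‖(p : ℂ) ^ 2 + (p : ℂ) ^ 2 * B0 p + B2 p‖ ≤
        (p ^ 2 + A * p ^ 3 + A * p ^ 3) * E := by
      refine (norm_add₃_le).trans ?_
      rw [norm_mul, norm_pow, hnp]
      have : p ^ 2 * ‖B0 p‖ ≤ p ^ 2 * (A * p * E) := by gcongr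
      have : p ^ 2 * 1 ≤ p ^ 2 * E := by gcongr
      nlinarith
    simp only [hH]
    rw [norm_neg, norm_mul, Complex.norm_exp]
    have hre : (-(x * p)).re = -(x.re * p) := by simp
    rw [hre, norm_mul]
    calc Real.exp (-(x.re * p)) * (A * ‖x ^ 2 / 2 *
          ((p : ℂ) ^ 2 + (p : ℂ) ^ 2 * B0 p + B2 p) + x * p * (1 + B0 p) + (1 + B0 p)‖)
        ≤ Real.exp (-(x.re * p)) * (A * (X ^ 2 / 2 * ((p ^ 2 + A * p ^ 3 + A * p ^ 3) * E) +
          X * p * ((1 + A * p) * E) + (1 + A * p) * E)) := by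
          gcongr
          refine (norm_add₃_le).trans ?_
          rw [norm_mul, norm_mul (x * p), norm_div, norm_pow, norm_mul, hnp, Complex.norm_ofNat]
          gcongr
      _ = _ := by rw [hexp]; ring
  have hkey := MeasureTheory.integral_Ioi_of_hasDerivAt_of_tendsto (a := 0)
    (hHd 0).continuousAt.continuousWithinAt (fun p _ => hHd p)
    (hint.congr_fun hH'eq measurableSet_Ioi) hlim
  rw [← MeasureTheory.setIntegral_congr_fun measurableSet_Ioi hH'eq] at hkey
  rw [MeasureTheory.integral_sub, MeasureTheory.integral_sub, MeasureTheory.integral_sub,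
    MeasureTheory.integral_add] at hkey
  · simp only [MeasureTheory.integral_const_mul, hIeq] at hkey
    have hH0 : H 0 = -α := by simp [hH, hB0, hB2]
    rw [hH0] at hkey
    linear_combination hkey
  · exact (hIi 2).const_mul _
  · exact (hIi 1).const_mul _
  · exact ((hIi 2).const_mul _).add ((hIi 1).const_mul _)
  · exact (hIi 2).const_mul _
  · exact (((hIi 2).const_mul _).add ((hIi 1).const_mul _)).sub ((hIi 2).const_mul _)
  · exact (hIi 1).const_mul _
  · exact ((((hIi 2).const_mul _).add ((hIi 1).const_mul _)).sub ((hIi 2).const_mul _)).sub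
      ((hIi 1).const_mul _)
  · exact (hIi 0).const_mul _

/-! ### Propagators and coordinates relative to the static solutions. -/

/-- The fundamental solution of `X' = ε A(t) X` and its inverse. -/
theorem exists_propagator {A : ℝ → (ℂ × ℂ) →L[ℂ] (ℂ × ℂ)} (hA : Continuous A) :
    ∃ X Y : ℝ → ℂ → (ℂ × ℂ) →L[ℂ] (ℂ × ℂ),
      (∀ ε, X 0 ε = 1) ∧ (∀ ε, Y 0 ε = 1) ∧ (∀ t, Y t 0 = 1) ∧
      (∀ t ε, HasDerivAt (fun t => X t ε) (ε • (A t * X t ε)) t) ∧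
      (∀ t ε, HasDerivAt (fun t => Y t ε) (-(ε • (Y t ε * A t))) t) ∧
      (∀ t, Differentiable ℂ (X t)) ∧ (∀ t, Differentiable ℂ (Y t)) ∧
      (∀ t ε, Y t ε * X t ε = 1) ∧ (∀ t ε, X t ε * Y t ε = 1) ∧
      ∀ T R : ℝ, ∃ C, ∀ t ε, |t| ≤ T → ‖ε‖ ≤ R → ‖Y t ε‖ ≤ C := by
  have hL : Continuous fun t => ContinuousLinearMap.compL ℂ (ℂ × ℂ) (ℂ × ℂ) (ℂ × ℂ) (A t) :=
    (ContinuousLinearMap.compL ℂ (ℂ × ℂ) (ℂ × ℂ) (ℂ × ℂ)).continuous.comp hA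
  have hR : Continuous fun t => -(ContinuousLinearMap.compL ℂ (ℂ × ℂ) (ℂ × ℂ) (ℂ × ℂ)).flip (A t) :=
    ((ContinuousLinearMap.compL ℂ (ℂ × ℂ) (ℂ × ℂ) (ℂ × ℂ)).flip.continuous.comp hA).neg
  obtain ⟨X, hX0, -, hXd, hXε, -⟩ := exists_linearODE_solution hL (1 : (ℂ × ℂ) →L[ℂ] (ℂ × ℂ))
  obtain ⟨Y, hY0, hYz, hYd, hYε, hYb⟩ := exists_linearODE_solution hR (1 : (ℂ × ℂ) →L[ℂ] (ℂ × ℂ))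
  have hXd' : ∀ t ε, HasDerivAt (fun t => X t ε) (ε • (A t * X t ε)) t := hXd
  have hYd' : ∀ t ε, HasDerivAt (fun t => Y t ε) (-(ε • (Y t ε * A t))) t := by
    intro t ε
    refine (hYd t ε).congr_deriv ?_
    rw [neg_apply, smul_neg]
    rfl
  have hYX : ∀ t ε, Y t ε * X t ε = 1 := by
    intro t ε
    have hd : ∀ s, HasDerivAt (fun s => Y s ε * X s ε) 0 s := by
      intro s
      refine ((hYd' s ε).mul (hXd' s ε)).congr_deriv ?_
      rw [neg_mul, smul_mul_assoc, mul_smul_comm, mul_assoc, neg_add_cancel]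
    have := is_const_of_deriv_eq_zero (fun s => (hd s).differentiableAt) (fun s => (hd s).deriv) t 0
    rw [this, hX0, hY0, one_mul]
  refine ⟨X, Y, hX0, hY0, hYz, hXd', hYd', hXε, hYε, hYX, fun t ε => ?_, hYb⟩
  -- In finite dimension a left inverse is also a right inverse.
  have h1 : (Y t ε : (ℂ × ℂ) →ₗ[ℂ] (ℂ × ℂ)) * (X t ε : (ℂ × ℂ) →ₗ[ℂ] (ℂ × ℂ)) = 1 := by
    have := congrArg (fun T : (ℂ × ℂ) →L[ℂ] (ℂ × ℂ) => (T : (ℂ × ℂ) →ₗ[ℂ] (ℂ × ℂ))) (hYX t ε)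
    exact this
  have h2 := mul_eq_one_comm.1 h1
  ext1 <;> ext1
  all_goals exact LinearMap.congr_fun h2 _

/-- The endomorphism of `ℂ²` with the given matrix entries. -/
def endOfEntries (p q r s : ℂ) : (ℂ × ℂ) →L[ℂ] (ℂ × ℂ) :=
  (p • ContinuousLinearMap.fst ℂ ℂ ℂ + q • ContinuousLinearMap.snd ℂ ℂ ℂ).prod
    (r • ContinuousLinearMap.fst ℂ ℂ ℂ + s • ContinuousLinearMap.snd ℂ ℂ ℂ)

@[simp]
theorem endOfEntries_apply (p q r s : ℂ) (x : ℂ × ℂ) :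
    endOfEntries p q r s x = (p * x.1 + q * x.2, r * x.1 + s * x.2) := by
  simp [endOfEntries]

theorem endOfEntries_eq (p q r s : ℂ) : endOfEntries p q r s =
    p • endOfEntries 1 0 0 0 + q • endOfEntries 0 1 0 0 + r • endOfEntries 0 0 1 0 +
      s • endOfEntries 0 0 0 1 := by
  ext <;> simp

theorem continuous_endOfEntries {X : Type*} [TopologicalSpace X] {p q r s : X → ℂ}
    (hp : Continuous p) (hq : Continuous q) (hr : Continuous r) (hs : Continuous s) :
    Continuous fun x => endOfEntries (p x) (q x) (r x) (s x) := by
  simp_rw [endOfEntries_eq (p _) (q _) (r _) (s _)]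
  fun_prop

/-- The second static solution `-(r / a) log(1 - a / r)` of the Regge-Wheeler equation with `l = 0`,
as a function of `r` and `L = log(1 - a / r)`. The first one is `r`. -/
def staticSol (a r L : ℂ) : ℂ := -(r / a) * L

/-- The derivative of `staticSol` in the Regge-Wheeler coordinate. -/
def staticSolDeriv (a r L : ℂ) : ℂ := -((1 - a / r) / a) * L - 1 / r

/-- The coordinates, relative to the two static solutions, of `φ = e^{-zu/2} m` and its derivative
in `u`, where `m₁` is the derivative of `m` in `r`. -/
def staticCoord (a z r L u m m₁ : ℂ) : ℂ × ℂ :=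
  (Complex.exp (-(z / 2 * u)) * (((1 - a / r) * m₁ - z / 2 * m) * staticSol a r L -
      m * staticSolDeriv a r L),
    Complex.exp (-(z / 2 * u)) * ((1 - a / r) * m - r * ((1 - a / r) * m₁ - z / 2 * m)))

/-- The coefficient matrix of the equation for the static coordinates. -/
def staticMat (a r L : ℂ) : (ℂ × ℂ) →L[ℂ] (ℂ × ℂ) :=
  endOfEntries (r * staticSol a r L) (staticSol a r L ^ 2) (-r ^ 2) (-(r * staticSol a r L))

/-- Cramer's rule: the Wronskian `r s' - r' s` of the static solutions `r` and `s` equals `-1`. -/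
theorem static_fst {a r : ℂ} (ha : a ≠ 0) (hr : r ≠ 0) (L z u m m₁ : ℂ) :
    r * (staticCoord a z r L u m m₁).1 + staticSol a r L * (staticCoord a z r L u m m₁).2 =
      Complex.exp (-(z / 2 * u)) * m := by
  simp only [staticCoord, staticSol, staticSolDeriv]
  field_simp
  ring

theorem static_snd {a r : ℂ} (ha : a ≠ 0) (hr : r ≠ 0) (L z u m m₁ : ℂ) :
    (1 - a / r) * (staticCoord a z r L u m m₁).1 +
      staticSolDeriv a r L * (staticCoord a z r L u m m₁).2 =
      Complex.exp (-(z / 2 * u)) * ((1 - a / r) * m₁ - z / 2 * m) := by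
  simp only [staticCoord, staticSol, staticSolDeriv]
  field_simp
  ring

/-! ### Static coordinates along a curve in the complex `r`-plane. -/

section Curve

variable {a z : ℂ} {r L u : ℝ → ℂ} {u' : ℂ} {t : ℝ}

theorem hasDerivAt_one_sub_div (hr0 : r t ≠ 0)
    (hr : HasDerivAt r ((1 - a / r t) * u') t) :
    HasDerivAt (fun t => 1 - a / r t) (a / r t ^ 2 * ((1 - a / r t) * u')) t := by
  have := ((hr.inv hr0).const_mul a).const_sub 1
  refine this.congr_deriv ?_
  field_simp

theorem hasDerivAt_staticSol (ha : a ≠ 0) (hr0 : r t ≠ 0)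
    (hr : HasDerivAt r ((1 - a / r t) * u') t) (hL : HasDerivAt L (a / r t ^ 2 * u') t) :
    HasDerivAt (fun t => staticSol a (r t) (L t)) (u' * staticSolDeriv a (r t) (L t)) t := by
  refine ((hr.div_const a).neg.mul hL).congr_deriv ?_
  simp only [staticSolDeriv, Pi.neg_apply]
  field_simp
  ring

theorem hasDerivAt_staticSolDeriv (ha : a ≠ 0) (hr0 : r t ≠ 0)
    (hr : HasDerivAt r ((1 - a / r t) * u') t) (hL : HasDerivAt L (a / r t ^ 2 * u') t) :
    HasDerivAt (fun t => staticSolDeriv a (r t) (L t))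
      (u' * ((1 - a / r t) * a / r t ^ 3) * staticSol a (r t) (L t)) t := by
  have h1 := (((hasDerivAt_one_sub_div hr0 hr).div_const a).neg.mul hL).sub (hr.inv hr0)
  have h2 : (fun t => staticSolDeriv a (r t) (L t)) =
      (fun t => -((1 - a / r t) / a)) * L - r⁻¹ := by
    ext t
    simp [staticSolDeriv]
  rw [h2]
  refine h1.congr_deriv ?_
  simp only [staticSol, Pi.neg_apply]
  field_simp
  ring

/-- The static coordinates of a solution satisfy `c' = (z² / 4) u' A c`. -/
theorem hasDerivAt_staticCoord {m m₁ : ℝ → ℂ} {m₂ : ℂ} (ha : a ≠ 0) (hr0 : r t ≠ 0)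
    (hr : HasDerivAt r ((1 - a / r t) * u') t) (hL : HasDerivAt L (a / r t ^ 2 * u') t)
    (hu : HasDerivAt u u' t) (hm : HasDerivAt m (m₁ t * ((1 - a / r t) * u')) t)
    (hm₁ : HasDerivAt m₁ (m₂ * ((1 - a / r t) * u')) t)
    (hode : r t ^ 3 * m₂ - a * r t ^ 2 * m₂ + a * r t * m₁ t - z * r t ^ 3 * m₁ t - a * m t = 0) :
    HasDerivAt (fun t => staticCoord a z (r t) (L t) (u t) (m t) (m₁ t))
      ((z ^ 2 / 4) • (u' • staticMat a (r t) (L t))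
        (staticCoord a z (r t) (L t) (u t) (m t) (m₁ t))) t := by
  set e : ℝ → ℂ := fun t => Complex.exp (-(z / 2 * u t)) with he
  set φ : ℝ → ℂ := fun t => e t * m t with hφ
  set π : ℝ → ℂ := fun t => e t * ((1 - a / r t) * m₁ t - z / 2 * m t) with hπ
  have hed : HasDerivAt e (e t * -(z / 2 * u')) t := (hu.const_mul (z / 2)).neg.cexp
  have hφd : HasDerivAt φ (u' * π t) t := by
    refine (hed.mul hm).congr_deriv ?_
    simp only [hπ]
    ring
  -- The equation for `m` divided by `r³`. With the factor `e^{-zu/2}` it becomes `φ'' = (V + z²/4)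
  -- φ` in the variable `u`.
  have hV : (1 - a / r t) * m₂ + a / r t ^ 2 * m₁ t - z * m₁ t = a / r t ^ 3 * m t := by
    field_simp
    linear_combination hode
  have hπd : HasDerivAt π (u' * ((1 - a / r t) * a / r t ^ 3 + z ^ 2 / 4) * φ t) t := by
    refine (hed.mul (((hasDerivAt_one_sub_div hr0 hr).mul hm₁).sub
      (hm.const_mul (z / 2)))).congr_deriv ?_
    simp only [hφ, Pi.sub_apply, Pi.mul_apply]
    linear_combination (e t * (1 - a / r t) * u') * hV
  have h1 := (hπd.mul (hasDerivAt_staticSol ha hr0 hr hL)).sub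
    (hφd.mul (hasDerivAt_staticSolDeriv ha hr0 hr hL))
  have h2 := ((hasDerivAt_one_sub_div hr0 hr).mul hφd).sub (hr.mul hπd)
  have heq : (fun t => staticCoord a z (r t) (L t) (u t) (m t) (m₁ t)) =
      fun t => ((π * (fun t => staticSol a (r t) (L t)) -
        φ * fun t => staticSolDeriv a (r t) (L t)) t, ((fun t => 1 - a / r t) * φ - r * π) t) := by
    ext t
    · simp [staticCoord, hφ, hπ, he]; ring
    · simp [staticCoord, hφ, hπ, he]; ring
  -- The potential terms cancel in the coordinates; what remains is `z²/4` times `φ` times a static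
  -- solution, and `φ` is written back in the coordinates.
  have hfst := static_fst ha hr0 (L t) z (u t) (m t) (m₁ t)
  set c := staticCoord a z (r t) (L t) (u t) (m t) (m₁ t) with hc
  have hfst' : r t * c.1 + staticSol a (r t) (L t) * c.2 = φ t := hfst
  rw [heq]
  refine (h1.prodMk h2).congr_deriv ?_
  rw [Prod.ext_iff]
  constructor
  · simp [staticMat]
    linear_combination (-(z ^ 2 / 4) * u' * staticSol a (r t) (L t)) * hfst'
  · simp [staticMat]
    field_simp
    linear_combination (z ^ 2 * u' * r t ^ 4) * hfst'

end Curve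

/-! ### The circle `|r| = 4a`. -/

section Circle

open Complex

/-- The circle `|r| = 4a`. -/
def circleR (a θ : ℝ) : ℂ := 4 * a * exp (I * θ)

/-- `log(1 - a / r)` on the circle `|r| = 4a`. -/
def circleL (θ : ℝ) : ℂ := log (1 - exp (-(I * θ)) / 4)

/-- The Regge-Wheeler coordinate on the circle `|r| = 4a`. -/
def circleU (a θ : ℝ) : ℂ := circleR a θ + a * (Real.log 4 + I * θ + circleL θ)

/-- Since `|a / r| = 1/4`, the number `1 - a / r` stays in the right half-plane, so its logarithm is
single-valued around the circle. -/
theorem one_sub_exp_mem_slitPlane (θ : ℝ) : 1 - exp (-(I * θ)) / 4 ∈ slitPlane := by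
  left
  have h : ‖exp (-(I * θ))‖ = 1 := by rw [norm_exp]; simp
  have h2 := (re_le_norm (exp (-(I * θ)))).trans_eq h
  have h3 : (exp (-(I * θ)) / 4).re = (exp (-(I * θ))).re / 4 := by
    rw [show (4 : ℂ) = ((4 : ℝ) : ℂ) by norm_num, div_ofReal_re]
  rw [sub_re, one_re, h3]
  linarith

theorem circleR_ne_zero {a : ℝ} (ha : 0 < a) (θ : ℝ) : circleR a θ ≠ 0 := by
  have : (a : ℂ) ≠ 0 := by exact_mod_cast ha.ne'
  simp [circleR, this, exp_ne_zero]

theorem div_circleR {a : ℝ} (ha : 0 < a) (θ : ℝ) : a / circleR a θ = exp (-(I * θ)) / 4 := by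
  have : (a : ℂ) ≠ 0 := by exact_mod_cast ha.ne'
  rw [circleR, exp_neg]
  field_simp [exp_ne_zero]

theorem one_sub_div_circleR_ne_zero {a : ℝ} (ha : 0 < a) (θ : ℝ) : 1 - a / circleR a θ ≠ 0 := by
  rw [div_circleR ha]
  exact slitPlane_ne_zero (one_sub_exp_mem_slitPlane θ)

/-- The derivative of the Regge-Wheeler coordinate in the angle. -/
def circleSpeed (a θ : ℝ) : ℂ := I * circleR a θ / (1 - a / circleR a θ)

theorem continuous_circleR (a : ℝ) : Continuous (circleR a) := by
  unfold circleR; fun_prop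

theorem continuous_circleL : Continuous circleL := by
  unfold circleL
  exact Continuous.clog (by fun_prop) one_sub_exp_mem_slitPlane

theorem continuous_circleU (a : ℝ) : Continuous (circleU a) := by
  have h1 := continuous_circleR a
  have h2 := continuous_circleL
  unfold circleU
  fun_prop

theorem continuous_circleSpeed {a : ℝ} (ha : 0 < a) : Continuous (circleSpeed a) := by
  have h1 := continuous_circleR a
  exact (continuous_const.mul h1).div
    (continuous_const.sub (continuous_const.div h1 (circleR_ne_zero ha)))
    (one_sub_div_circleR_ne_zero ha)

theorem hasDerivAt_circleR' (a θ : ℝ) : HasDerivAt (circleR a) (I * circleR a θ) θ := by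
  have hp : HasDerivAt (fun p : ℝ => (p : ℂ)) 1 θ := ofRealCLM.hasDerivAt
  refine (((hp.const_mul I).cexp).const_mul (4 * (a : ℂ))).congr_deriv ?_
  simp only [circleR]; ring

theorem hasDerivAt_circleR {a : ℝ} (ha : 0 < a) (θ : ℝ) :
    HasDerivAt (circleR a) ((1 - a / circleR a θ) * circleSpeed a θ) θ := by
  refine (hasDerivAt_circleR' a θ).congr_deriv ?_
  have := one_sub_div_circleR_ne_zero ha θ
  rw [circleSpeed, mul_div_cancel₀ _ this]

theorem hasDerivAt_circleL {a : ℝ} (ha : 0 < a) (θ : ℝ) :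
    HasDerivAt circleL (a / circleR a θ ^ 2 * circleSpeed a θ) θ := by
  have hp : HasDerivAt (fun p : ℝ => (p : ℂ)) 1 θ := ofRealCLM.hasDerivAt
  have h1 := ((((hp.const_mul I).neg.cexp).div_const 4).const_sub 1).clog_real
    (one_sub_exp_mem_slitPlane θ)
  refine h1.congr_deriv ?_
  have h2 := one_sub_div_circleR_ne_zero ha θ
  have h3 := circleR_ne_zero ha θ
  have h4 := div_circleR ha θ
  simp only [Pi.neg_apply, circleSpeed]
  rw [← h4]
  have h5 : exp (-(I * θ)) = 4 * (a / circleR a θ) := by rw [h4]; ring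
  simp only [h5]
  field_simp

theorem hasDerivAt_circleU {a : ℝ} (ha : 0 < a) (θ : ℝ) :
    HasDerivAt (circleU a) (circleSpeed a θ) θ := by
  have hp : HasDerivAt (fun p : ℝ => (p : ℂ)) 1 θ := ofRealCLM.hasDerivAt
  refine ((hasDerivAt_circleR' a θ).add ((((hp.const_mul I).const_add
    ((Real.log 4 : ℝ) : ℂ)).add (hasDerivAt_circleL ha θ)).const_mul (a : ℂ))).congr_deriv ?_
  have h2 := one_sub_div_circleR_ne_zero ha θ
  have h3 := circleR_ne_zero ha θ
  rw [circleSpeed]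
  have h6 : circleR a θ - a ≠ 0 := by
    intro h
    apply h2
    rw [sub_eq_zero] at h
    rw [← h, div_self h3, sub_self]
  field_simp
  ring

theorem circleR_sub_two_pi (a θ : ℝ) : circleR a (θ - 2 * Real.pi) = circleR a θ := by
  unfold circleR
  push_cast
  rw [mul_sub, exp_sub, show I * (2 * Real.pi) = 2 * Real.pi * I by ring, exp_two_pi_mul_I, div_one]

theorem circleL_sub_two_pi (θ : ℝ) : circleL (θ - 2 * Real.pi) = circleL θ := by
  unfold circleL
  push_cast
  rw [show -(I * (θ - 2 * Real.pi)) = -(I * θ) + 2 * Real.pi * I by ring, exp_add,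
    exp_two_pi_mul_I, mul_one]

/-- Only the part `a log r` of the coordinate is multivalued. This shift produces the linear term of
the monodromy, and finally the constants `M^i / i!`. -/
theorem circleU_sub_two_pi (a θ : ℝ) :
    circleU a (θ - 2 * Real.pi) = circleU a θ - 2 * Real.pi * I * a := by
  unfold circleU
  rw [circleR_sub_two_pi, circleL_sub_two_pi]
  push_cast
  ring

theorem re_exp_mul_circleR (a θ : ℝ) (ζ : ℂ) :
    (exp ζ * circleR a θ).re = 4 * a * (Real.exp ζ.re * Real.cos (ζ.im + θ)) := by
  have : exp ζ * circleR a θ = ((4 * a : ℝ) : ℂ) * exp (ζ + I * θ) := by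
    rw [circleR, exp_add]; push_cast; ring
  rw [this, re_ofReal_mul, exp_re]
  simp

/-- Radius `4a` and angle `π/3` fit together: `4a cos > 2a`, which is the convergence condition with
`α = az`, `x = zr`. -/
theorem two_norm_lt_re_mul_circleR {a : ℝ} (ha : 0 < a) {θ : ℝ} {ζ : ℂ}
    (h : |ζ.im + θ| < Real.pi / 3) : 2 * ‖(a : ℂ) * exp ζ‖ < (exp ζ * circleR a θ).re := by
  have hc : 1 / 2 < Real.cos (ζ.im + θ) := by
    rw [← Real.cos_abs, ← Real.cos_pi_div_three]
    exact Real.cos_lt_cos_of_nonneg_of_le_pi (abs_nonneg _) (by linarith [Real.pi_pos]) h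
  rw [re_exp_mul_circleR, norm_mul, norm_exp, norm_real, Real.norm_of_nonneg ha.le]
  have := mul_pos ha (Real.exp_pos ζ.re)
  nlinarith

/-- The static coordinates of the Jost solution on the circle `|r| = 4a`, with `z = e^ζ`. -/
def circleCoord (a θ : ℝ) (ζ : ℂ) : ℂ × ℂ :=
  staticCoord a (exp ζ) (circleR a θ) (circleL θ) (circleU a θ)
    (1 + borelLaplace 0 (a * exp ζ) 1 (exp ζ * circleR a θ))
    (-(exp ζ * borelLaplace 1 (a * exp ζ) 1 (exp ζ * circleR a θ)))

theorem one_mem_wideSector : (1 : ℂ) ∈ wideSector := by simp [wideSector]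

/-- The coefficient matrix on the circle. -/
def circleMat (a θ : ℝ) : (ℂ × ℂ) →L[ℂ] (ℂ × ℂ) :=
  circleSpeed a θ • staticMat a (circleR a θ) (circleL θ)

theorem continuous_circleMat {a : ℝ} (ha : 0 < a) : Continuous (circleMat a) := by
  have h1 := continuous_circleR a
  have h2 := continuous_circleL
  have h3 := continuous_circleSpeed ha
  have h4 : Continuous fun θ => staticSol a (circleR a θ) (circleL θ) := by
    unfold staticSol; fun_prop
  exact h3.smul (continuous_endOfEntries (h1.mul h4) (h4.pow 2) (h1.pow 2).neg (h1.mul h4).neg)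

theorem circleMat_sub_two_pi (a θ : ℝ) : circleMat a (θ - 2 * Real.pi) = circleMat a θ := by
  simp only [circleMat, circleSpeed, circleR_sub_two_pi, circleL_sub_two_pi]

theorem hasDerivAt_circleCoord {a : ℝ} (ha : 0 < a) {θ : ℝ} {ζ : ℂ}
    (h : |ζ.im + θ| < Real.pi / 3) :
    HasDerivAt (fun θ => circleCoord a θ ζ)
      ((exp ζ ^ 2 / 4) • circleMat a θ (circleCoord a θ ζ)) θ := by
  have hx := two_norm_lt_re_mul_circleR ha h
  have ha' : (a : ℂ) ≠ 0 := by exact_mod_cast ha.ne'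
  have hI : ∀ j, HasDerivAt
      (fun θ => borelLaplace j (a * exp ζ) 1 (exp ζ * circleR a θ))
      (-borelLaplace (j + 1) (a * exp ζ) 1 (exp ζ * circleR a θ) *
        (exp ζ * ((1 - a / circleR a θ) * circleSpeed a θ))) θ := fun j =>
    HasDerivAt.comp (h₂ := borelLaplace j (a * exp ζ) 1) (h := fun θ => exp ζ * circleR a θ) θ
      (hasDerivAt_borelLaplace one_mem_wideSector hx j)
      ((hasDerivAt_circleR ha θ).const_mul (exp ζ))
  refine hasDerivAt_staticCoord (m₂ := exp ζ ^ 2 * borelLaplace 2 (a * exp ζ) 1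
    (exp ζ * circleR a θ)) ha' (circleR_ne_zero ha θ) (hasDerivAt_circleR ha θ)
    (hasDerivAt_circleL ha θ) (hasDerivAt_circleU ha θ) ?_ ?_ ?_
  · refine ((hI 0).const_add 1).congr_deriv ?_
    ring
  · refine ((hI 1).const_mul (exp ζ)).neg.congr_deriv ?_
    ring
  -- The Heun equation with `β = 1`, `α = az`, `x = zr` is `z` times the required one.
  · have hode := borelLaplace_ode one_mem_wideSector hx
    refine mul_left_cancel₀ (exp_ne_zero ζ) ?_
    rw [mul_zero, ← hode]
    ring

/-- The opposite turns of `r` and `z` restore everything except `u`, whose shift gives a scalar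
factor through `e^{-zu/2}`. -/
theorem circleCoord_sub_two_pi (a θ : ℝ) (ζ : ℂ) :
    circleCoord a (θ - 2 * Real.pi) (ζ + 2 * Real.pi * I) =
      exp (Real.pi * I * a * exp ζ) • circleCoord a θ ζ := by
  have he : exp (ζ + 2 * Real.pi * I) = exp ζ := by rw [exp_add, exp_two_pi_mul_I, mul_one]
  simp only [circleCoord, he, circleR_sub_two_pi, circleL_sub_two_pi, circleU_sub_two_pi]
  have h2 : exp (-(exp ζ / 2 * (circleU a θ - 2 * Real.pi * I * a))) =
      exp (Real.pi * I * a * exp ζ) * exp (-(exp ζ / 2 * circleU a θ)) := by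
    rw [← exp_add]; congr 1; ring
  simp only [staticCoord, h2, Prod.smul_mk, smul_eq_mul]
  refine Prod.ext ?_ ?_ <;> simp only <;> ring

end Circle

theorem HasDerivAt.clm_apply_real {Y : ℝ → (ℂ × ℂ) →L[ℂ] (ℂ × ℂ)} {Y' : (ℂ × ℂ) →L[ℂ] (ℂ × ℂ)}
    {c : ℝ → ℂ × ℂ} {c' : ℂ × ℂ} {t : ℝ} (hY : HasDerivAt Y Y' t) (hc : HasDerivAt c c' t) :
    HasDerivAt (fun t => Y t (c t)) (Y' (c t) + Y t c') t :=
  (((ContinuousLinearMap.restrictScalarsL ℂ (ℂ × ℂ) (ℂ × ℂ) ℝ ℝ).hasFDerivAt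
    (x := Y t)).comp_hasDerivAt t hY).clm_apply hc

/-! ### Continuation around `z = 0` and its monodromy. -/

section Circle

open Complex

theorem differentiableAt_staticCoord (a r L : ℂ) {z u m m₁ : ℂ → ℂ} {ζ : ℂ}
    (hz : DifferentiableAt ℂ z ζ) (hu : DifferentiableAt ℂ u ζ) (hm : DifferentiableAt ℂ m ζ)
    (hm₁ : DifferentiableAt ℂ m₁ ζ) :
    DifferentiableAt ℂ (fun ζ => staticCoord a (z ζ) r L (u ζ) (m ζ) (m₁ ζ)) ζ := by
  unfold staticCoord
  fun_prop

theorem differentiableOn_circleCoord {a : ℝ} (ha : 0 < a) (θ : ℝ) :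
    DifferentiableOn ℂ (circleCoord a θ) {ζ | |ζ.im + θ| < Real.pi / 3} := by
  intro ζ hζ
  have hU : IsOpen {ζ : ℂ | |ζ.im + θ| < Real.pi / 3} :=
    isOpen_lt (by fun_prop) continuous_const
  have hI : ∀ j, DifferentiableAt ℂ
      (fun ζ => borelLaplace j (a * exp ζ) 1 (exp ζ * circleR a θ)) ζ := fun j =>
    differentiableAt_borelLaplace_param hU (a := fun ζ => a * exp ζ) (b := fun _ => 1)
      (x := fun ζ => exp ζ * circleR a θ) (by fun_prop) (by fun_prop) (by fun_prop)
      (fun _ _ => one_mem_wideSector) (fun _ h => two_norm_lt_re_mul_circleR ha h) j hζ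
  exact (differentiableAt_staticCoord a _ _ (by fun_prop) (differentiableAt_const _)
    ((hI 0).const_add 1)
    ((DifferentiableAt.fun_mul (by fun_prop) (hI 1)).fun_neg)).differentiableWithinAt

/-- The choice `θ = -Im ζ` makes `zr = 4a|z|` positive. With margin `δ = 2a|z|` the bounds for `m`
and its derivative do not depend on `z`, so all arguments of the coordinates lie in a compact set.
-/
theorem norm_circleCoord_le {a : ℝ} (ha : 0 < a) :
    ∃ C, ∀ ζ : ℂ, ζ.re ≤ 0 → 0 ≤ ζ.im → ζ.im ≤ 2 * Real.pi → ‖circleCoord a (-ζ.im) ζ‖ ≤ C := by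
  set F : ℝ × ℂ × ℂ × ℂ → ℂ × ℂ := fun p =>
    staticCoord a p.2.1 (circleR a p.1) (circleL p.1) (circleU a p.1) p.2.2.1 p.2.2.2 with hF
  have hFc : Continuous F := by
    have h1 := continuous_circleR a
    have h2 := continuous_circleL
    have h3 := continuous_circleU a
    have h4 : Continuous fun θ => 1 / circleR a θ := continuous_const.div h1 (circleR_ne_zero ha)
    have h5 : Continuous fun θ => a / circleR a θ := continuous_const.div h1 (circleR_ne_zero ha)
    simp only [hF, staticCoord, staticSol, staticSolDeriv]
    have h6 : Continuous fun p : ℝ × ℂ × ℂ × ℂ => 1 / circleR a p.1 := h4.comp continuous_fst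
    have h7 : Continuous fun p : ℝ × ℂ × ℂ × ℂ => a / circleR a p.1 := h5.comp continuous_fst
    fun_prop
  have hK : IsCompact (Set.Icc (-(2 * Real.pi)) 0 ×ˢ Metric.closedBall (0 : ℂ) 1 ×ˢ
      Metric.closedBall (0 : ℂ) (3 / 2) ×ˢ Metric.closedBall (0 : ℂ) (1 / (4 * a))) :=
    isCompact_Icc.prod ((isCompact_closedBall _ _).prod
      ((isCompact_closedBall _ _).prod (isCompact_closedBall _ _)))
  obtain ⟨C, hC⟩ := hK.exists_bound_of_continuousOn hFc.continuousOn
  refine ⟨C, fun ζ h1 h2 h3 => ?_⟩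
  have hz : 0 < ‖exp ζ‖ := norm_pos_iff.2 (exp_ne_zero _)
  have hx : (exp ζ * circleR a (-ζ.im)).re = 4 * a * ‖exp ζ‖ := by
    rw [re_exp_mul_circleR, add_neg_cancel, Real.cos_zero, mul_one, norm_exp]
  have hb := norm_borelLaplace_le one_mem_wideSector (α := a * exp ζ)
    (x := exp ζ * circleR a (-ζ.im)) (δ := 2 * a * ‖exp ζ‖) (by positivity) (by
      rw [hx, norm_mul, norm_real, Real.norm_of_nonneg ha.le]; linarith)
  rw [norm_mul, norm_real, Real.norm_of_nonneg ha.le] at hb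
  have hb0 := hb 0
  have hb1 := hb 1
  refine hC (-ζ.im, exp ζ, 1 + borelLaplace 0 (a * exp ζ) 1 (exp ζ * circleR a (-ζ.im)),
    -(exp ζ * borelLaplace 1 (a * exp ζ) 1 (exp ζ * circleR a (-ζ.im)))) ?_
  refine ⟨⟨by simp only; linarith, by simp only; linarith⟩, ?_, ?_, ?_⟩
  · rw [mem_closedBall_zero_iff, norm_exp]
    exact Real.exp_le_one_iff.2 h1
  · rw [mem_closedBall_zero_iff]
    refine (norm_add_le _ _).trans ?_
    have : a * ‖exp ζ‖ * ((0).factorial / (2 * a * ‖exp ζ‖) ^ (0 + 1)) = 1 / 2 := by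
      simp; field_simp
    rw [norm_one]
    linarith
  · rw [mem_closedBall_zero_iff, norm_neg, norm_mul]
    refine (mul_le_mul_of_nonneg_left hb1 hz.le).trans_eq ?_
    simp
    field_simp
    norm_num

/-- The Jost solution in static coordinates, as a function of `ζ = log z`: it is entire, and its
monodromy determines its form near `z = 0`. -/
theorem exists_jost_coord {a : ℝ} (ha : 0 < a) :
    ∃ v : ℂ → ℂ × ℂ, Differentiable ℂ v ∧
      (∀ ζ : ℂ, |ζ.im| < Real.pi / 3 → v ζ = circleCoord a 0 ζ) ∧
      ∃ (G : ℂ → (ℂ × ℂ) →L[ℂ] (ℂ × ℂ)) (w : ℂ → ℂ × ℂ) (δ : ℝ), 0 < δ ∧ AnalyticAt ℂ G 0 ∧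
        G 0 = 0 ∧ HasDerivAt G ((a / 2 : ℂ) • 1) 0 ∧ AnalyticAt ℂ w 0 ∧
        ∀ ζ, ‖exp ζ‖ < δ → v ζ = NormedSpace.exp (ζ • G (exp ζ)) (w (exp ζ)) := by
  obtain ⟨X, Y, hX0, hY0, hYz, hX, hY, -, hYε, hYX, hXY, hYb⟩ :=
    exists_propagator (continuous_circleMat ha)
  -- Transport back from angle `θ` to angle `0`; the result does not depend on `θ`, as long as the
  -- Laplace integral converges.
  set W : ℝ → ℂ → ℂ × ℂ := fun θ ζ => Y θ (exp ζ ^ 2 / 4) (circleCoord a θ ζ) with hW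
  have hWc : ∀ ζ θ₁ θ₂, |ζ.im + θ₁| < Real.pi / 3 → |ζ.im + θ₂| < Real.pi / 3 →
      W θ₁ ζ = W θ₂ ζ := by
    intro ζ θ₁ θ₂ h1 h2
    have hd : ∀ θ : ℝ, |ζ.im + θ| < Real.pi / 3 → HasDerivAt (fun θ => W θ ζ) 0 θ := by
      intro θ hθ
      refine ((hY θ (exp ζ ^ 2 / 4)).clm_apply_real (hasDerivAt_circleCoord ha hθ)).congr_deriv ?_
      rw [map_smul, neg_apply]
      exact neg_add_cancel _
    have hball : ∀ θ : ℝ, θ ∈ Metric.ball (-ζ.im) (Real.pi / 3) ↔ |ζ.im + θ| < Real.pi / 3 := by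
      intro θ
      rw [Metric.mem_ball, Real.dist_eq, sub_neg_eq_add, add_comm]
    exact Metric.isOpen_ball.is_const_of_deriv_eq_zero (convex_ball _ _).isPreconnected
      (fun θ hθ => (hd θ ((hball θ).1 hθ)).differentiableAt.differentiableWithinAt)
      (fun θ hθ => (hd θ ((hball θ).1 hθ)).deriv) ((hball _).2 h1) ((hball _).2 h2)
  have hpi := Real.pi_pos
  -- The angle varies with `Im ζ`, so holomorphy is not visible here; it follows because `v` locally
  -- equals `W` at a fixed angle.
  set v : ℂ → ℂ × ℂ := fun ζ => W (-ζ.im) ζ with hv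
  have hvW : ∀ ζ θ, |ζ.im + θ| < Real.pi / 3 → v ζ = W θ ζ := fun ζ θ h =>
    hWc ζ _ _ (by rw [add_neg_cancel, abs_zero]; positivity) h
  have hvd : Differentiable ℂ v := by
    intro ζ₀
    have hU : {ζ : ℂ | |ζ.im + -ζ₀.im| < Real.pi / 3} ∈ 𝓝 ζ₀ := by
      refine (isOpen_lt (by fun_prop) continuous_const).mem_nhds ?_
      change |ζ₀.im + -ζ₀.im| < Real.pi / 3
      rw [add_neg_cancel, abs_zero]; positivity
    have h1 : v =ᶠ[𝓝 ζ₀] W (-ζ₀.im) := by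
      filter_upwards [hU] with ζ hζ using hvW ζ _ hζ
    refine DifferentiableAt.congr_of_eventuallyEq ?_ h1
    have h2 := (differentiableOn_circleCoord ha (-ζ₀.im)).differentiableAt hU
    have h3 : DifferentiableAt ℂ (fun ζ => Y (-ζ₀.im) (exp ζ ^ 2 / 4)) ζ₀ :=
      (hYε (-ζ₀.im) (exp ζ₀ ^ 2 / 4)).fun_comp' ζ₀ (f := fun ζ => exp ζ ^ 2 / 4) (by fun_prop)
    exact h3.clm_apply h2
  -- Scalar factor from the shift of `u`, times transport around the circle. The latter depends on
  -- `z²`, so the derivative at `0` is `πia = 2πi · a/2`.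
  set Mh : ℂ → (ℂ × ℂ) →L[ℂ] (ℂ × ℂ) := fun z =>
    exp (Real.pi * I * a * z) • Y (-(2 * Real.pi)) (z ^ 2 / 4) with hMh
  have hYc : Differentiable ℂ fun z : ℂ => Y (-(2 * Real.pi)) (z ^ 2 / 4) := fun z =>
    (hYε _ (z ^ 2 / 4)).fun_comp' z (f := fun z => z ^ 2 / 4) (by fun_prop)
  have hMd : Differentiable ℂ Mh := by
    have : Differentiable ℂ fun z : ℂ => exp (Real.pi * I * a * z) := by fun_prop
    exact this.smul hYc
  have hM0 : Mh 0 = 1 := by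
    simp only [hMh, mul_zero, exp_zero]
    rw [show (0 : ℂ) ^ 2 / 4 = 0 by norm_num, hYz]
    exact one_smul ℂ _
  have hYc0 : HasDerivAt (fun z : ℂ => Y (-(2 * Real.pi)) (z ^ 2 / 4)) 0 0 := by
    have h1 := (hYε (-(2 * Real.pi)) ((0 : ℂ) ^ 2 / 4)).hasDerivAt
    have h2 : HasDerivAt (fun z : ℂ => z ^ 2 / 4) 0 0 := by
      refine (((hasDerivAt_id (0 : ℂ)).pow 2).div_const 4).congr_deriv ?_
      simp
    have := h1.scomp (0 : ℂ) h2
    rw [show (0 : ℂ) • deriv (Y (-(2 * Real.pi))) ((0 : ℂ) ^ 2 / 4) = 0 from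
      zero_smul ℂ (deriv (Y (-(2 * Real.pi))) ((0 : ℂ) ^ 2 / 4))] at this
    exact this
  have hM1 : HasDerivAt Mh ((2 * Real.pi * I * (a / 2 : ℂ)) • 1) 0 := by
    have h2 : HasDerivAt (fun z : ℂ => exp (Real.pi * I * a * z)) (Real.pi * I * a) 0 := by
      refine ((hasDerivAt_id (0 : ℂ)).const_mul (Real.pi * I * a : ℂ)).cexp.congr_deriv ?_
      simp
    refine (h2.smul hYc0).congr_deriv ?_
    rw [smul_zero, zero_add, show (0 : ℂ) ^ 2 / 4 = 0 by norm_num, hYz]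
    congr 1
    ring
  -- Floquet theory: the coefficient is `2π`-periodic, so the propagator shifted by a period differs
  -- by a constant factor.
  have hYper : ∀ θ ε, Y (θ - 2 * Real.pi) ε = Y (-(2 * Real.pi)) ε * Y θ ε := by
    intro θ ε
    have hd : ∀ s, HasDerivAt (fun s => Y (s - 2 * Real.pi) ε * X s ε) 0 s := by
      intro s
      have h1 := (hY (s - 2 * Real.pi) ε).comp_sub_const s (2 * Real.pi)
      rw [circleMat_sub_two_pi] at h1
      refine (h1.mul (hX s ε)).congr_deriv ?_
      have aux : ∀ A B C : (ℂ × ℂ) →L[ℂ] (ℂ × ℂ), -(ε • (B * A)) * C + B * ε • (A * C) = 0 := by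
        intro A B C
        ext1 <;> ext1 <;> simp
      exact aux _ _ _
    have := is_const_of_deriv_eq_zero (fun s => (hd s).differentiableAt) (fun s => (hd s).deriv) θ 0
    simp only [hX0, zero_sub, mul_one] at this
    rw [← this, mul_assoc, hXY, mul_one]
  have hper : ∀ ζ, v (ζ + 2 * Real.pi * I) = Mh (exp ζ) (v ζ) := by
    intro ζ
    have him : -(ζ + 2 * Real.pi * I).im = -ζ.im - 2 * Real.pi := by
      simp; ring
    have he : exp (ζ + 2 * Real.pi * I) = exp ζ := by rw [exp_add, exp_two_pi_mul_I, mul_one]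
    simp only [hv, hW, him, he]
    rw [hYper, circleCoord_sub_two_pi, map_smul]
    rfl
  obtain ⟨C₁, hC₁⟩ := hYb (2 * Real.pi) 1
  obtain ⟨C₂, hC₂⟩ := norm_circleCoord_le ha
  refine ⟨v, hvd, fun ζ h => ?_, exists_monodromy_factorization hvd hMd hM0 hM1 hper
    (C := C₁ * C₂) fun ζ h1 h2 h3 => ?_⟩
  · rw [hvW ζ 0 (by rwa [add_zero]), hW]
    simp only [hY0]
    rfl
  · have hz : ‖exp ζ‖ ≤ 1 := by
      rw [norm_exp]; exact Real.exp_le_one_iff.2 h1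
    have h4 := hC₁ (-ζ.im) (exp ζ ^ 2 / 4) (by rw [abs_neg, abs_of_nonneg h2]; exact h3) (by
      rw [norm_div, norm_pow]
      norm_num
      nlinarith [norm_nonneg (exp ζ)])
    refine ((Y (-ζ.im) (exp ζ ^ 2 / 4)).le_opNorm _).trans ?_
    exact mul_le_mul h4 (hC₂ ζ h1 h2 h3) (norm_nonneg _) ((norm_nonneg _).trans h4)

end Circle

/-! ### Representation at `r = 4a` in the wide sector. -/

section WideSector

open Complex

theorem exp_mem_wideSector {ζ : ℂ} (h : |ζ.im| < 3 * Real.pi / 4) : exp ζ ∈ wideSector := by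
  have h1 : 0 < Real.sin (|ζ.im| + Real.pi / 4) :=
    Real.sin_pos_of_pos_of_lt_pi (by have := Real.pi_pos; positivity) (by linarith)
  rw [Real.sin_add, Real.cos_pi_div_four, Real.sin_pi_div_four, Real.cos_abs] at h1
  have h2 : Real.sin |ζ.im| ≤ |Real.sin ζ.im| := by
    rcases abs_cases ζ.im with ⟨h, -⟩ | ⟨h, -⟩
    · rw [h]; exact le_abs_self _
    · rw [h, Real.sin_neg]; exact neg_le_abs _
  have h3 : 0 < Real.cos ζ.im + |Real.sin ζ.im| := by
    have h4 : 0 < √2 := by positivity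
    nlinarith
  simp only [wideSector, Set.mem_ofPred_eq, exp_re, exp_im, abs_mul, abs_of_pos (Real.exp_pos _)]
  rw [← mul_add]
  exact mul_pos (Real.exp_pos _) h3

theorem circleR_zero (a : ℝ) : circleR a 0 = 4 * a := by simp [circleR]

/-- The Jost solution in static coordinates at `r = 4a`, represented for `z` in a wide sector. -/
theorem jost_coord_eq {a : ℝ} (ha : 0 < a) {v : ℂ → ℂ × ℂ} (hv : Differentiable ℂ v)
    (hvc : ∀ ζ : ℂ, |ζ.im| < Real.pi / 3 → v ζ = circleCoord a 0 ζ) {ζ : ℂ}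
    (hζ : |ζ.im| < 3 * Real.pi / 4) :
    v ζ = staticCoord a (exp ζ) (4 * a) (circleL 0) (circleU a 0)
      (1 + borelLaplace 0 a (exp ζ) (4 * a)) (-borelLaplace 1 a (exp ζ) (4 * a)) := by
  set S : Set ℂ := {ζ | |ζ.im| < 3 * Real.pi / 4} with hS
  have hSo : IsOpen S := isOpen_lt (by fun_prop) continuous_const
  have hSc : IsPreconnected S := by
    have h1 : S = imCLM ⁻¹' Metric.ball 0 (3 * Real.pi / 4) := by
      ext ζ; simp [hS]
    rw [h1]
    exact ((convex_ball _ _).linear_preimage imCLM.toLinearMap).isPreconnected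
  set F : ℂ → ℂ × ℂ := fun ζ => staticCoord a (exp ζ) (4 * a) (circleL 0) (circleU a 0)
      (1 + borelLaplace 0 a (exp ζ) (4 * a)) (-borelLaplace 1 a (exp ζ) (4 * a)) with hF
  have hFd : DifferentiableOn ℂ F S := by
    intro ζ hζ
    have hI : ∀ j, DifferentiableAt ℂ (fun ζ => borelLaplace j a (exp ζ) (4 * a)) ζ := fun j =>
      differentiableAt_borelLaplace_param hSo (a := fun _ => (a : ℂ)) (b := exp)
        (x := fun _ => 4 * (a : ℂ)) (by fun_prop) (by fun_prop) (by fun_prop)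
        (fun _ h => exp_mem_wideSector h) (fun _ _ => by
          rw [norm_real, Real.norm_of_nonneg ha.le]
          simp
          linarith) j hζ
    exact (differentiableAt_staticCoord a _ _ (by fun_prop) (differentiableAt_const _)
      ((hI 0).const_add 1) (hI 1).fun_neg).differentiableWithinAt
  -- For positive `z` the substitution `s ↦ zs` turns one normalization into the other.
  have hreal : ∀ x : ℝ, v x = F x := by
    intro x
    rw [hvc x (by simp [Real.pi_pos]), hF]
    simp only [circleCoord, circleR_zero]
    have h := fun j => borelLaplace_scale (Real.exp_pos x) a (4 * a) j
    simp only [ofReal_exp] at h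
    simp [h 0, h 1]
  -- The identity theorem extends the equality from real `ζ` to the strip, hence to `arg z = ±π/2`.
  refine AnalyticOnNhd.eqOn_of_preconnected_of_frequently_eq (z₀ := 0)
    (hv.differentiableOn.analyticOnNhd hSo) (hFd.analyticOnNhd hSo) hSc
    (by simp [hS, Real.pi_pos]) ?_ hζ
  have h1 : Tendsto (fun x : ℝ => (x : ℂ)) (𝓝[≠] 0) (𝓝[≠] 0) := by
    refine tendsto_nhdsWithin_of_tendsto_nhds_of_eventually_within _ ?_ ?_
    · exact (continuous_ofReal.tendsto' 0 0 ofReal_zero).mono_left nhdsWithin_le_nhds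
    · filter_upwards [self_mem_nhdsWithin] with x hx using ofReal_ne_zero.2 hx
  exact h1.frequently (Eventually.frequently (Eventually.of_forall hreal))

end WideSector

/-! ### The radius and the potential as functions of `u`. -/

section Radius

variable {M : ℝ}

theorem two_mul_lt_schwarzschildRadius (hM : 0 < M) (u : ℝ) : 2 * M < schwarzschildRadius M u :=
  Function.invFunOn_mem ((reggeWheeler_bijOn hM).surjOn (Set.mem_univ u))

theorem reggeWheeler_schwarzschildRadius (hM : 0 < M) (u : ℝ) :
    reggeWheeler M (schwarzschildRadius M u) = u :=
  Function.invFunOn_eq ((reggeWheeler_bijOn hM).surjOn (Set.mem_univ u))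

theorem schwarzschildRadius_reggeWheeler (hM : 0 < M) {r : ℝ} (hr : 2 * M < r) :
    schwarzschildRadius M (reggeWheeler M r) = r :=
  (reggeWheeler_bijOn hM).injOn (two_mul_lt_schwarzschildRadius hM _) hr
    (reggeWheeler_schwarzschildRadius hM _)

/-- The logarithm is increasing, so `u` grows at least as fast as `r`; hence `r(u)` is monotone and
1-Lipschitz. -/
theorem reggeWheeler_sub_le (hM : 0 < M) {r s : ℝ} (hr : 2 * M < r) (hs : r ≤ s) :
    s - r ≤ reggeWheeler M s - reggeWheeler M r := by
  have h2 : 0 < 2 * M := by positivity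
  have h1 : 1 < r / (2 * M) := (one_lt_div h2).2 hr
  have h : r / (2 * M) ≤ s / (2 * M) := div_le_div_of_nonneg_right hs h2.le
  have hl := Real.log_le_log (by linarith : 0 < r / (2 * M) - 1)
    (by linarith : r / (2 * M) - 1 ≤ s / (2 * M) - 1)
  unfold reggeWheeler
  nlinarith

theorem monotone_schwarzschildRadius (hM : 0 < M) : Monotone (schwarzschildRadius M) := by
  intro u v huv
  by_contra! h
  have := reggeWheeler_sub_le hM (two_mul_lt_schwarzschildRadius hM v) h.le
  rw [reggeWheeler_schwarzschildRadius hM, reggeWheeler_schwarzschildRadius hM] at this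
  linarith

theorem continuous_schwarzschildRadius (hM : 0 < M) : Continuous (schwarzschildRadius M) := by
  refine (LipschitzWith.of_le_add fun u v => ?_).continuous
  rcases le_total (schwarzschildRadius M u) (schwarzschildRadius M v) with h | h
  · linarith [dist_nonneg (x := u) (y := v)]
  · have := reggeWheeler_sub_le hM (two_mul_lt_schwarzschildRadius hM v) h
    rw [reggeWheeler_schwarzschildRadius hM, reggeWheeler_schwarzschildRadius hM] at this
    have h2 := le_abs_self (u - v)
    rw [Real.dist_eq]
    linarith

theorem hasDerivAt_schwarzschildRadius (hM : 0 < M) (u : ℝ) :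
    HasDerivAt (schwarzschildRadius M) (1 - 2 * M / schwarzschildRadius M u) u := by
  have hr := two_mul_lt_schwarzschildRadius hM u
  set r := schwarzschildRadius M u with hrdef
  have h2 : 0 < 2 * M := by positivity
  have h1 : 1 < r / (2 * M) := (one_lt_div h2).2 hr
  have hd : HasDerivAt (reggeWheeler M) (1 + 2 * M * (1 / (2 * M) / (r / (2 * M) - 1))) r :=
    (hasDerivAt_id r).add (((((hasDerivAt_id r).div_const (2 * M)).sub_const 1).log
      (by simp only [id]; linarith)).const_mul (2 * M))
  have h3 : r - 2 * M ≠ 0 := by linarith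
  have h4 : r ≠ 0 := by linarith
  have h5 : 1 + 2 * M * (1 / (2 * M) / (r / (2 * M) - 1)) = r / (r - 2 * M) := by
    have : r / (2 * M) - 1 ≠ 0 := by linarith
    have h6 : r / (2 * M) - 1 = (r - 2 * M) / (2 * M) := by field_simp
    rw [h6]
    field_simp
    ring
  rw [h5] at hd
  refine (hd.of_local_left_inverse (continuous_schwarzschildRadius hM).continuousAt
    (div_ne_zero h4 h3) (Eventually.of_forall (reggeWheeler_schwarzschildRadius hM))).congr_deriv ?_
  field_simp

/-- From `log x ≤ x - 1` one gets `u ≤ 2r - 4M`. -/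
theorem half_le_schwarzschildRadius (hM : 0 < M) (u : ℝ) : u / 2 ≤ schwarzschildRadius M u := by
  have hr := two_mul_lt_schwarzschildRadius hM u
  have h2 : 0 < 2 * M := by positivity
  have h1 : 1 < schwarzschildRadius M u / (2 * M) := (one_lt_div h2).2 hr
  have h3 := Real.log_le_sub_one_of_pos (by linarith : 0 < schwarzschildRadius M u / (2 * M) - 1)
  have h4 := reggeWheeler_schwarzschildRadius hM u
  unfold reggeWheeler at h4
  have h5 := mul_le_mul_of_nonneg_left h3 h2.le
  have h6 : 2 * M * (schwarzschildRadius M u / (2 * M) - 1 - 1) =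
      schwarzschildRadius M u - 4 * M := by field_simp; ring
  linarith

theorem tendsto_schwarzschildRadius (hM : 0 < M) :
    Tendsto (schwarzschildRadius M) atTop atTop :=
  tendsto_atTop_mono (half_le_schwarzschildRadius hM) (tendsto_id.atTop_div_const two_pos)

theorem potential_zero (M u : ℝ) : potential M 0 u =
    (1 - 2 * M / schwarzschildRadius M u) * (2 * M) / schwarzschildRadius M u ^ 3 := by
  simp [potential]; ring

theorem potential_nonneg (hM : 0 < M) (u : ℝ) : 0 ≤ potential M 0 u := by
  have hr := two_mul_lt_schwarzschildRadius hM u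
  have h0 : 0 < schwarzschildRadius M u := by linarith
  have : 2 * M / schwarzschildRadius M u ≤ 1 := (div_le_one h0).2 hr.le
  rw [potential_zero]
  have : 0 ≤ 1 - 2 * M / schwarzschildRadius M u := by linarith
  positivity

theorem continuous_potential (hM : 0 < M) : Continuous (potential M 0) := by
  have h := continuous_schwarzschildRadius hM
  have h0 : ∀ u, schwarzschildRadius M u ≠ 0 := fun u => by
    have := two_mul_lt_schwarzschildRadius hM u
    linarith
  have h1 : potential M 0 = fun u =>
    (1 - 2 * M / schwarzschildRadius M u) * (2 * M) / schwarzschildRadius M u ^ 3 :=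
    funext (potential_zero M)
  rw [h1]
  exact ((continuous_const.sub (continuous_const.div h h0)).mul continuous_const).div (h.pow 3)
    fun u => pow_ne_zero 3 (h0 u)

/-- The tail integral of `V_0` is exactly `M / r²`, which makes all bounds on the iterates explicit.
-/
theorem hasDerivAt_potential_tail (hM : 0 < M) (u : ℝ) :
    HasDerivAt (fun u => M / schwarzschildRadius M u ^ 2) (-potential M 0 u) u := by
  have hr := two_mul_lt_schwarzschildRadius hM u
  have h0 : schwarzschildRadius M u ≠ 0 := by linarith
  refine (((hasDerivAt_schwarzschildRadius hM u).pow 2).inv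
    (pow_ne_zero 2 h0) |>.const_mul M).congr_deriv ?_
  rw [potential_zero]
  simp
  field_simp

theorem tendsto_potential_tail (hM : 0 < M) :
    Tendsto (fun u => M / schwarzschildRadius M u ^ 2) atTop (𝓝 0) :=
  ((tendsto_pow_atTop two_ne_zero).comp (tendsto_schwarzschildRadius hM)).const_div_atTop M

end Radius

/-! ### The Volterra equation and the iteration series. -/

section Volterra

open MeasureTheory

variable {M ω : ℝ}

/-- The kernel of the Volterra equation of the Jost solution. -/
def jostKernel (M ω u v : ℝ) : ℝ := 1 / ω * Real.sin (ω * (u - v)) * potential M 0 v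

/-- The crude bound `|sin| ≤ 1` suffices: the iteration is used only at fixed `ω ≠ 0`, never
uniformly as `ω → 0`. -/
theorem norm_jostKernel_le (hM : 0 < M) (u v : ℝ) :
    ‖(jostKernel M ω u v : ℂ)‖ ≤ potential M 0 v / |ω| := by
  rw [Complex.norm_real, jostKernel, norm_mul, norm_mul, norm_div, norm_one, Real.norm_eq_abs ω,
    Real.norm_of_nonneg (potential_nonneg hM v), Real.norm_eq_abs]
  have h1 := Real.abs_sin_le_one (ω * (u - v))
  have h2 := potential_nonneg hM v
  calc 1 / |ω| * |Real.sin (ω * (u - v))| * potential M 0 v ≤ 1 / |ω| * 1 * potential M 0 v := by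
        gcongr
    _ = _ := by ring

/-- With `W = M / (r² |ω|)` the integrand `-W' W^n` has the primitive `-W^(n+1) / (n+1)`; iterating
produces the factorials. -/
theorem hasDerivAt_tail_pow (hM : 0 < M) (n : ℕ) (u : ℝ) :
    HasDerivAt (fun u => (M / schwarzschildRadius M u ^ 2 / |ω|) ^ (n + 1) / (n + 1))
      (-(potential M 0 u / |ω| * (M / schwarzschildRadius M u ^ 2 / |ω|) ^ n)) u := by
  refine ((((hasDerivAt_potential_tail hM u).div_const |ω|).pow (n + 1)).div_const
    ((n : ℝ) + 1)).congr_deriv ?_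
  have : (n : ℝ) + 1 ≠ 0 := by positivity
  push_cast
  field_simp

theorem tendsto_tail_pow (hM : 0 < M) (n : ℕ) :
    Tendsto (fun u => (M / schwarzschildRadius M u ^ 2 / |ω|) ^ (n + 1) / (n + 1)) atTop
      (𝓝 0) := by
  have := (((tendsto_potential_tail hM).div_const |ω|).pow (n + 1)).div_const ((n : ℝ) + 1)
  simpa using this

theorem tail_nonneg (hM : 0 < M) (u : ℝ) : 0 ≤ M / schwarzschildRadius M u ^ 2 / |ω| := by
  positivity

theorem integrableOn_tail_pow (hM : 0 < M) (n : ℕ) (u : ℝ) :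
    IntegrableOn (fun v => potential M 0 v / |ω| * (M / schwarzschildRadius M v ^ 2 / |ω|) ^ n)
      (Set.Ioi u) := by
  have h := integrableOn_Ioi_deriv_of_nonpos' (a := u) (fun v _ => hasDerivAt_tail_pow (ω := ω) hM n v)
    (fun v _ => neg_nonpos.2 (mul_nonneg (div_nonneg (potential_nonneg hM v) (abs_nonneg _))
      (pow_nonneg (tail_nonneg hM v) n))) (tendsto_tail_pow hM n)
  simpa using h.neg

theorem integral_tail_pow (hM : 0 < M) (n : ℕ) (u : ℝ) :
    ∫ v in Set.Ioi u, potential M 0 v / |ω| * (M / schwarzschildRadius M v ^ 2 / |ω|) ^ n =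
      (M / schwarzschildRadius M u ^ 2 / |ω|) ^ (n + 1) / (n + 1) := by
  have h := integral_Ioi_of_hasDerivAt_of_nonpos' (a := u)
    (fun v _ => hasDerivAt_tail_pow (ω := ω) hM n v)
    (fun v _ => neg_nonpos.2 (mul_nonneg (div_nonneg (potential_nonneg hM v) (abs_nonneg _))
      (pow_nonneg (tail_nonneg hM v) n))) (tendsto_tail_pow hM n)
  rw [integral_neg] at h
  linarith

theorem norm_jostKernel_mul_le (hM : 0 < M) {f : ℝ → ℂ} {B : ℝ} {n : ℕ} {u v : ℝ}
    (hf : ‖f v‖ ≤ B * (M / schwarzschildRadius M v ^ 2 / |ω|) ^ n) :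
    ‖(jostKernel M ω u v : ℂ) * f v‖ ≤
      B * (potential M 0 v / |ω| * (M / schwarzschildRadius M v ^ 2 / |ω|) ^ n) := by
  rw [norm_mul]
  refine (mul_le_mul (norm_jostKernel_le hM u v) hf (norm_nonneg _)
    (div_nonneg (potential_nonneg hM v) (abs_nonneg _))).trans_eq ?_
  ring

theorem norm_integral_jostKernel_le (hM : 0 < M) {f : ℝ → ℂ} {B : ℝ} {n : ℕ} {u : ℝ}
    (hf : ∀ v, u < v → ‖f v‖ ≤ B * (M / schwarzschildRadius M v ^ 2 / |ω|) ^ n) :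
    ‖∫ v in Set.Ioi u, (jostKernel M ω u v : ℂ) * f v‖ ≤
      B * ((M / schwarzschildRadius M u ^ 2 / |ω|) ^ (n + 1) / (n + 1)) := by
  rw [← integral_tail_pow hM n u, ← integral_const_mul]
  refine norm_integral_le_of_norm_le ((integrableOn_tail_pow hM n u).const_mul B) ?_
  filter_upwards [ae_restrict_mem measurableSet_Ioi] with v hv
    using norm_jostKernel_mul_le hM (hf v hv)

theorem continuous_jostKernel (hM : 0 < M) (ω : ℝ) :
    Continuous fun p : ℝ × ℝ => (jostKernel M ω p.1 p.2 : ℂ) := by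
  have h := continuous_potential hM
  unfold jostKernel
  fun_prop

theorem integrableOn_jostKernel_mul (hM : 0 < M) {f : ℝ → ℂ} (hfm : StronglyMeasurable f)
    {B : ℝ} {n : ℕ} {u : ℝ}
    (hf : ∀ v, u < v → ‖f v‖ ≤ B * (M / schwarzschildRadius M v ^ 2 / |ω|) ^ n) :
    IntegrableOn (fun v => (jostKernel M ω u v : ℂ) * f v) (Set.Ioi u) := by
  refine Integrable.mono' ((integrableOn_tail_pow (ω := ω) hM n u).const_mul B) ?_ ?_
  · have h1 : Continuous fun v => (jostKernel M ω u v : ℂ) :=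
      (continuous_jostKernel hM ω).comp (f := fun v => (u, v)) (by fun_prop)
    exact h1.aestronglyMeasurable.mul hfm.aestronglyMeasurable
  · filter_upwards [ae_restrict_mem measurableSet_Ioi] with v hv
      using norm_jostKernel_mul_le hM (hf v hv)

theorem jostIter_succ (M ω : ℝ) (k : ℕ) (u : ℝ) :
    jostIter M ω (k + 1) u = -∫ v in Set.Ioi u, (jostKernel M ω u v : ℂ) * jostIter M ω k v := rfl

theorem stronglyMeasurable_jostIter (hM : 0 < M) (ω : ℝ) (k : ℕ) :
    StronglyMeasurable (jostIter M ω k) := by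
  induction k with
  | zero =>
    have : Continuous fun u : ℝ => Complex.exp (-(Complex.I * ω * u)) := by fun_prop
    exact this.stronglyMeasurable
  | succ k ih =>
    -- An indicator on the plane replaces the moving half-line, so that measurability of parametric
    -- integrals applies.
    have h1 : jostIter M ω (k + 1) = fun u => -∫ v, Set.indicator {p : ℝ × ℝ | p.1 < p.2}
        (fun p => (jostKernel M ω p.1 p.2 : ℂ) * jostIter M ω k p.2) (u, v) := by
      ext u
      rw [jostIter_succ, ← integral_indicator measurableSet_Ioi]
      rfl
    rw [h1]
    refine StronglyMeasurable.neg (StronglyMeasurable.integral_prod_right ?_)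
    exact ((continuous_jostKernel hM ω).stronglyMeasurable.mul
      (ih.comp_measurable measurable_snd)).indicator
      (measurableSet_lt measurable_fst measurable_snd)

/-- Stated for a general sequence because it serves both the iterates and the remainders of their
partial sums. -/
theorem norm_le_pow_div_factorial (hM : 0 < M) {f : ℕ → ℝ → ℂ} {B u₁ : ℝ}
    (h0 : ∀ u, u₁ ≤ u → ‖f 0 u‖ ≤ B)
    (hs : ∀ n u, f (n + 1) u = -∫ v in Set.Ioi u, (jostKernel M ω u v : ℂ) * f n v) (n : ℕ) :
    ∀ u, u₁ ≤ u → ‖f n u‖ ≤ B / n.factorial * (M / schwarzschildRadius M u ^ 2 / |ω|) ^ n := by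
  induction n with
  | zero => simpa using h0
  | succ n ih =>
    intro u hu
    rw [hs, norm_neg]
    refine (norm_integral_jostKernel_le hM fun v hv => ih v (hu.trans hv.le)).trans_eq ?_
    rw [Nat.factorial_succ]
    push_cast
    field_simp

theorem norm_jostIter_le (hM : 0 < M) (ω : ℝ) (k : ℕ) (u : ℝ) : ‖jostIter M ω k u‖ ≤
    1 / k.factorial * (M / schwarzschildRadius M u ^ 2 / |ω|) ^ k := by
  refine norm_le_pow_div_factorial hM (u₁ := u) (fun v _ => ?_) (jostIter_succ M ω) k u le_rfl
  rw [jostIter, Complex.norm_exp]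
  simp

theorem summable_jostIter (hM : 0 < M) (ω u : ℝ) : Summable fun k => jostIter M ω k u := by
  refine Summable.of_norm_bounded (Real.summable_pow_div_factorial
    (M / schwarzschildRadius M u ^ 2 / |ω|)) fun k => (norm_jostIter_le hM ω k u).trans_eq ?_
  ring

/-- A solution of the Jost equation with the asymptotics of the Jost solution satisfies the
Volterra equation. -/
theorem jost_volterra (hM : 0 < M) (hω : ω ≠ 0) {Φ Ψ : ℝ → ℂ} (hΦ : ∀ u, HasDerivAt Φ (Ψ u) u)
    (hΨ : ∀ u, HasDerivAt Ψ ((potential M 0 u - ω ^ 2) * Φ u) u)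
    (h1 : Tendsto (fun u : ℝ => Complex.exp (Complex.I * ω * u) * Φ u) atTop (𝓝 1))
    (h2 : Tendsto (fun u : ℝ => Complex.exp (Complex.I * ω * u) * Ψ u) atTop
      (𝓝 (-(Complex.I * ω)))) {u B : ℝ} (hB : ∀ v, u ≤ v → ‖Φ v‖ ≤ B) :
    Φ u = jostIter M ω 0 u - ∫ v in Set.Ioi u, (jostKernel M ω u v : ℂ) * Φ v := by
  have hω' : (ω : ℂ) ≠ 0 := by exact_mod_cast hω
  -- Variation of constants: `G(u) = Φ(u)`, `G'` is the kernel times `Φ`, and the limit at infinity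
  -- is `e^{-iωu}`.
  set G : ℝ → ℂ := fun v => Complex.sin (ω * (u - v)) / ω * Ψ v + Complex.cos (ω * (u - v)) * Φ v
    with hG
  have hGd : ∀ v, HasDerivAt G ((jostKernel M ω u v : ℂ) * Φ v) v := by
    intro v
    have hp : HasDerivAt (fun v : ℝ => (ω : ℂ) * (u - v)) (-ω) v :=
      ((Complex.ofRealCLM.hasDerivAt (x := v)).const_sub (u : ℂ)).const_mul (ω : ℂ) |>.congr_deriv
        (by simp)
    have hsin := HasDerivAt.comp v (Complex.hasDerivAt_sin (ω * (u - v))) hp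
    have hcos := HasDerivAt.comp v (Complex.hasDerivAt_cos (ω * (u - v))) hp
    refine (((hsin.div_const (ω : ℂ)).mul (hΨ v)).add (hcos.mul (hΦ v))).congr_deriv ?_
    simp only [Function.comp]
    rw [jostKernel]
    push_cast
    field_simp
    ring
  have hGl : Tendsto G atTop (𝓝 (jostIter M ω 0 u)) := by
    set P : ℂ := Complex.exp (Complex.I * ω * u) with hP
    set N : ℂ := Complex.exp (-(Complex.I * ω * u)) with hN
    have h3 : ∀ v : ℝ, Complex.exp (Complex.I * ω * v) * Complex.exp (-(Complex.I * ω * v)) = 1 := by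
      intro v; rw [← Complex.exp_add, add_neg_cancel, Complex.exp_zero]
    -- The component along the other exponential vanishes at infinity: an oscillating factor times a
    -- quantity tending to `1 - 1`.
    have hbd : Tendsto (fun v : ℝ => Complex.exp (-(Complex.I * ω * v)) *
        Complex.exp (-(Complex.I * ω * v)) * ((-(Complex.I * ω))⁻¹ *
          (Complex.exp (Complex.I * ω * v) * Ψ v) - Complex.exp (Complex.I * ω * v) * Φ v))
        atTop (𝓝 0) := by
      have h4 := (h2.const_mul (-(Complex.I * ω))⁻¹).sub h1
      rw [inv_mul_cancel₀ (neg_ne_zero.2 (mul_ne_zero Complex.I_ne_zero hω')), sub_self] at h4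
      refine squeeze_zero_norm (fun v => ?_) (tendsto_zero_iff_norm_tendsto_zero.1 h4)
      have h5 : ‖Complex.exp (-(Complex.I * ω * v))‖ = 1 := by rw [Complex.norm_exp]; simp
      rw [norm_mul, norm_mul, h5, one_mul, one_mul]
    have h6 := ((h1.const_mul (N / 2)).add ((h2.const_mul (N / 2 * (-(Complex.I * ω))⁻¹)))).sub
      (hbd.const_mul (P / 2))
    have h7 : N / 2 * 1 + N / 2 * (-(Complex.I * ω))⁻¹ * -(Complex.I * ω) - P / 2 * 0 =
        jostIter M ω 0 u := by
      rw [mul_assoc, inv_mul_cancel₀ (neg_ne_zero.2 (mul_ne_zero Complex.I_ne_zero hω')), jostIter]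
      ring
    rw [h7] at h6
    refine h6.congr fun v => ?_
    have e1 : Complex.exp ((ω : ℂ) * (u - v) * Complex.I) =
        P * Complex.exp (-(Complex.I * ω * v)) := by
      rw [hP, ← Complex.exp_add]; congr 1; ring
    have e2 : Complex.exp (-((ω : ℂ) * (u - v)) * Complex.I) =
        N * Complex.exp (Complex.I * ω * v) := by
      rw [hN, ← Complex.exp_add]; congr 1; ring
    simp only [hG, Complex.sin, Complex.cos]
    rw [e1, e2]
    have h8 := h3 v
    set x := Complex.exp (Complex.I * ω * v)
    set y := Complex.exp (-(Complex.I * ω * v))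
    have hI : (-(Complex.I * ω))⁻¹ = Complex.I / ω := by
      refine inv_eq_of_mul_eq_one_right ?_
      field_simp
      linear_combination -Complex.I_sq
    rw [hI]
    linear_combination (P / 2 * y * (Φ v - Complex.I / ω * Ψ v)) * h8
  have hΦc : Continuous Φ := continuous_iff_continuousAt.2 fun v => (hΦ v).continuousAt
  have hint := integrableOn_jostKernel_mul (ω := ω) hM hΦc.stronglyMeasurable (n := 0) (B := B) (u := u)
    fun v hv => by simpa using hB v hv.le
  have h := integral_Ioi_of_hasDerivAt_of_tendsto' (fun v _ => hGd v) hint hGl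
  rw [h, hG]
  simp

/-- A solution of the Jost equation with the asymptotics of the Jost solution is the sum of the
iteration. -/
theorem jost_eq_of_tendsto (hM : 0 < M) (hω : ω ≠ 0) {Φ Ψ : ℝ → ℂ}
    (hΦ : ∀ u, HasDerivAt Φ (Ψ u) u)
    (hΨ : ∀ u, HasDerivAt Ψ ((potential M 0 u - ω ^ 2) * Φ u) u)
    (h1 : Tendsto (fun u : ℝ => Complex.exp (Complex.I * ω * u) * Φ u) atTop (𝓝 1))
    (h2 : Tendsto (fun u : ℝ => Complex.exp (Complex.I * ω * u) * Ψ u) atTop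
      (𝓝 (-(Complex.I * ω)))) : jost M ω = Φ := by
  ext u
  have hΦc : Continuous Φ := continuous_iff_continuousAt.2 fun v => (hΦ v).continuousAt
  have hbd : ∀ u, ∃ B, ∀ v, u ≤ v → ‖Φ v‖ ≤ B := by
    intro u
    obtain ⟨T, hT⟩ := eventually_atTop.1 ((h1.norm).eventually_le_const
      (show ‖(1 : ℂ)‖ < 2 by norm_num))
    obtain ⟨C, hC⟩ := (isCompact_Icc (a := u) (b := T)).exists_bound_of_continuousOn hΦc.continuousOn
    refine ⟨max C 2, fun v hv => ?_⟩
    rcases le_total v T with h | h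
    · exact (hC v ⟨hv, h⟩).trans (le_max_left _ _)
    · refine le_trans ?_ (le_max_right _ _)
      have := hT v h
      rwa [norm_mul, Complex.norm_exp, show (Complex.I * ω * v : ℂ).re = 0 by simp, Real.exp_zero,
        one_mul] at this
  -- The remainders obey the same recursion as the iterates, starting from the bounded function `Φ`,
  -- and so tend to zero factorially.
  set D : ℕ → ℝ → ℂ := fun n u => Φ u - ∑ k ∈ Finset.range n, jostIter M ω k u with hD
  have hD0 : D 0 = Φ := by simp [hD]
  have hDs : ∀ n, D (n + 1) = fun u => D n u - jostIter M ω n u := by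
    intro n
    ext u
    simp only [hD, Finset.sum_range_succ]
    ring
  have hDm : ∀ n, StronglyMeasurable (D n) := by
    intro n
    induction n with
    | zero => rw [hD0]; exact hΦc.stronglyMeasurable
    | succ n ih => rw [hDs]; exact ih.sub (stronglyMeasurable_jostIter hM ω n)
  have hDb : ∀ n u, ∃ B, ∀ v, u ≤ v →
      ‖D n v‖ ≤ B * (M / schwarzschildRadius M v ^ 2 / |ω|) ^ 0 := by
    intro n u
    have hmono : ∀ k v, u ≤ v → ‖jostIter M ω k v‖ ≤
        1 / k.factorial * (M / schwarzschildRadius M u ^ 2 / |ω|) ^ k := by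
      intro k v hv
      refine (norm_jostIter_le hM ω k v).trans ?_
      have h3 := monotone_schwarzschildRadius hM hv
      have h4 : 0 < schwarzschildRadius M u :=
        lt_trans (by positivity) (two_mul_lt_schwarzschildRadius hM u)
      gcongr
    induction n with
    | zero =>
      obtain ⟨B, hB⟩ := hbd u
      exact ⟨B, fun v hv => by simpa [hD0] using hB v hv⟩
    | succ n ih =>
      obtain ⟨B, hB⟩ := ih
      refine ⟨B + 1 / n.factorial * (M / schwarzschildRadius M u ^ 2 / |ω|) ^ n, fun v hv => ?_⟩
      have h3 := hB v hv
      rw [pow_zero, mul_one] at h3 ⊢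
      rw [hDs]
      exact (norm_sub_le _ _).trans (add_le_add h3 (hmono n v hv))
  have hDr : ∀ n u, D (n + 1) u = -∫ v in Set.Ioi u, (jostKernel M ω u v : ℂ) * D n v := by
    intro n
    induction n with
    | zero =>
      intro u
      obtain ⟨B, hB⟩ := hbd u
      rw [hDs, hD0]
      simp only
      rw [jost_volterra hM hω hΦ hΨ h1 h2 hB]
      ring
    | succ n ih =>
      intro u
      obtain ⟨B, hB⟩ := hDb n u
      have hi1 := integrableOn_jostKernel_mul hM (hDm n) fun v hv => hB v (le_of_lt hv)
      have hi2 := integrableOn_jostKernel_mul (ω := ω) hM (stronglyMeasurable_jostIter hM ω n)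
        (B := 1 / n.factorial) (n := n) (u := u) fun v _ => norm_jostIter_le hM ω n v
      rw [hDs (n + 1)]
      simp only
      rw [ih, jostIter_succ, sub_neg_eq_add, neg_add_eq_sub, ← neg_sub, ← integral_sub hi1 hi2]
      simp only [hDs, mul_sub]
  obtain ⟨B, hB⟩ := hbd u
  have hlim : Tendsto (fun n => D n u) atTop (𝓝 0) := by
    have h3 := (FloorSemiring.tendsto_pow_div_factorial_atTop
      (M / schwarzschildRadius M u ^ 2 / |ω|)).const_mul B
    rw [mul_zero] at h3
    refine squeeze_zero_norm (fun n => ?_) h3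
    refine (norm_le_pow_div_factorial hM (f := D) (B := B) (u₁ := u) ?_ hDr n u le_rfl).trans_eq ?_
    · rw [hD0]; exact hB
    · ring
  have hsum := (summable_jostIter hM ω u).hasSum.tendsto_sum_nat
  have h4 : Tendsto (fun n => ∑ k ∈ Finset.range n, jostIter M ω k u) atTop (𝓝 (Φ u)) := by
    have := hlim.const_sub (Φ u)
    simpa [hD] using this
  exact tendsto_nhds_unique hsum h4

end Volterra

/-! ### The Jost solution on the real line in static coordinates. -/

section RealLine

open Complex

variable {M : ℝ}

/-- `log(1 - 2M / r)` as a function of the Regge-Wheeler coordinate. -/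
def horizonLog (M u : ℝ) : ℝ := Real.log (1 - 2 * M / schwarzschildRadius M u)

theorem one_sub_div_schwarzschildRadius_pos (hM : 0 < M) (u : ℝ) :
    0 < 1 - 2 * M / schwarzschildRadius M u := by
  have hr := two_mul_lt_schwarzschildRadius hM u
  have h0 : 0 < schwarzschildRadius M u := by linarith
  have : 2 * M / schwarzschildRadius M u < 1 := (div_lt_one h0).2 hr
  linarith

theorem hasDerivAt_horizonLog (hM : 0 < M) (u : ℝ) :
    HasDerivAt (horizonLog M) (2 * M / schwarzschildRadius M u ^ 2) u := by
  have h0 : schwarzschildRadius M u ≠ 0 := by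
    have := two_mul_lt_schwarzschildRadius hM u
    linarith
  have h1 := one_sub_div_schwarzschildRadius_pos hM u
  refine (((((hasDerivAt_schwarzschildRadius hM u).inv h0).const_mul (2 * M)).const_sub 1).log
    h1.ne').congr_deriv ?_
  have h2 := h1.ne'
  simp only [Pi.inv_apply, ← div_eq_mul_inv]
  field_simp
  exact div_self (by linarith [two_mul_lt_schwarzschildRadius hM u])

theorem continuous_horizonLog (hM : 0 < M) : Continuous (horizonLog M) :=
  continuous_iff_continuousAt.2 fun u => (hasDerivAt_horizonLog hM u).continuousAt

theorem hasDerivAt_ofReal_schwarzschildRadius (hM : 0 < M) (u : ℝ) :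
    HasDerivAt (fun u => (schwarzschildRadius M u : ℂ))
      ((1 - ((2 * M : ℝ) : ℂ) / schwarzschildRadius M u) * 1) u := by
  refine (hasDerivAt_schwarzschildRadius hM u).ofReal_comp.congr_deriv ?_
  push_cast
  ring

theorem hasDerivAt_ofReal_horizonLog (hM : 0 < M) (u : ℝ) :
    HasDerivAt (fun u => (horizonLog M u : ℂ))
      (((2 * M : ℝ) : ℂ) / (schwarzschildRadius M u : ℂ) ^ 2 * 1) u := by
  refine (hasDerivAt_horizonLog hM u).ofReal_comp.congr_deriv ?_
  push_cast
  ring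

/-- The coefficient matrix of the static coordinates on the real line. -/
def exteriorMat (M u : ℝ) : (ℂ × ℂ) →L[ℂ] (ℂ × ℂ) :=
  staticMat (2 * M : ℝ) (schwarzschildRadius M u) (horizonLog M u)

theorem ofReal_schwarzschildRadius_ne_zero (hM : 0 < M) (u : ℝ) :
    (schwarzschildRadius M u : ℂ) ≠ 0 := by
  have := two_mul_lt_schwarzschildRadius hM u
  have h2 : schwarzschildRadius M u ≠ 0 := by linarith
  exact_mod_cast h2

theorem continuous_exteriorMat (hM : 0 < M) : Continuous (exteriorMat M) := by
  have h1 := continuous_schwarzschildRadius hM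
  have h2 := continuous_horizonLog hM
  have h4 : Continuous fun u =>
      staticSol (2 * M : ℝ) (schwarzschildRadius M u) (horizonLog M u) := by
    unfold staticSol; fun_prop
  have h5 : Continuous fun u => (schwarzschildRadius M u : ℂ) := by fun_prop
  exact continuous_endOfEntries (h5.mul h4) (h4.pow 2) (h5.pow 2).neg (h5.mul h4).neg

/-- A solution with static coordinates `c`. -/
def staticPairing (M u : ℝ) : (ℂ × ℂ) →L[ℂ] ℂ :=
  (schwarzschildRadius M u : ℂ) • ContinuousLinearMap.fst ℂ ℂ ℂ +
    staticSol (2 * M : ℝ) (schwarzschildRadius M u) (horizonLog M u) •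
      ContinuousLinearMap.snd ℂ ℂ ℂ

/-- The derivative of a solution with static coordinates `c`. -/
def staticDerivPairing (M u : ℝ) : (ℂ × ℂ) →L[ℂ] ℂ :=
  (1 - ((2 * M : ℝ) : ℂ) / schwarzschildRadius M u) • ContinuousLinearMap.fst ℂ ℂ ℂ +
    staticSolDeriv (2 * M : ℝ) (schwarzschildRadius M u) (horizonLog M u) •
      ContinuousLinearMap.snd ℂ ℂ ℂ

/-- The pairing with `(r, s)` annihilates the range of the coefficient matrix, so only the static
solutions are differentiated. -/
theorem hasDerivAt_staticPairing (hM : 0 < M) {c : ℝ → ℂ × ℂ} {ε : ℂ} {u : ℝ}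
    (hc : HasDerivAt c (ε • exteriorMat M u (c u)) u) :
    HasDerivAt (fun u => staticPairing M u (c u)) (staticDerivPairing M u (c u)) u := by
  have ha : ((2 * M : ℝ) : ℂ) ≠ 0 := by
    have : 2 * M ≠ 0 := by positivity
    exact_mod_cast this
  have hr := hasDerivAt_ofReal_schwarzschildRadius hM u
  have hs := hasDerivAt_staticSol (r := fun u => (schwarzschildRadius M u : ℂ)) (L := fun u => (horizonLog M u : ℂ)) ha
    (ofReal_schwarzschildRadius_ne_zero hM u) hr (hasDerivAt_ofReal_horizonLog hM u)
  have h1 : HasDerivAt (fun u => (c u).1) (ε • exteriorMat M u (c u)).1 u :=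
    (ContinuousLinearMap.fst ℝ ℂ ℂ).hasFDerivAt.comp_hasDerivAt u hc
  have h2 : HasDerivAt (fun u => (c u).2) (ε • exteriorMat M u (c u)).2 u :=
    (ContinuousLinearMap.snd ℝ ℂ ℂ).hasFDerivAt.comp_hasDerivAt u hc
  have h := (hr.mul h1).add (hs.mul h2)
  refine (h.congr_deriv ?_).congr_of_eventuallyEq (Eventually.of_forall fun u => ?_)
  · simp [staticDerivPairing, exteriorMat, staticMat]
    ring
  · simp [staticPairing]

/-- The static solutions contribute `V φ`; the matrix paired with `(r', s')` gives the Wronskian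
times `φ`, hence `ε φ`. -/
theorem hasDerivAt_staticDerivPairing (hM : 0 < M) {c : ℝ → ℂ × ℂ} {ε : ℂ} {u : ℝ}
    (hc : HasDerivAt c (ε • exteriorMat M u (c u)) u) :
    HasDerivAt (fun u => staticDerivPairing M u (c u))
      ((potential M 0 u + ε) * staticPairing M u (c u)) u := by
  have ha : ((2 * M : ℝ) : ℂ) ≠ 0 := by
    have : 2 * M ≠ 0 := by positivity
    exact_mod_cast this
  have hr0 := ofReal_schwarzschildRadius_ne_zero hM u
  have hr := hasDerivAt_ofReal_schwarzschildRadius hM u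
  have hf := hasDerivAt_one_sub_div (r := fun u => (schwarzschildRadius M u : ℂ)) hr0 hr
  have hs := hasDerivAt_staticSolDeriv (r := fun u => (schwarzschildRadius M u : ℂ)) (L := fun u => (horizonLog M u : ℂ)) ha
    hr0 hr (hasDerivAt_ofReal_horizonLog hM u)
  have h1 : HasDerivAt (fun u => (c u).1) (ε • exteriorMat M u (c u)).1 u :=
    (ContinuousLinearMap.fst ℝ ℂ ℂ).hasFDerivAt.comp_hasDerivAt u hc
  have h2 : HasDerivAt (fun u => (c u).2) (ε • exteriorMat M u (c u)).2 u :=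
    (ContinuousLinearMap.snd ℝ ℂ ℂ).hasFDerivAt.comp_hasDerivAt u hc
  have h := (hf.mul h1).add (hs.mul h2)
  have hV : (potential M 0 u : ℂ) = (1 - ((2 * M : ℝ) : ℂ) / schwarzschildRadius M u) *
      ((2 * M : ℝ) : ℂ) / (schwarzschildRadius M u : ℂ) ^ 3 := by
    rw [potential_zero]; push_cast; ring
  refine (h.congr_deriv ?_).congr_of_eventuallyEq (Eventually.of_forall fun u => ?_)
  · rw [hV]
    simp only [staticPairing, exteriorMat, staticMat, staticSol, staticSolDeriv,
      endOfEntries_apply]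
    clear hV h hs hf hr h1 h2 hc
    simp [-ofReal_mul]
    generalize ((2 * M : ℝ) : ℂ) = a at ha ⊢
    field_simp
    ring
  · simp [staticDerivPairing]

/-- The Jost solution and its derivative in static coordinates. -/
theorem exists_jost_representation (hM : 0 < M) :
    ∃ (P Q : ℝ → ℂ → (ℂ × ℂ) →L[ℂ] ℂ) (v : ℂ → ℂ × ℂ),
      (∀ u, Differentiable ℂ (P u)) ∧ (∀ u, Differentiable ℂ (Q u)) ∧ Differentiable ℂ v ∧
      (∃ (G : ℂ → (ℂ × ℂ) →L[ℂ] (ℂ × ℂ)) (w : ℂ → ℂ × ℂ) (δ : ℝ), 0 < δ ∧ AnalyticAt ℂ G 0 ∧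
        G 0 = 0 ∧ HasDerivAt G ((M : ℂ) • 1) 0 ∧ AnalyticAt ℂ w 0 ∧
        ∀ ζ, ‖exp ζ‖ < δ → v ζ = NormedSpace.exp (ζ • G (exp ζ)) (w (exp ζ))) ∧
      ∀ ω : ℝ, ω ≠ 0 → ∀ u, jost M ω u = P u (-ω ^ 2) (v (log (2 * I * ω))) ∧
        HasDerivAt (jost M ω) (Q u (-ω ^ 2) (v (log (2 * I * ω)))) u := by
  have ha : 0 < 2 * M := by positivity
  have ha' : ((2 * M : ℝ) : ℂ) ≠ 0 := by exact_mod_cast ha.ne'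
  obtain ⟨v, hvd, hvc, G, w, δ, hδ, hGa, hG0, hG1, hwa, hvw⟩ := exists_jost_coord ha
  obtain ⟨X, Y, hX0, hY0, -, hX, hY, hXε, -, hYX, hXY, -⟩ :=
    exists_propagator (A := fun t => exteriorMat M (t + reggeWheeler M (4 * (2 * M))))
      ((continuous_exteriorMat hM).comp (by fun_prop))
  -- The base point `r = 4a`, which is the point `θ = 0` of the circle.
  set u₀ := reggeWheeler M (4 * (2 * M)) with hu₀
  have hr₀ : schwarzschildRadius M u₀ = 4 * (2 * M) :=
    schwarzschildRadius_reggeWheeler hM (by linarith)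
  refine ⟨fun u ε => staticPairing M u ∘L X (u - u₀) ε,
    fun u ε => staticDerivPairing M u ∘L X (u - u₀) ε, v,
    fun u => (differentiable_const _).clm_comp (hXε _),
    fun u => (differentiable_const _).clm_comp (hXε _), hvd,
    ⟨G, w, δ, hδ, hGa, hG0, ?_, hwa, hvw⟩, fun ω hω => ?_⟩
  · convert hG1 using 2
    push_cast
    ring
  have hω' : (ω : ℂ) ≠ 0 := by exact_mod_cast hω
  set z : ℂ := 2 * I * ω with hz
  have hz0 : z ≠ 0 := by simp [hz, hω']
  have hε : z ^ 2 / 4 = -ω ^ 2 := by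
    rw [hz]; linear_combination (ω : ℂ) ^ 2 * I_sq
  -- `z = 2iω` is purely imaginary, so `|arg z| = π/2 < 3π/4`.
  have him : |(log z).im| < 3 * Real.pi / 4 := by
    have h1 : |(log z).im| ≤ Real.pi / 2 := by
      rw [log_im, abs_arg_le_pi_div_two_iff]
      simp [hz]
    linarith [Real.pi_pos]
  have hzW : z ∈ wideSector := by
    have := exp_mem_wideSector him
    rwa [exp_log hz0] at this
  have hv0 := jost_coord_eq ha hvd hvc him
  rw [exp_log hz0] at hv0
  -- the solution built from the static coordinates
  set c : ℝ → ℂ × ℂ := fun u => X (u - u₀) (-ω ^ 2) (v (log z)) with hc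
  have hcd : ∀ u, HasDerivAt c (((-ω ^ 2 : ℂ)) • exteriorMat M u (c u)) u := by
    intro u
    have h1 := (hX (u - u₀) (-ω ^ 2)).comp_sub_const u u₀
    refine (h1.clm_apply_real (hasDerivAt_const u (v (log z)))).congr_deriv ?_
    rw [map_zero, add_zero]
    simp [hc]
  set Φ : ℝ → ℂ := fun u => staticPairing M u (c u) with hΦ
  set Ψ : ℝ → ℂ := fun u => staticDerivPairing M u (c u) with hΨ
  have hΦd : ∀ u, HasDerivAt Φ (Ψ u) u := fun u => hasDerivAt_staticPairing hM (hcd u)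
  have hΨd : ∀ u, HasDerivAt Ψ ((potential M 0 u - ω ^ 2) * Φ u) u := fun u =>
    (hasDerivAt_staticDerivPairing hM (hcd u)).congr_deriv (by simp only [hΦ]; ring)
  -- the representation for large radius
  set m : ℝ → ℂ := fun u => 1 + borelLaplace 0 (2 * M : ℝ) z (schwarzschildRadius M u) with hm
  set m₁ : ℝ → ℂ := fun u => -borelLaplace 1 (2 * M : ℝ) z (schwarzschildRadius M u) with hm₁
  set b : ℝ → ℂ × ℂ := fun u => staticCoord (2 * M : ℝ) z (schwarzschildRadius M u)
    (horizonLog M u) u (m u) (m₁ u) with hb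
  have hbd : ∀ u, u₀ ≤ u → HasDerivAt b ((-ω ^ 2 : ℂ) • exteriorMat M u (b u)) u := by
    intro u hu
    have hr : 4 * (2 * M) ≤ schwarzschildRadius M u := hr₀ ▸ monotone_schwarzschildRadius hM hu
    have hx : 2 * ‖((2 * M : ℝ) : ℂ)‖ < (schwarzschildRadius M u : ℂ).re := by
      rw [norm_real, Real.norm_of_nonneg ha.le, ofReal_re]
      linarith
    have hI : ∀ j, HasDerivAt (fun u => borelLaplace j (2 * M : ℝ) z (schwarzschildRadius M u))
        (-borelLaplace (j + 1) (2 * M : ℝ) z (schwarzschildRadius M u) *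
          ((1 - ((2 * M : ℝ) : ℂ) / schwarzschildRadius M u) * 1)) u := fun j =>
      HasDerivAt.comp (h₂ := borelLaplace j (2 * M : ℝ) z)
        (h := fun u => (schwarzschildRadius M u : ℂ)) u
        (hasDerivAt_borelLaplace hzW hx j) (hasDerivAt_ofReal_schwarzschildRadius hM u)
    have hu1 : HasDerivAt (fun u : ℝ => (u : ℂ)) 1 u := ofRealCLM.hasDerivAt
    have hm₁d : HasDerivAt m₁ (borelLaplace 2 (2 * M : ℝ) z (schwarzschildRadius M u) *
        ((1 - ((2 * M : ℝ) : ℂ) / schwarzschildRadius M u) * 1)) u :=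
      (hI 1).neg.congr_deriv (by ring)
    have hmd : HasDerivAt m (m₁ u * ((1 - ((2 * M : ℝ) : ℂ) / schwarzschildRadius M u) * 1)) u :=
      (hI 0).const_add 1
    have := hasDerivAt_staticCoord (z := z) (r := fun u => (schwarzschildRadius M u : ℂ))
      (L := fun u => (horizonLog M u : ℂ)) (u := fun u => (u : ℂ)) (m := m) (m₁ := m₁)
      (m₂ := borelLaplace 2 (2 * M : ℝ) z (schwarzschildRadius M u)) ha'
      (ofReal_schwarzschildRadius_ne_zero hM u) (hasDerivAt_ofReal_schwarzschildRadius hM u)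
      (hasDerivAt_ofReal_horizonLog hM u) hu1 hmd hm₁d (by
        rw [← borelLaplace_ode hzW hx]
        ring)
    rw [hε] at this
    refine this.congr_deriv ?_
    rw [one_smul]
    rfl
  -- Both curves solve the same linear equation and agree at `u₀`. The comparison is made only for
  -- `u ≥ u₀`, where the Laplace integral converges; `c` itself is global.
  have hcb : ∀ u, u₀ ≤ u → c u = b u := by
    intro u hu
    have hd : ∀ s, u₀ ≤ s → HasDerivAt (fun s => Y (s - u₀) (-ω ^ 2) (b s)) 0 s := by
      intro s hs
      have h1 := (hY (s - u₀) (-ω ^ 2)).comp_sub_const s u₀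
      refine (h1.clm_apply_real (hbd s hs)).congr_deriv ?_
      rw [map_smul, neg_apply, sub_add_cancel]
      exact neg_add_cancel _
    have h1 := constant_of_has_deriv_right_zero (a := u₀) (b := u)
      (fun s hs => (hd s hs.1).continuousAt.continuousWithinAt)
      (fun s hs => (hd s hs.1).hasDerivWithinAt) u ⟨hu, le_rfl⟩
    have hb0 : b u₀ = v (log z) := by
      rw [hv0]
      simp only [hb, hm, hm₁, hr₀]
      have e1 : ((4 * (2 * M) : ℝ) : ℂ) = 4 * ((2 * M : ℝ) : ℂ) := by push_cast; ring
      have e2 : (horizonLog M u₀ : ℂ) = circleL 0 := by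
        rw [horizonLog, hr₀, circleL, ofReal_log (by
          have : 2 * M / (4 * (2 * M)) = 1 / 4 := by field_simp
          rw [this]; norm_num)]
        congr 1
        have : M ≠ 0 := hM.ne'
        have : (M : ℂ) ≠ 0 := by exact_mod_cast this
        push_cast
        simp
        field_simp
      have e3 : (u₀ : ℂ) = circleU (2 * M) 0 := by
        have h3 : circleL 0 = ((Real.log (3 / 4) : ℝ) : ℂ) := by
          rw [circleL, ofReal_log (by norm_num)]
          congr 1
          push_cast
          simp
          norm_num
        rw [circleU, circleR_zero, h3, hu₀, reggeWheeler]
        have h4 : 4 * (2 * M) / (2 * M) - 1 = 3 := by field_simp; norm_num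
        rw [h4, Real.log_div (by norm_num) (by norm_num)]
        push_cast
        ring
      rw [e1, e2, e3]
    simp only [sub_self, hY0] at h1
    have h2 : X (u - u₀) (-ω ^ 2) (Y (u - u₀) (-ω ^ 2) (b u)) = b u :=
      DFunLike.congr_fun (hXY (u - u₀) (-ω ^ 2)) (b u)
    rw [← h2, h1, hc]
    simp only
    rw [show (1 : (ℂ × ℂ) →L[ℂ] (ℂ × ℂ)) (b u₀) = b u₀ from rfl, hb0]
  have hexp : ∀ u : ℝ, exp (I * ω * u) * exp (-(z / 2 * u)) = 1 := by
    intro u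
    rw [← exp_add, hz, ← exp_zero]
    congr 1
    ring
  have hΦb : ∀ u, u₀ ≤ u → exp (I * ω * u) * Φ u = m u := by
    intro u hu
    have h1 := static_fst ha' (ofReal_schwarzschildRadius_ne_zero hM u) (horizonLog M u) z u (m u)
      (m₁ u)
    have h2 : Φ u = exp (-(z / 2 * u)) * m u := by
      rw [← h1]; simp only [hΦ, hcb u hu, hb]; simp [staticPairing]
    rw [h2, ← mul_assoc, hexp, one_mul]
  have hΨb : ∀ u, u₀ ≤ u → exp (I * ω * u) * Ψ u =
      (1 - ((2 * M : ℝ) : ℂ) / schwarzschildRadius M u) * m₁ u - z / 2 * m u := by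
    intro u hu
    have h1 := static_snd ha' (ofReal_schwarzschildRadius_ne_zero hM u) (horizonLog M u) z u (m u)
      (m₁ u)
    have h2 : Ψ u = exp (-(z / 2 * u)) *
        ((1 - ((2 * M : ℝ) : ℂ) / schwarzschildRadius M u) * m₁ u - z / 2 * m u) := by
      rw [← h1]; simp only [hΨ, hcb u hu, hb]; simp [staticDerivPairing]
    rw [h2, ← mul_assoc, hexp, one_mul]
  have hrl := tendsto_schwarzschildRadius hM
  have hIl : ∀ j, Tendsto (fun u => borelLaplace j (2 * M : ℝ) z (schwarzschildRadius M u)) atTop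
      (𝓝 0) := by
    intro j
    have h1 : Tendsto (fun u => (2 * M) * (j.factorial /
        (schwarzschildRadius M u - 2 * (2 * M)) ^ (j + 1))) atTop (𝓝 0) := by
      have h2 := (tendsto_pow_atTop (Nat.succ_ne_zero j)).comp
        (tendsto_atTop_add_const_right atTop (-(2 * (2 * M))) hrl)
      simpa [sub_eq_add_neg] using (h2.const_div_atTop (j.factorial : ℝ)).const_mul (2 * M)
    refine squeeze_zero_norm' ?_ h1
    filter_upwards [hrl.eventually_gt_atTop (2 * (2 * M))] with u hu
    have h3 := norm_borelLaplace_le hzW (α := (2 * M : ℝ)) (x := schwarzschildRadius M u)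
      (δ := schwarzschildRadius M u - 2 * (2 * M)) (by linarith) (by
        rw [norm_real, Real.norm_of_nonneg ha.le, ofReal_re]
        linarith) j
    rwa [norm_real, Real.norm_of_nonneg ha.le] at h3
  have hml : Tendsto m atTop (𝓝 1) := by simpa only [add_zero] using (hIl 0).const_add 1
  have hm₁l : Tendsto m₁ atTop (𝓝 0) := by simpa only [neg_zero] using (hIl 1).neg
  have hfl : Tendsto (fun u => 1 - ((2 * M : ℝ) : ℂ) / schwarzschildRadius M u) atTop (𝓝 1) := by
    have h1 : Tendsto (fun u => 1 - 2 * M / schwarzschildRadius M u) atTop (𝓝 (1 - 0)) :=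
      (hrl.const_div_atTop _).const_sub 1
    have h2 := (continuous_ofReal.tendsto _).comp h1
    simpa [Function.comp_def] using h2
  have h1 : Tendsto (fun u : ℝ => exp (I * ω * u) * Φ u) atTop (𝓝 1) := by
    refine hml.congr' ?_
    filter_upwards [eventually_ge_atTop u₀] with u hu using (hΦb u hu).symm
  have h2 : Tendsto (fun u : ℝ => exp (I * ω * u) * Ψ u) atTop (𝓝 (-(I * ω))) := by
    have h3 := (hfl.mul hm₁l).sub (hml.const_mul (z / 2))
    rw [show (1 : ℂ) * 0 - z / 2 * 1 = -(I * ω) by rw [hz]; ring] at h3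
    refine h3.congr' ?_
    filter_upwards [eventually_ge_atTop u₀] with u hu using (hΨb u hu).symm
  have hj := jost_eq_of_tendsto hM hω hΦd hΨd h1 h2
  intro u
  rw [hj]
  exact ⟨rfl, hΦd u⟩

end RealLine

/-! ### Distributing a logarithmic expansion among `C⁴` coefficients. -/

section LogExpansion

open Complex

theorem tendsto_norm_doubleSector :
    Tendsto (fun ω : ℂ => ‖ω‖) (𝓝[doubleSector] 0) (𝓝[>] 0) := by
  refine tendsto_nhdsWithin_of_tendsto_nhds_of_eventually_within _ ?_ ?_
  · exact (continuous_norm.tendsto' 0 0 norm_zero).mono_left nhdsWithin_le_nhds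
  · filter_upwards [self_mem_nhdsWithin] with ω hω
    refine norm_pos_iff.2 fun h => ?_
    simp [h, doubleSector] at hω

theorem two_I_mul_mem_slitPlane {ω : ℂ} (hω : ω ∈ doubleSector) : 2 * I * ω ∈ slitPlane := by
  right
  have h : |ω.im| < |ω.re| := hω
  have h2 : ω.re ≠ 0 := by
    intro h0
    rw [h0, abs_zero] at h
    exact absurd h (abs_nonneg _).not_gt
  simpa using h2

theorem norm_rpow_isBigO {s t : ℝ} (h : s ≤ t) :
    (fun ω : ℂ => ‖ω‖ ^ t) =O[𝓝[doubleSector] 0] fun ω => ‖ω‖ ^ s := by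
  refine IsBigO.of_bound 1 ?_
  filter_upwards [tendsto_norm_doubleSector.eventually (Ioo_mem_nhdsGT one_pos)] with ω hω
  rw [Real.norm_of_nonneg (by positivity), Real.norm_of_nonneg (by positivity), one_mul]
  exact Real.rpow_le_rpow_of_exponent_ge hω.1 hω.2.le h

/-- The exponent `1/10` is a budget: five logarithms cost half a power, so terms of order five
remain `O(|ω|^{9/2})`, enough for four derivatives. -/
theorem log_isBigO_doubleSector :
    (fun ω : ℂ => log (2 * I * ω)) =O[𝓝[doubleSector] 0] fun ω => ‖ω‖ ^ (-(1 / 10) : ℝ) := by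
  have h0 : (fun ω : ℂ => Real.log ‖ω‖) =O[𝓝[doubleSector] 0] fun ω => ‖ω‖ ^ (-(1 / 10) : ℝ) :=
    ((isLittleO_log_rpow_nhdsGT_zero (by norm_num)).comp_tendsto tendsto_norm_doubleSector).isBigO
  have h1 : ∀ c : ℝ, (fun _ : ℂ => c) =O[𝓝[doubleSector] 0] fun ω => ‖ω‖ ^ (-(1 / 10) : ℝ) := by
    intro c
    have h2 := (norm_rpow_isBigO (s := -(1 / 10)) (t := 0) (by norm_num))
    simp only [Real.rpow_zero] at h2
    exact (isBigO_const_const c one_ne_zero _).trans h2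
  refine IsBigO.trans ?_ ((h0.norm_left.add (h1 (Real.log 2 + Real.pi))))
  refine IsBigO.of_bound 1 ?_
  filter_upwards [self_mem_nhdsWithin,
    tendsto_norm_doubleSector.eventually (Ioo_mem_nhdsGT one_pos)] with ω hω h2
  have h3 : Real.log ‖2 * I * ω‖ = Real.log 2 + Real.log ‖ω‖ := by
    rw [norm_mul, norm_mul, norm_I, mul_one, Real.log_mul (by simp) h2.1.ne']
    simp
  have h4 : ‖log (2 * I * ω)‖ ≤ |Real.log ‖2 * I * ω‖| + |arg (2 * I * ω)| := by
    rw [← log_re, ← log_im]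
    exact norm_le_abs_re_add_abs_im _
  have h5 := abs_arg_le_pi (2 * I * ω)
  have h6 := abs_add_le (Real.log 2) (Real.log ‖ω‖)
  have h7 : 0 ≤ Real.log 2 := Real.log_nonneg (by norm_num)
  rw [h3] at h4
  rw [abs_of_nonneg h7] at h6
  rw [one_mul, Real.norm_eq_abs (‖Real.log ‖ω‖‖ + _), abs_of_nonneg (by positivity), Real.norm_eq_abs]
  linarith

/-- `(2iω)^m log^j(2iω)` with few logarithms is small. -/
theorem pow_mul_log_pow_isBigO {m j : ℕ} {s : ℝ} (hs : s ≤ m - j / 10) :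
    (fun ω : ℂ => (2 * I * ω) ^ m * log (2 * I * ω) ^ j) =O[𝓝[doubleSector] 0]
      fun ω => ‖ω‖ ^ s := by
  have h1 : (fun ω : ℂ => (2 * I * ω) ^ m) =O[𝓝[doubleSector] 0] fun ω => ‖ω‖ ^ m := by
    have : (fun ω : ℂ => 2 * I * ω) =O[𝓝[doubleSector] 0] fun ω => ‖ω‖ :=
      ((isBigO_refl (fun ω : ℂ => ω) _).const_mul_left _).norm_right
    exact this.pow m
  refine (h1.mul (log_isBigO_doubleSector.pow j)).trans (IsBigO.trans ?_ (norm_rpow_isBigO hs))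
  refine IsBigO.of_bound 1 ?_
  filter_upwards [tendsto_norm_doubleSector.eventually (Ioo_mem_nhdsGT one_pos)] with ω h2
  rw [one_mul, ← Real.rpow_natCast, ← Real.rpow_natCast, ← Real.rpow_mul h2.1.le,
    ← Real.rpow_add h2.1]
  refine le_of_eq ?_
  congr 2
  ring

theorem conj_mem_doubleSector {ω : ℂ} (h : ω ∈ doubleSector) :
    starRingEnd ℂ ω ∈ doubleSector := by
  simpa [doubleSector] using h

theorem tendsto_conj_doubleSector :
    Tendsto (starRingEnd ℂ) (𝓝[doubleSector] 0) (𝓝[doubleSector] 0) := by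
  refine tendsto_nhdsWithin_of_tendsto_nhds_of_eventually_within _ ?_ ?_
  · exact (continuous_conj.tendsto' 0 0 (map_zero _)).mono_left nhdsWithin_le_nhds
  · filter_upwards [self_mem_nhdsWithin] with ω hω using conj_mem_doubleSector hω

/-- The holomorphic function that agrees on the real line with `G` if `j` is even and with the
conjugate of `G` if `j` is odd. -/
def schwarzReflect (j : ℕ) (G : ℂ → ℂ) (ω : ℂ) : ℂ :=
  if Even j then G ω else starRingEnd ℂ (G (starRingEnd ℂ ω))

theorem schwarzReflect_sub (j : ℕ) (G H : ℂ → ℂ) (ω : ℂ) :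
    schwarzReflect j (fun ω => G ω - H ω) ω = schwarzReflect j G ω - schwarzReflect j H ω := by
  unfold schwarzReflect
  split_ifs <;> simp

/-- Reflecting in argument and value preserves holomorphy, which plain conjugation would destroy;
Cauchy estimates stay available. -/
theorem differentiableOn_schwarzReflect (j : ℕ) {G : ℂ → ℂ}
    (hG : DifferentiableOn ℂ G doubleSector) :
    DifferentiableOn ℂ (schwarzReflect j G) doubleSector := by
  intro ω hω
  refine DifferentiableAt.differentiableWithinAt ?_
  unfold schwarzReflect
  split_ifs
  · exact hG.differentiableAt (isOpen_doubleSector.mem_nhds hω)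
  · have h1 : DifferentiableAt ℂ G (starRingEnd ℂ ω) :=
      hG.differentiableAt (isOpen_doubleSector.mem_nhds (conj_mem_doubleSector hω))
    have h2 := h1.conj_conj
    rw [conj_conj] at h2
    exact h2

theorem schwarzReflect_isBigO (j : ℕ) {G : ℂ → ℂ} {s : ℝ}
    (hG : G =O[𝓝[doubleSector] 0] fun ω => ‖ω‖ ^ s) :
    schwarzReflect j G =O[𝓝[doubleSector] 0] fun ω => ‖ω‖ ^ s := by
  unfold schwarzReflect
  split_ifs
  · exact hG
  · have h1 := hG.comp_tendsto tendsto_conj_doubleSector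
    refine IsBigO.trans (IsBigO.of_bound 1 (Eventually.of_forall fun ω => ?_))
      (h1.congr_right (g₂ := fun ω => ‖ω‖ ^ s) fun ω => ?_)
    · simp
    · simp

/-- Given an expansion of `F` into terms `(2iω)^(j+k) log^j(2iω)` whose leading coefficients are
fixed real multiples of a real number, the coefficients of highest logarithmic order can be chosen
as these multiples of the regular part or of its conjugate, up to any power of `ω`. -/
theorem exists_log_expansion {F : ℂ → ℂ} (hF : DifferentiableOn ℂ F doubleSector)
    {h : ℕ → ℕ → ℂ} {c : ℕ → ℝ}
    (hexp : (fun ω => F ω - ∑ j ∈ Finset.range 5, ∑ k ∈ Finset.range (5 - j),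
      h j k * ((2 * I * ω) ^ (j + k) * log (2 * I * ω) ^ j)) =O[𝓝[doubleSector] 0]
        fun ω => ‖ω‖ ^ (9 / 2 : ℝ))
    (hc : ∀ j, h j 0 = c j * h 0 0) (hreal : starRingEnd ℂ (h 0 0) = h 0 0) (κ : ℤ) :
    ∃ (G : ℝ → ℂ) (g : ℕ → ℕ → ℝ → ℂ), ContDiff ℝ 4 G ∧ (∀ i j, ContDiff ℝ 4 (g i j)) ∧
      (∀ ω : ℝ, ω ≠ 0 → F ω = G ω + ∑ i ∈ Finset.Icc 1 4, ∑ j ∈ Finset.Icc 1 i,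
        (2 * I * ω) ^ i * log (2 * I * ω) ^ j * g i j ω) ∧
      (∀ i, Even i → (fun ω : ℝ => g i i ω - c i * G ω) =o[𝓝[≠] 0] fun ω : ℝ => ω ^ κ) ∧
      ∀ i, Odd i →
        (fun ω : ℝ => g i i ω - c i * starRingEnd ℂ (G ω)) =o[𝓝[≠] 0] fun ω : ℝ => ω ^ κ := by
  set T : ℂ → ℂ := fun ω => ∑ k ∈ Finset.range 5, h 0 k * (2 * I * ω) ^ k with hT
  -- Taylor coefficients of the reflection of `T`; the sign `(-1)^k` comes from `conj(2i) = -2i`.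
  set τ : ℕ → ℕ → ℂ := fun j k => if Even j then h 0 k else starRingEnd ℂ (h 0 k) * (-1) ^ k with hτ
  -- For `j < i`: the coefficient demanded by the expansion minus what the top term `c_j z^j log^j
  -- z` times the reflected `T` already supplies.
  set low : ℕ → ℕ → ℂ := fun i j => h j (i - j) - c j * τ j (i - j) with hlow
  set Low : ℂ → ℂ := fun ω => ∑ i ∈ Finset.Icc 1 4, ∑ j ∈ Finset.Ico 1 i,
    (2 * I * ω) ^ i * log (2 * I * ω) ^ j * low i j with hLow
  -- A fixed point would be a regular part satisfying the required relation exactly.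
  set step : (ℂ → ℂ) → ℂ → ℂ := fun G ω => F ω - Low ω - ∑ j ∈ Finset.Icc 1 4,
    (2 * I * ω) ^ j * log (2 * I * ω) ^ j * (c j * schwarzReflect j G ω) with hstep
  have hTd : Differentiable ℂ T := by simp only [hT]; fun_prop
  have hlogd : DifferentiableOn ℂ (fun ω => log (2 * I * ω)) doubleSector := fun ω hω =>
    (DifferentiableAt.clog (by fun_prop) (two_I_mul_mem_slitPlane hω)).differentiableWithinAt
  have hstepd : ∀ G, DifferentiableOn ℂ G doubleSector →
      DifferentiableOn ℂ (step G) doubleSector := by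
    intro G hG
    have h1 := fun j => differentiableOn_schwarzReflect j hG
    refine (hF.sub ?_).sub ?_
    · simp only [hLow]
      fun_prop
    · fun_prop
  -- Every term contains `(z log z)^j` with `j ≥ 1`, so at least half a power of `|ω|` is gained.
  have hsum : ∀ {G : ℂ → ℂ} {s : ℝ}, G =O[𝓝[doubleSector] 0] (fun ω => ‖ω‖ ^ s) →
      (fun ω => ∑ j ∈ Finset.Icc 1 4, (2 * I * ω) ^ j * log (2 * I * ω) ^ j *
        (c j * schwarzReflect j G ω)) =O[𝓝[doubleSector] 0] fun ω => ‖ω‖ ^ (s + 1 / 2) := by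
    intro G s hG
    refine IsBigO.fun_sum fun j hj => ?_
    obtain ⟨hj1, hj4⟩ := Finset.mem_Icc.1 hj
    have hj1' : (1 : ℝ) ≤ j := by exact_mod_cast hj1
    refine ((pow_mul_log_pow_isBigO (s := 1 / 2) (by linarith)).mul
      ((schwarzReflect_isBigO j hG).const_mul_left (c j : ℂ))).congr' EventuallyEq.rfl ?_
    filter_upwards [tendsto_norm_doubleSector.eventually (Ioo_mem_nhdsGT one_pos)] with ω h2
    rw [← Real.rpow_add h2.1, add_comm]
  have hstepsub : ∀ G H ω, step G ω - step H ω = -∑ j ∈ Finset.Icc 1 4,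
      (2 * I * ω) ^ j * log (2 * I * ω) ^ j *
        (c j * schwarzReflect j (fun ω => G ω - H ω) ω) := by
    intro G H ω
    simp only [hstep, schwarzReflect_sub, mul_sub, Finset.sum_sub_distrib]
    ring
  have hTreflect : ∀ j ω, schwarzReflect j T ω = ∑ k ∈ Finset.range 5, τ j k * (2 * I * ω) ^ k := by
    intro j ω
    simp only [schwarzReflect, hT, hτ]
    split_ifs
    · rfl
    · rw [map_sum]
      refine Finset.sum_congr rfl fun k _ => ?_
      simp only [map_mul, map_pow, conj_conj, conj_I, map_ofNat]
      rw [show 2 * -I * ω = -1 * (2 * I * ω) by ring, mul_pow]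
      ring
  have hstepT : (fun ω => step T ω - T ω) =O[𝓝[doubleSector] 0]
      fun ω => ‖ω‖ ^ (9 / 2 : ℝ) := by
    -- Products of the top terms with Taylor terms of total order at least five; at most four
    -- logarithms leave the exponent above `9/2`.
    have hrem : (fun ω : ℂ => ∑ j ∈ Finset.Icc 1 4, ∑ k ∈ Finset.Ico (5 - j) 5,
        (c j * τ j k) * ((2 * I * ω) ^ (j + k) * log (2 * I * ω) ^ j)) =O[𝓝[doubleSector] 0]
          fun ω => ‖ω‖ ^ (9 / 2 : ℝ) := by
      refine IsBigO.fun_sum fun j hj => IsBigO.fun_sum fun k hk => ?_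
      obtain ⟨hj1, hj4⟩ := Finset.mem_Icc.1 hj
      obtain ⟨hk1, hk2⟩ := Finset.mem_Ico.1 hk
      have h5 : (5 : ℝ) ≤ (j + k : ℕ) := by exact_mod_cast (by omega : 5 ≤ j + k)
      have h6 : (j : ℝ) ≤ 4 := by exact_mod_cast hj4
      exact (pow_mul_log_pow_isBigO (by linarith)).const_mul_left _
    refine (hexp.sub hrem).congr_left fun ω => ?_
    -- Reality of `h 0 0` makes the top coefficients match for odd `j` as well.
    have hτ0 : ∀ j, τ j 0 = h 0 0 := by
      intro j
      simp only [hτ]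
      split_ifs
      · rfl
      · simp [hreal]
    simp only [hstep, hTreflect]
    simp only [hT, hLow, hlow]
    have e1 := hc 1
    have e2 := hc 2
    have e3 := hc 3
    have e4 := hc 4
    have t1 := hτ0 1
    have t2 := hτ0 2
    have t3 := hτ0 3
    have t4 := hτ0 4
    simp [Finset.sum_range_succ, Finset.sum_Icc_succ_top, Finset.sum_Ico_succ_top, e1, e2, e3, e4,
      hτ0]
    ring
  set Gs : ℕ → ℂ → ℂ := fun n => step^[n] T with hGs
  have hGsucc : ∀ n, Gs (n + 1) = step (Gs n) := fun n => Function.iterate_succ_apply' step n T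
  have hGd : ∀ n, DifferentiableOn ℂ (Gs n) doubleSector := by
    intro n
    induction n with
    | zero => exact hTd.differentiableOn
    | succ n ih => rw [hGsucc]; exact hstepd _ ih
  have hGinc : ∀ n : ℕ, (fun ω => Gs (n + 1) ω - Gs n ω) =O[𝓝[doubleSector] 0]
      fun ω => ‖ω‖ ^ (9 / 2 + n / 2 : ℝ) := by
    intro n
    induction n with
    | zero => simpa [hGs] using hstepT
    | succ n ih =>
      rw [hGsucc (n + 1), hGsucc n]
      rw [hGsucc n] at ih
      simp only [hstepsub]
      refine ((hsum ih).neg_left).congr_right fun ω => ?_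
      congr 1
      push_cast
      ring
  have hGT : ∀ n : ℕ, (fun ω => Gs n ω - T ω) =O[𝓝[doubleSector] 0]
      fun ω => ‖ω‖ ^ (9 / 2 : ℝ) := by
    intro n
    induction n with
    | zero => simpa [hGs] using isBigO_zero _ _
    | succ n ih =>
      have h1 := (hGinc n).trans (norm_rpow_isBigO (s := 9 / 2) (by
        have : (0 : ℝ) ≤ n := n.cast_nonneg
        linarith))
      exact (h1.add ih).congr_left fun ω => by ring
  -- The difference from `T` vanishes to order `9/2` at `0`, so extending it by zero is `C⁴`; the
  -- polynomial `T` is smooth.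
  set Gr : ℕ → ℝ → ℂ := fun n ω => (if ω = 0 then 0 else Gs n ω - T ω) + T ω with hGr
  have hGr_eq : ∀ n ω, ω ≠ 0 → Gr n ω = Gs n ω := by
    intro n ω hω
    simp [hGr, hω]
  have hGrC : ∀ n, ContDiff ℝ 4 (Gr n) := by
    intro n
    refine ContDiff.add ?_ ?_
    · exact contDiff_of_isBigO_doubleSector (F := fun ω => Gs n ω - T ω) (n := 4)
        ((hGd n).sub hTd.differentiableOn) (by norm_num) (hGT n)
    · have : ContDiff ℝ 4 (fun ω : ℝ => (ω : ℂ)) := ofRealCLM.contDiff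
      simp only [hT]
      fun_prop
  -- This makes `9/2 + n/2 > κ`.
  obtain ⟨n, hn⟩ := exists_nat_gt (2 * (κ : ℝ))
  have hinc : (fun ω : ℝ => Gr n ω - Gr (n + 1) ω) =o[𝓝[≠] 0] fun ω : ℝ => ω ^ κ := by
    have h1 := ((hGinc n).comp_tendsto ofReal_tendsto_doubleSector).neg_left
    have h2 : (fun ω : ℝ => Gr n ω - Gr (n + 1) ω) =O[𝓝[≠] 0]
        fun ω : ℝ => |ω| ^ (9 / 2 + n / 2 : ℝ) := by
      refine h1.congr' ?_ ?_
      · filter_upwards [self_mem_nhdsWithin] with ω hω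
        rw [hGr_eq _ _ hω, hGr_eq _ _ hω]
        simp
      · exact Eventually.of_forall fun ω => by simp
    refine h2.trans_isLittleO ?_
    have h3 : Tendsto (fun ω : ℝ => |ω|) (𝓝[≠] 0) (𝓝[>] 0) := by
      refine tendsto_nhdsWithin_of_tendsto_nhds_of_eventually_within _ ?_ ?_
      · exact (continuous_abs.tendsto' 0 0 abs_zero).mono_left nhdsWithin_le_nhds
      · filter_upwards [self_mem_nhdsWithin] with ω hω using abs_pos.2 hω
    have h4 : (0 : ℝ) < 9 / 2 + n / 2 - κ := by linarith
    have h5 : Tendsto (fun ω : ℝ => |ω| ^ (9 / 2 + n / 2 - κ : ℝ)) (𝓝[≠] 0) (𝓝 0) := by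
      have := (Real.continuousAt_rpow_const 0 _ (Or.inr h4.le)).tendsto
      rw [Real.zero_rpow h4.ne'] at this
      exact this.comp (h3.mono_right nhdsWithin_le_nhds)
    have h6 := ((isLittleO_one_iff ℝ).2 h5).mul_isBigO
      (isBigO_refl (fun ω : ℝ => |ω| ^ κ) (𝓝[≠] 0))
    refine (h6.congr' ?_ (Eventually.of_forall fun ω => one_mul _)).trans_isBigO ?_
    · filter_upwards [self_mem_nhdsWithin] with ω hω
      rw [← Real.rpow_intCast, ← Real.rpow_add (abs_pos.2 hω), sub_add_cancel]
    · refine IsBigO.of_bound 1 (Eventually.of_forall fun ω => ?_)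
      simp
  set g : ℕ → ℕ → ℝ → ℂ := fun i j ω => if i = j then
    c j * (if Even j then Gr n ω else starRingEnd ℂ (Gr n ω)) else low i j with hg
  -- The regular part is iterate `n + 1`, the top coefficients use iterate `n`. The expansion is
  -- then exact by definition of `step`, and the relation fails only by one increment.
  refine ⟨Gr (n + 1), g, hGrC _, fun i j => ?_, fun ω hω => ?_, fun i hi => ?_, fun i hi => ?_⟩
  · simp only [hg]
    split_ifs
    · exact contDiff_const.mul (hGrC n)
    · exact contDiff_const.mul (conjCLE.contDiff.comp (hGrC n))
    · exact contDiff_const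
  · rw [hGr_eq _ _ hω, hGsucc]
    have h1 : ∀ i ∈ Finset.Icc 1 4, ∑ j ∈ Finset.Icc 1 i,
        (2 * I * (ω : ℂ)) ^ i * log (2 * I * ω) ^ j * g i j ω =
        ∑ j ∈ Finset.Ico 1 i, (2 * I * (ω : ℂ)) ^ i * log (2 * I * ω) ^ j * low i j +
          (2 * I * (ω : ℂ)) ^ i * log (2 * I * ω) ^ i * (c i * schwarzReflect i (Gs n) ω) := by
      intro i hi
      rw [← Finset.Ico_insert_right (Finset.mem_Icc.1 hi).1,
        Finset.sum_insert Finset.right_notMem_Ico, add_comm]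
      congr 1
      · refine Finset.sum_congr rfl fun j hj => ?_
        have : i ≠ j := (Finset.mem_Ico.1 hj).2.ne'
        simp [hg, this]
      · simp [hg, schwarzReflect, hGr_eq n ω hω]
    rw [Finset.sum_congr rfl h1, Finset.sum_add_distrib]
    simp only [hstep, hLow]
    ring
  · have := hinc.const_mul_left (c i : ℂ)
    refine this.congr_left fun ω => ?_
    simp [hg, hi]
    ring
  · have h1 := (hinc.const_mul_left (c i : ℂ))
    refine (IsBigO.trans_isLittleO ?_ h1)
    refine IsBigO.of_bound 1 (Eventually.of_forall fun ω => ?_)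
    have hi' : ¬ Even i := Nat.not_even_iff_odd.2 hi
    simp only [hg, hi', if_true, if_false]
    rw [← mul_sub, ← map_sub, norm_mul, norm_mul, norm_conj, one_mul]

end LogExpansion

/-! ### Expansion of `exp(log z · G(z)) w(z)` in powers of `z log z`. -/

section ExpExpansion

open Complex

theorem AnalyticAt.exists_taylor {f : ℂ → ℂ} (hf : AnalyticAt ℂ f 0) :
    ∃ a : ℕ → ℂ, a 0 = f 0 ∧ ∀ n, (fun ω => f ω - ∑ k ∈ Finset.range n, a k * (2 * I * ω) ^ k)
      =O[𝓝 0] fun ω => ‖ω‖ ^ n := by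
  obtain ⟨p, hp⟩ := hf
  refine ⟨fun k => p.coeff k * ((2 * I) ^ k)⁻¹, ?_, fun n => ?_⟩
  · change p.coeff 0 * ((2 * I) ^ 0)⁻¹ = f 0
    rw [pow_zero, inv_one, mul_one]
    exact hp.coeff_zero _
  · refine (hp.isBigO_sub_partialSum_pow n).congr_left fun ω => ?_
    rw [zero_add, FormalMultilinearSeries.partialSum]
    congr 1
    refine Finset.sum_congr rfl fun k _ => ?_
    rw [FormalMultilinearSeries.apply_eq_pow_smul_coeff, smul_eq_mul, mul_pow]
    have : (2 * I : ℂ) ^ k ≠ 0 := pow_ne_zero _ (by simp)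
    field_simp

theorem exp_sub_sum_isBigO {A : Type*} [NormedRing A] [NormedAlgebra ℂ A] [CompleteSpace A]
    (n : ℕ) : (fun x : A => NormedSpace.exp x - ∑ j ∈ Finset.range n, ((j.factorial : ℂ)⁻¹) • x ^ j)
      =O[𝓝 0] fun x => ‖x‖ ^ n := by
  have h := (NormedSpace.exp_hasFPowerSeriesAt_zero (𝕂 := ℂ) (𝔸 := A)).isBigO_sub_partialSum_pow n
  refine h.congr_left fun x => ?_
  rw [zero_add, FormalMultilinearSeries.partialSum]
  simp only [NormedSpace.expSeries_apply_eq]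

theorem AnalyticAt.clm_apply' {f : ℂ → (ℂ × ℂ) →L[ℂ] (ℂ × ℂ)} {g : ℂ → ℂ × ℂ} {z : ℂ}
    (hf : AnalyticAt ℂ f z) (hg : AnalyticAt ℂ g z) : AnalyticAt ℂ (fun ω => f ω (g ω)) z := by
  rw [analyticAt_iff_eventually_differentiableAt] at *
  filter_upwards [hf, hg] with ω h1 h2 using h1.clm_apply h2

theorem smul_pow_clm_apply (t : ℂ) (N : (ℂ × ℂ) →L[ℂ] (ℂ × ℂ)) (j : ℕ) (x : ℂ × ℂ) :
    ((t • N) ^ j) x = t ^ j • (N ^ j) x := by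
  induction j with
  | zero => simp
  | succ j ih =>
    have h1 : ((t • N) ^ (j + 1)) x = t • N (((t • N) ^ j) x) := by
      rw [pow_succ']
      rfl
    rw [h1, ih, map_smul, smul_smul, ← pow_succ', pow_succ' N]
    rfl

/-- The expansion in powers of `z = 2iω` and `log z` of a function built from
`exp(log z · G(z)) w(z)`. -/
theorem exists_exp_expansion {Λ : ℂ → (ℂ × ℂ) →L[ℂ] ℂ} (hΛ : Differentiable ℂ Λ) {A : ℂ → ℂ}
    (hA : Differentiable ℂ A) (hA0 : A 0 = 0) {v : ℂ → ℂ × ℂ}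
    {G : ℂ → (ℂ × ℂ) →L[ℂ] (ℂ × ℂ)} {w : ℂ → ℂ × ℂ} {δ : ℝ} {m : ℂ} (hδ : 0 < δ)
    (hG : AnalyticAt ℂ G 0) (hG0 : G 0 = 0) (hG1 : HasDerivAt G (m • 1) 0)
    (hw : AnalyticAt ℂ w 0)
    (hv : ∀ ζ, ‖exp ζ‖ < δ → v ζ = NormedSpace.exp (ζ • G (exp ζ)) (w (exp ζ))) :
    ∃ h : ℕ → ℕ → ℂ, (∀ j, h j 0 = m ^ j / j.factorial * h 0 0) ∧
      (fun ω => Λ ω (v (log (2 * I * ω))) + A ω - ∑ j ∈ Finset.range 5,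
        ∑ k ∈ Finset.range (5 - j), h j k * ((2 * I * ω) ^ (j + k) * log (2 * I * ω) ^ j))
        =O[𝓝[doubleSector] 0] fun ω => ‖ω‖ ^ (9 / 2 : ℝ) := by
  have h2I : Tendsto (fun ω : ℂ => 2 * I * ω) (𝓝 0) (𝓝 0) :=
    (by fun_prop : Continuous fun ω : ℂ => 2 * I * ω).tendsto' 0 0 (mul_zero _)
  have h2Ia : AnalyticAt ℂ (fun ω : ℂ => 2 * I * ω) 0 :=
    (by fun_prop : Differentiable ℂ fun ω : ℂ => 2 * I * ω).analyticAt 0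
  -- `N = G(z) / z` is analytic because `G(0) = 0`, so `log z · G(z) = (z log z) N`.
  set N : ℂ → (ℂ × ℂ) →L[ℂ] (ℂ × ℂ) := fun ω => dslope G 0 (2 * I * ω) with hN
  have hNa : AnalyticAt ℂ N 0 := by
    obtain ⟨p, hp⟩ := hG
    have h1 : AnalyticAt ℂ (dslope G 0) (2 * I * 0) := by
      rw [mul_zero]; exact ⟨_, hp.has_fpower_series_dslope_fslope⟩
    exact h1.comp h2Ia
  have hN0 : N 0 = m • 1 := by simp [hN, hG1.deriv]
  have hGN : ∀ ω, G (2 * I * ω) = (2 * I * ω) • N ω := by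
    intro ω
    have := sub_smul_dslope G 0 (2 * I * ω)
    rw [sub_zero, hG0, sub_zero] at this
    exact this.symm
  set y : ℕ → ℂ → ℂ × ℂ := fun j ω => (N ω ^ j) (w (2 * I * ω)) with hy
  have hya : ∀ j, AnalyticAt ℂ (y j) 0 := by
    intro j
    induction j with
    | zero =>
      have h1 : AnalyticAt ℂ w (2 * I * 0) := by rwa [mul_zero]
      exact h1.comp h2Ia
    | succ j ih =>
      refine (hNa.clm_apply' ih).congr (Eventually.of_forall fun ω => ?_)
      simp only [hy, pow_succ']
      rfl
  set f : ℕ → ℂ → ℂ := fun j ω => Λ ω ((j.factorial : ℂ)⁻¹ • y j ω) + if j = 0 then A ω else 0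
    with hf
  have hfa : ∀ j, AnalyticAt ℂ (f j) 0 := by
    intro j
    refine AnalyticAt.add ?_ ?_
    · have h1 := hya j
      rw [analyticAt_iff_eventually_differentiableAt] at h1 ⊢
      filter_upwards [h1] with ω h1
      exact (hΛ ω).clm_apply (h1.const_smul (j.factorial : ℂ)⁻¹)
    · split_ifs
      · exact hA.analyticAt 0
      · exact analyticAt_const
  choose h hh0 hh using fun j => (hfa j).exists_taylor
  refine ⟨h, fun j => ?_, ?_⟩
  -- `N(0)` is the scalar `m`, and `A(0) = 0` leaves the leading coefficient of the term `j = 0`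
  -- unchanged.
  · have hpow : ∀ j, y j 0 = m ^ j • w 0 := by
      intro j
      induction j with
      | zero => simp [hy]
      | succ j ih =>
        have h1 : y (j + 1) 0 = N 0 (y j 0) := by
          simp only [hy, pow_succ']
          rfl
        rw [h1, ih, hN0, map_smul, pow_succ, mul_smul]
        rfl
    rw [hh0, hh0]
    simp only [hf, hpow, hA0, ite_self, add_zero, map_smul, smul_eq_mul]
    simp
    ring
  set t : ℂ → ℂ := fun ω => 2 * I * ω * log (2 * I * ω) with ht
  have ht1 : ∀ {s : ℝ}, s ≤ 9 / 10 → t =O[𝓝[doubleSector] 0] fun ω => ‖ω‖ ^ s := by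
    intro s hs
    have := pow_mul_log_pow_isBigO (m := 1) (j := 1) (s := s) (by norm_num; linarith)
    simpa only [pow_one] using this
  have hNb : N =O[𝓝[doubleSector] 0] fun _ => (1 : ℂ) :=
    (hNa.continuousAt.tendsto.mono_left nhdsWithin_le_nhds).isBigO_one ℂ
  have htN : (fun ω => t ω • N ω) =O[𝓝[doubleSector] 0] t := by
    have := (isBigO_refl t (𝓝[doubleSector] 0)).smul hNb
    refine this.trans (IsBigO.of_bound 1 (Eventually.of_forall fun ω => ?_))
    simp
  have htl : Tendsto t (𝓝[doubleSector] 0) (𝓝 0) := by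
    refine (ht1 (s := 9 / 10) le_rfl).trans_tendsto ?_
    have := (Real.continuousAt_rpow_const 0 (9 / 10) (Or.inr (by norm_num))).tendsto
    rw [Real.zero_rpow (by norm_num)] at this
    exact this.comp (tendsto_norm_doubleSector.mono_right nhdsWithin_le_nhds)
  -- The first omitted term is of size `|z log z|^5 = O(|ω|^{9/2})`.
  have hE : (fun ω => NormedSpace.exp (t ω • N ω) - ∑ j ∈ Finset.range 5,
      ((j.factorial : ℂ)⁻¹) • (t ω • N ω) ^ j) =O[𝓝[doubleSector] 0]
        fun ω => ‖ω‖ ^ (9 / 2 : ℝ) := by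
    refine ((exp_sub_sum_isBigO 5).comp_tendsto (htN.trans_tendsto htl)).trans ?_
    refine (htN.norm_left.pow 5).trans ?_
    have := pow_mul_log_pow_isBigO (m := 5) (j := 5) (s := 9 / 2) (by norm_num)
    simpa only [ht, mul_pow] using this
  have hmain : (fun ω => Λ ω (v (log (2 * I * ω))) + A ω - ∑ j ∈ Finset.range 5, t ω ^ j * f j ω)
      =O[𝓝[doubleSector] 0] fun ω => ‖ω‖ ^ (9 / 2 : ℝ) := by
    have hwb : (fun ω => w (2 * I * ω)) =O[𝓝[doubleSector] 0] fun _ => (1 : ℝ) :=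
      ((hw.continuousAt.tendsto.comp h2I).mono_left nhdsWithin_le_nhds).isBigO_one ℝ
    have hΛb : Λ =O[𝓝[doubleSector] 0] fun _ => (1 : ℝ) :=
      ((hΛ 0).continuousAt.tendsto.mono_left nhdsWithin_le_nhds).isBigO_one ℝ
    have h1 := (hΛb.norm_norm.mul (hE.norm_norm.mul hwb.norm_norm))
    refine IsBigO.trans ?_ (h1.congr_right (g₂ := fun ω => ‖ω‖ ^ (9 / 2 : ℝ)) fun ω => ?_)
    · refine IsBigO.of_bound 1 ?_
      have hsmall : ∀ᶠ ω in 𝓝[doubleSector] 0, ‖2 * I * ω‖ < δ := by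
        exact (h2I.norm.mono_left (nhdsWithin_le_nhds (s := doubleSector))).eventually_lt_const
          (show ‖(0 : ℂ)‖ < δ by simpa using hδ)
      filter_upwards [self_mem_nhdsWithin, hsmall] with ω hω hs
      have hz : 2 * I * ω ≠ 0 := slitPlane_ne_zero (two_I_mul_mem_slitPlane hω)
      have h2 := hv (log (2 * I * ω)) (by rwa [exp_log hz])
      rw [exp_log hz, hGN, smul_smul, mul_comm (log _)] at h2
      have h3 : Λ ω (v (log (2 * I * ω))) + A ω - ∑ j ∈ Finset.range 5, t ω ^ j * f j ω =
          Λ ω ((NormedSpace.exp (t ω • N ω) - ∑ j ∈ Finset.range 5,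
            ((j.factorial : ℂ)⁻¹) • (t ω • N ω) ^ j) (w (2 * I * ω))) := by
        have h4 : ∀ j, t ω ^ j * f j ω =
            Λ ω ((((j.factorial : ℂ)⁻¹) • (t ω • N ω) ^ j) (w (2 * I * ω))) +
              if j = 0 then A ω else 0 := by
          intro j
          have h6 : (((j.factorial : ℂ)⁻¹) • (t ω • N ω) ^ j) (w (2 * I * ω)) =
              t ω ^ j • ((j.factorial : ℂ)⁻¹) • y j ω := by
            rw [smul_apply, smul_pow_clm_apply, smul_comm]
          rw [h6, map_smul, smul_eq_mul]
          simp only [hf, mul_add]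
          congr 1
          split_ifs with h7
          · simp [h7]
          · simp
        rw [Finset.sum_congr rfl fun j _ => h4 j, Finset.sum_add_distrib, h2,
          Finset.sum_ite_eq' (Finset.range 5) 0, if_pos (by simp), sub_apply, map_sub,
          sum_apply, map_sum]
        ring
      rw [h3, one_mul, Real.norm_of_nonneg (by positivity)]
      refine ((Λ ω).le_opNorm _).trans ?_
      gcongr
      exact ContinuousLinearMap.le_opNorm _ _
    · rw [norm_one, one_mul, mul_one, Real.norm_of_nonneg (by positivity)]
  -- Each analytic coefficient is cut at degree `5 - j`, which keeps the total order below five.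
  have htail : (fun ω => ∑ j ∈ Finset.range 5, t ω ^ j *
      (f j ω - ∑ k ∈ Finset.range (5 - j), h j k * (2 * I * ω) ^ k)) =O[𝓝[doubleSector] 0]
        fun ω => ‖ω‖ ^ (9 / 2 : ℝ) := by
    refine IsBigO.fun_sum fun j hj => ?_
    have hj5 := Finset.mem_range.1 hj
    have hj4 : (j : ℝ) ≤ 4 := by exact_mod_cast (by omega : j ≤ 4)
    have h1 := pow_mul_log_pow_isBigO (m := j) (j := j) (s := j - j / 10) le_rfl
    refine (((h1.mul ((hh j (5 - j)).mono nhdsWithin_le_nhds)).congr_left fun ω => ?_).trans ?_)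
    · simp only [ht, mul_pow]
    · refine IsBigO.trans ?_ (norm_rpow_isBigO (s := 9 / 2) (t := 5 - j / 10) (by linarith))
      refine IsBigO.of_bound 1 ?_
      filter_upwards [tendsto_norm_doubleSector.eventually (Ioo_mem_nhdsGT one_pos)] with ω h2
      rw [one_mul, ← Real.rpow_natCast, ← Real.rpow_add h2.1, Nat.cast_sub hj5.le]
      refine le_of_eq ?_
      congr 2
      push_cast
      ring
  refine (hmain.add htail).congr_left fun ω => ?_
  simp only [mul_sub, Finset.sum_sub_distrib, Finset.mul_sum]
  have h3 : ∀ j k, t ω ^ j * (h j k * (2 * I * ω) ^ k) =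
      h j k * ((2 * I * ω) ^ (j + k) * log (2 * I * ω) ^ j) := by
    intro j k
    simp only [ht, mul_pow, pow_add]
    ring
  simp only [h3]
  ring

end ExpExpansion

/-! ### The expansion of the Jost solution. -/

section Expansion

open Complex

/-- The kernel is real and even in `ω`; only the initial exponential changes, to its conjugate. -/
theorem jostIter_neg (M ω : ℝ) (k : ℕ) (u : ℝ) :
    jostIter M (-ω) k u = starRingEnd ℂ (jostIter M ω k u) := by
  induction k generalizing u with
  | zero =>
    simp only [jostIter]
    rw [← exp_conj]
    simp
  | succ k ih =>
    rw [jostIter_succ, jostIter_succ, map_neg, ← integral_conj]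
    congr 2
    ext v
    rw [ih, map_mul, conj_ofReal]
    congr 2
    simp only [jostKernel, neg_mul, Real.sin_neg]
    rw [div_neg]
    ring

theorem jost_neg (M ω u : ℝ) : jost M (-ω) u = starRingEnd ℂ (jost M ω u) := by
  simp only [jost, jostIter_neg]
  exact (conj_tsum _).symm

/-- Powers of `log(2iω)` alone suffice, so the terms with `k > 0` are switched off. -/
theorem logSum_of_eq_zero (n : ℕ) (g : ℕ → ℕ → ℝ → ℝ → ℂ) (ω u : ℝ) :
    logSum n (fun i j k ω u => if k = 0 then g i j ω u else 0) ω u =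
      ∑ i ∈ Finset.Icc 1 n, ∑ j ∈ Finset.Icc 1 i,
        (2 * I * ω) ^ i * log (2 * I * ω) ^ j * g i j ω u := by
  unfold logSum
  refine Finset.sum_congr rfl fun i _ => Finset.sum_congr rfl fun m _ => ?_
  rw [Finset.sum_eq_single (m, 0)]
  · simp
  · intro p hp hpm
    have h1 := Finset.HasAntidiagonal.mem_antidiagonal.1 hp
    have h2 : p.2 ≠ 0 := by
      intro h0
      exact hpm (Prod.ext (by simpa [h0] using h1) h0)
    simp [h2]
  · intro h
    exact absurd (Finset.HasAntidiagonal.mem_antidiagonal.2 (by simp)) h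

/-- The leading coefficient of an expansion of a function with `F(-ω) = conj F(ω)` is real. -/
theorem conj_leading_coeff {F : ℂ → ℂ} {h : ℕ → ℕ → ℂ}
    (hexp : (fun ω => F ω - ∑ j ∈ Finset.range 5, ∑ k ∈ Finset.range (5 - j),
      h j k * ((2 * I * ω) ^ (j + k) * log (2 * I * ω) ^ j)) =O[𝓝[doubleSector] 0]
        fun ω => ‖ω‖ ^ (9 / 2 : ℝ))
    (hsym : ∀ ω : ℝ, ω ≠ 0 → F ((-ω : ℝ) : ℂ) = starRingEnd ℂ (F ω)) :
    starRingEnd ℂ (h 0 0) = h 0 0 := by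
  have h1 : (fun ω : ℂ => ∑ j ∈ Finset.range 5, ∑ k ∈ Finset.range (5 - j),
      (h j k * ((2 * I * ω) ^ (j + k) * log (2 * I * ω) ^ j) - if j + k = 0 then h 0 0 else 0))
        =O[𝓝[doubleSector] 0] fun ω => ‖ω‖ ^ (1 / 2 : ℝ) := by
    refine IsBigO.fun_sum fun j _ => IsBigO.fun_sum fun k _ => ?_
    split_ifs with h0
    · obtain ⟨rfl, rfl⟩ := Nat.add_eq_zero_iff.1 h0
      simpa using isBigO_zero _ _
    · simp only [sub_zero]
      refine (pow_mul_log_pow_isBigO ?_).const_mul_left _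
      have h2 : (1 : ℝ) ≤ j + k := by exact_mod_cast Nat.one_le_iff_ne_zero.2 h0
      have h3 : (0 : ℝ) ≤ j := j.cast_nonneg
      have h4 : (0 : ℝ) ≤ k := k.cast_nonneg
      push_cast
      linarith
  have h2 : (fun ω => F ω - h 0 0) =O[𝓝[doubleSector] 0] fun ω => ‖ω‖ ^ (1 / 2 : ℝ) := by
    refine ((hexp.trans (norm_rpow_isBigO (by norm_num))).add h1).congr_left fun ω => ?_
    simp only [Finset.sum_sub_distrib]
    have h3 : ∑ j ∈ Finset.range 5, ∑ k ∈ Finset.range (5 - j),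
        (if j + k = 0 then h 0 0 else 0) = h 0 0 := by
      simp [Finset.sum_range_succ]
    rw [h3]
    ring
  have h3 : Tendsto (fun ω : ℝ => F ω) (𝓝[≠] 0) (𝓝 (h 0 0)) := by
    have h4 : Tendsto (fun ω : ℂ => ‖ω‖ ^ (1 / 2 : ℝ)) (𝓝[doubleSector] 0) (𝓝 0) := by
      have := (Real.continuousAt_rpow_const 0 (1 / 2) (Or.inr (by norm_num))).tendsto
      rw [Real.zero_rpow (by norm_num)] at this
      exact this.comp (tendsto_norm_doubleSector.mono_right nhdsWithin_le_nhds)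
    exact tendsto_sub_nhds_zero_iff.1 ((h2.trans_tendsto h4).comp ofReal_tendsto_doubleSector)
  have h4 : Tendsto (fun ω : ℝ => -ω) (𝓝[≠] 0) (𝓝[≠] 0) := by
    refine tendsto_nhdsWithin_of_tendsto_nhds_of_eventually_within _ ?_ ?_
    · exact (continuous_neg.tendsto' 0 0 neg_zero).mono_left nhdsWithin_le_nhds
    · filter_upwards [self_mem_nhdsWithin] with ω hω using neg_ne_zero.2 hω
  have h5 : Tendsto (fun ω : ℝ => starRingEnd ℂ (F ω)) (𝓝[≠] 0) (𝓝 (h 0 0)) := by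
    refine (h3.comp h4).congr' ?_
    filter_upwards [self_mem_nhdsWithin] with ω hω using hsym ω hω
  exact tendsto_nhds_unique ((continuous_conj.tendsto _).comp h3) h5

/-- The expansion of a function built from static coordinates of the Jost solution. -/
theorem exists_static_log_expansion {Λ : ℂ → (ℂ × ℂ) →L[ℂ] ℂ} (hΛ : Differentiable ℂ Λ)
    {A : ℂ → ℂ} (hA : Differentiable ℂ A) (hA0 : A 0 = 0) {v : ℂ → ℂ × ℂ}
    (hvd : Differentiable ℂ v)
    {G : ℂ → (ℂ × ℂ) →L[ℂ] (ℂ × ℂ)} {w : ℂ → ℂ × ℂ} {δ m : ℝ} (hδ : 0 < δ)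
    (hG : AnalyticAt ℂ G 0) (hG0 : G 0 = 0) (hG1 : HasDerivAt G ((m : ℂ) • 1) 0)
    (hw : AnalyticAt ℂ w 0)
    (hv : ∀ ζ, ‖exp ζ‖ < δ → v ζ = NormedSpace.exp (ζ • G (exp ζ)) (w (exp ζ)))
    {F : ℝ → ℂ} (hF : ∀ ω : ℝ, ω ≠ 0 → F ω = Λ ω (v (log (2 * I * ω))) + A ω)
    (hsym : ∀ ω, ω ≠ 0 → F (-ω) = starRingEnd ℂ (F ω)) (κ : ℤ) :
    ∃ (G : ℝ → ℂ) (g : ℕ → ℕ → ℝ → ℂ), ContDiff ℝ 4 G ∧ (∀ i j, ContDiff ℝ 4 (g i j)) ∧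
      (∀ ω : ℝ, ω ≠ 0 → F ω = G ω + ∑ i ∈ Finset.Icc 1 4, ∑ j ∈ Finset.Icc 1 i,
        (2 * I * ω) ^ i * log (2 * I * ω) ^ j * g i j ω) ∧
      (∀ i, Even i → (fun ω : ℝ => g i i ω - (m ^ i / i.factorial : ℝ) * G ω)
        =o[𝓝[≠] 0] fun ω : ℝ => ω ^ κ) ∧
      ∀ i, Odd i → (fun ω : ℝ => g i i ω - (m ^ i / i.factorial : ℝ) * starRingEnd ℂ (G ω))
        =o[𝓝[≠] 0] fun ω : ℝ => ω ^ κ := by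
  obtain ⟨h, hh, hexp⟩ := exists_exp_expansion hΛ hA hA0 hδ hG hG0 hG1 hw hv
  have hd : DifferentiableOn ℂ (fun ω => Λ ω (v (log (2 * I * ω))) + A ω) doubleSector := by
    intro ω hω
    have h1 : DifferentiableAt ℂ (fun ω => log (2 * I * ω)) ω :=
      DifferentiableAt.clog (by fun_prop) (two_I_mul_mem_slitPlane hω)
    have h2 : DifferentiableAt ℂ (fun ω => v (log (2 * I * ω))) ω :=
      (hvd (log (2 * I * ω))).fun_comp' ω (f := fun ω => log (2 * I * ω)) h1
    exact (((hΛ ω).clm_apply h2).add (hA ω)).differentiableWithinAt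
  have hreal := conj_leading_coeff hexp fun ω hω => by
    rw [← hF _ (neg_ne_zero.2 hω), ← hF _ hω, hsym ω hω]
  obtain ⟨G', g, h1, h2, h3, h4, h5⟩ := exists_log_expansion hd
    (c := fun j => m ^ j / j.factorial) hexp (fun j => by rw [hh]; push_cast; rfl) hreal κ
  exact ⟨G', g, h1, h2, fun ω hω => by rw [hF ω hω, h3 ω hω], h4, h5⟩

/-- The small-energy expansion of the Jost solution and of its derivative. -/
theorem exists_jost_log_expansion {M : ℝ} (hM : 0 < M) (κ : ℤ) (u : ℝ) :
    ∃ (G H : ℝ → ℂ) (g h : ℕ → ℕ → ℝ → ℂ),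
      (ContDiff ℝ 4 G ∧ ContDiff ℝ 4 H ∧ ∀ i j, ContDiff ℝ 4 (g i j) ∧ ContDiff ℝ 4 (h i j)) ∧
      (∀ ω : ℝ, ω ≠ 0 →
        jost M ω u = G ω + ∑ i ∈ Finset.Icc 1 4, ∑ j ∈ Finset.Icc 1 i,
          (2 * I * ω) ^ i * log (2 * I * ω) ^ j * g i j ω ∧
        HasDerivAt (jost M ω) (-(I * ω) * exp (-(I * ω * u)) + H ω +
          ∑ i ∈ Finset.Icc 1 4, ∑ j ∈ Finset.Icc 1 i,
            (2 * I * ω) ^ i * log (2 * I * ω) ^ j * h i j ω) u) ∧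
      (∀ i, Even i →
        (fun ω : ℝ => g i i ω - (M ^ i / i.factorial : ℝ) * G ω)
          =o[𝓝[≠] 0] (fun ω : ℝ => ω ^ κ) ∧
        (fun ω : ℝ => h i i ω - (M ^ i / i.factorial : ℝ) * H ω)
          =o[𝓝[≠] 0] (fun ω : ℝ => ω ^ κ)) ∧
      ∀ i, Odd i →
        (fun ω : ℝ => g i i ω - (M ^ i / i.factorial : ℝ) * starRingEnd ℂ (G ω))
          =o[𝓝[≠] 0] (fun ω : ℝ => ω ^ κ) ∧
        (fun ω : ℝ => h i i ω - (M ^ i / i.factorial : ℝ) * starRingEnd ℂ (H ω))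
          =o[𝓝[≠] 0] (fun ω : ℝ => ω ^ κ) := by
  obtain ⟨P, Q, v, hP, hQ, hv, ⟨E, w, δ, hδ, hE, hE0, hE1, hw, hvw⟩, hj⟩ :=
    exists_jost_representation hM
  have hsq : Differentiable ℂ fun ω : ℂ => -ω ^ 2 := by fun_prop
  have hP' : Differentiable ℂ fun ω : ℂ => P u (-ω ^ 2) := (hP u).comp hsq
  have hQ' : Differentiable ℂ fun ω : ℂ => Q u (-ω ^ 2) := (hQ u).comp hsq
  obtain ⟨G, g, hG, hg, hGg, hge, hgo⟩ := exists_static_log_expansion (F := fun ω => jost M ω u)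
    hP' (differentiable_const 0) rfl hv hδ hE hE0 hE1 hw hvw
    (fun ω hω => by rw [(hj ω hω u).1, add_zero]) (fun ω _ => jost_neg M ω u) κ
  have hderiv : ∀ ω : ℝ, ω ≠ 0 → deriv (jost M ω) u = Q u (-ω ^ 2) (v (log (2 * I * ω))) :=
    fun ω hω => (hj ω hω u).2.deriv
  -- The free part of the derivative is moved to the left; it is entire in `ω` and vanishes at `0`,
  -- as required of `A`.
  obtain ⟨H, h, hH, hh, hHh, hhe, hho⟩ := exists_static_log_expansion
    (F := fun ω => deriv (jost M ω) u + I * ω * exp (-(I * ω * u)))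
    (A := fun ω => I * ω * exp (-(I * ω * u))) hQ' (by fun_prop) (by simp) hv hδ hE hE0 hE1 hw hvw
    (fun ω hω => by rw [hderiv ω hω]) (fun ω hω => by
      have h1 : jost M (-ω) = fun u => starRingEnd ℂ (jost M ω u) := funext (jost_neg M ω)
      have h2 : HasDerivAt (fun u => starRingEnd ℂ (jost M ω u))
          (starRingEnd ℂ (deriv (jost M ω) u)) u :=
        (conjCLE.toContinuousLinearMap.hasFDerivAt (x := jost M ω u)).comp_hasDerivAt u
          (hj ω hω u).2.differentiableAt.hasDerivAt
      rw [h1, h2.deriv, map_add, map_mul, map_mul, ← exp_conj]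
      simp) κ
  refine ⟨G, H, g, h, ⟨hG, hH, fun i j => ⟨hg i j, hh i j⟩⟩, fun ω hω => ⟨hGg ω hω, ?_⟩,
    fun i hi => ⟨hge i hi, hhe i hi⟩, fun i hi => ⟨hgo i hi, hho i hi⟩⟩
  have h1 := (hj ω hω u).2.differentiableAt.hasDerivAt
  refine h1.congr_deriv ?_
  linear_combination hHh ω hω

end Expansion

end

theorem mainTheorem6 (M : ℝ) (hM : 0 < M) :
    ∃ c : ℕ → ℕ → ℕ → ℝ, ∀ κ : ℤ,
      ∃ (g₀ h₀ : ℝ → ℝ → ℂ) (g h : ℕ → ℕ → ℕ → ℝ → ℝ → ℂ), ∀ u : ℝ,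
        -- the coefficient functions are of class C⁴ with respect to ω
        (ContDiff ℝ 4 (fun ω => g₀ ω u) ∧ ContDiff ℝ 4 (fun ω => h₀ ω u) ∧
          ∀ i j k : ℕ, 1 ≤ j + k → j + k ≤ i → i ≤ 4 →
            ContDiff ℝ 4 (fun ω => g i j k ω u) ∧ ContDiff ℝ 4 (fun ω => h i j k ω u)) ∧
        -- the expansions of the Jost solution and of its u-derivative
        (∀ ω : ℝ, ω ≠ 0 →
          jost M ω u = Complex.exp (-(Complex.I * ω * u)) + g₀ ω u + logSum 4 g ω u ∧
          HasDerivAt (jost M ω)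
            (-(Complex.I * ω) * Complex.exp (-(Complex.I * ω * u)) + h₀ ω u + logSum 4 h ω u)
            u) ∧
        -- the coefficients of highest logarithmic order
        (∀ i j k : ℕ, 1 ≤ i → i ≤ 4 → i = j + k →
          (Even i →
            (fun ω : ℝ => g i j k ω u -
                c i j k * (Complex.exp (-(Complex.I * ω * u)) + g₀ ω u))
              =o[𝓝[≠] 0] (fun ω : ℝ => ω ^ κ) ∧
            (fun ω : ℝ => h i j k ω u - c i j k * h₀ ω u) =o[𝓝[≠] 0] (fun ω : ℝ => ω ^ κ)) ∧
          (Odd i →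
            (fun ω : ℝ => g i j k ω u -
                c i j k * (Complex.exp (Complex.I * ω * u) + starRingEnd ℂ (g₀ ω u)))
              =o[𝓝[≠] 0] (fun ω : ℝ => ω ^ κ) ∧
            (fun ω : ℝ => h i j k ω u - c i j k * starRingEnd ℂ (h₀ ω u))
              =o[𝓝[≠] 0] (fun ω : ℝ => ω ^ κ))) := by
  -- These are the coefficients of `exp(M z log z)`, placed at `k = 0`.
  refine ⟨fun i _ k => if k = 0 then M ^ i / i.factorial else 0, fun κ => ?_⟩
  choose G H g h hC hexp heven hodd using exists_jost_log_expansion hM κ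
  -- With this choice `e^{-iωu} + g₀` is exactly the regular part `G`; for the derivative `H` itself
  -- serves as `h₀`.
  refine ⟨fun ω u => G u ω - Complex.exp (-(Complex.I * ω * u)), fun ω u => H u ω,
    fun i j k ω u => if k = 0 then g u i j ω else 0, fun i j k ω u => if k = 0 then h u i j ω else 0,
    fun u => ⟨⟨?_, (hC u).2.1, fun i j k _ _ _ => ?_⟩, fun ω hω => ?_,
      fun i j k _ _ hijk => ⟨fun hi => ?_, fun hi => ?_⟩⟩⟩
  · refine (hC u).1.sub ?_
    have : ContDiff ℝ 4 fun ω : ℝ => (ω : ℂ) := Complex.ofRealCLM.contDiff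
    fun_prop
  · by_cases hk : k = 0
    · simpa only [hk, if_true] using (hC u).2.2 i j
    · simpa only [hk, if_false] using ⟨contDiff_const, contDiff_const⟩
  · rw [logSum_of_eq_zero 4 fun i j ω u => g u i j ω, logSum_of_eq_zero 4 fun i j ω u => h u i j ω,
      add_sub_cancel]
    exact hexp u ω hω
  · by_cases hk : k = 0
    · subst hk
      obtain rfl : i = j := hijk
      simpa only [if_true, add_sub_cancel] using heven u i hi
    · simp only [hk, if_false, Complex.ofReal_zero, zero_mul, sub_zero]
      exact ⟨isLittleO_zero _ _, isLittleO_zero _ _⟩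
  · by_cases hk : k = 0
    · subst hk
      obtain rfl : i = j := hijk
      have hconj : ∀ ω : ℝ, Complex.exp (Complex.I * ω * u) +
          starRingEnd ℂ (G u ω - Complex.exp (-(Complex.I * ω * u))) = starRingEnd ℂ (G u ω) := by
        intro ω
        rw [map_sub, ← Complex.exp_conj]
        simp
      simpa only [if_true, hconj] using hodd u i hi
    · simp only [hk, if_false, Complex.ofReal_zero, zero_mul, sub_zero]
      exact ⟨isLittleO_zero _ _, isLittleO_zero _ _⟩
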